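/- A lattice polygon is the convex hull $P\subset\mathbb R^2$ of finitely many points of $\mathbb Z^2$, with $\dim P=2$; for $S\subset\mathbb R^2$ let $\mathrm G(S)=\#(S\cap\mathbb Z^2)$. The Ehrhart polynomial of $P$ is the polynomial $\mathrm G(s,P)$ with $\mathrm G(k,P)=\mathrm G(kP)$ for all integers $k\ge 1$; its roots in $\mathbb C$ are called the roots of $P$. Let $\Gamma(2,l)$ be the set of all roots of lattice polygons $P$ with $\mathrm G(\mathrm{int}\,P)=l$, and let $\Gamma(2)=\bigcup_{l\ge 0}\Gamma(2,l)$. Then: (i) For every lattice polygon $P$, each non-real root $s$ of $P$ satisfies $\left|s+\frac{2}{\mathrm G(\mathrm{bd}\,P)}\right|=\frac{2}{\mathrm G(\mathrm{bd}\,P)}$. (ii) All roots of a lattice polygon $P$ are real if and only if $\left(\frac{\mathrm G(\mathrm{bd}\,P)}{4}-1\right)^2\ge \mathrm G(\mathrm{int}\,P)$. (iii) $\Gamma(2)\subset\{-2,-1,-\frac23\}\cup\left\{s\in\mathbb C: -\frac12\le\operatorname{Re}s<0,\ \left|s+\frac23\right|\le\frac23\right\}$. (iv) The set of cluster points (accumulation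 points) of $\Gamma(2)$ in $\mathbb C$ is the real interval $[-\frac12,0]$. (v) $\Gamma(2,0)=\{-1\}\cup\{-2/l: l\in\mathbb Z,\ l\ge 1\}$. (vi) The set of $s\in\Gamma(2)$ with $\operatorname{Re}s=-\frac12$ equals the set of all roots of lattice polygons $P$ with $\mathrm G(\mathrm{int}\,P)=1$ and $\mathrm G(\mathrm{bd}\,P)\le 8$. Moreover, a lattice polygon $P$ has all its roots on the line $\operatorname{Re}s=-\frac12$ if and only if $\mathrm G(\mathrm{int}\,P)=1$ and $\mathrm G(\mathrm{bd}\,P)\le 8$. Up to affine unimodular maps $x\mapsto Ax+b$ ($A\in GL_2(\mathbb Z)$, $b\in\mathbb Z^2$) there is exactly one remaining lattice polygon with $\mathrm G(\mathrm{int}\,P)=1$, i.e. one with $\mathrm G(\mathrm{bd}\,P)>8$; every such polygon has $\mathrm G(\mathrm{bd}\,P)=9$, and its roots are $-\frac23$ and $-\frac13$. -/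

import Mathlib

open scoped Pointwise

namespace Ehrhart

/-- The point of `ℝⁿ` with the given integer coordinates. Only the vector space structure and the
(product = Euclidean) topology of `ℝⁿ` are used below, so `ℝⁿ` is `Fin n → ℝ`. -/
def latticePoint {n : ℕ} (z : Fin n → ℤ) : Fin n → ℝ := fun i => (z i : ℝ)

/-- The lattice point enumerator `G(S) = #(S ∩ ℤⁿ)`; it is only used for bounded `S`. -/
noncomputable def latticeCount {n : ℕ} (S : Set (Fin n → ℝ)) : ℕ :=
  {z : Fin n → ℤ | latticePoint z ∈ S}.ncard

/-- The class `𝒫ⁿ` of convex lattice `n`-polytopes in `ℝⁿ`: convex hulls of finitely many points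
of `ℤⁿ`, of dimension `n`. -/
def IsLatticePolytope {n : ℕ} (P : Set (Fin n → ℝ)) : Prop :=
  (∃ V : Finset (Fin n → ℤ), P = convexHull ℝ (latticePoint '' (V : Set (Fin n → ℤ)))) ∧
    affineSpan ℝ P = ⊤

/-- `p` is the counting polynomial of `P`: `G(k P) = p(k)` for all positive integers `k`. -/
def IsEhrhartPolynomial {n : ℕ} (P : Set (Fin n → ℝ)) (p : Polynomial ℝ) : Prop :=
  ∀ k : ℕ, 1 ≤ k → p.eval (k : ℝ) = (latticeCount ((k : ℝ) • P) : ℝ)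

open Classical in
/-- The Ehrhart polynomial `G(s, P)`, i.e. the polynomial `p` such that `G(k P) = p(k)` for all
positive integers `k`. It is unique by the lemma below. If there were no such polynomial, the value
would be `0`, and every complex number would count as a root. -/
noncomputable def ehrhartPolynomial {n : ℕ} (P : Set (Fin n → ℝ)) : Polynomial ℝ :=
  if h : ∃ p : Polynomial ℝ, IsEhrhartPolynomial P p then h.choose else 0

theorem IsEhrhartPolynomial.eq_ehrhartPolynomial {n : ℕ} {P : Set (Fin n → ℝ)}
    {p : Polynomial ℝ} (hp : IsEhrhartPolynomial P p) : ehrhartPolynomial P = p := by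
  have h : ∃ p : Polynomial ℝ, IsEhrhartPolynomial P p := ⟨p, hp⟩
  have hq : IsEhrhartPolynomial P (ehrhartPolynomial P) := by
    unfold ehrhartPolynomial
    rw [dif_pos h]
    exact h.choose_spec
  apply Polynomial.eq_of_infinite_eval_eq
  have hinf : ((fun k : ℕ => (k : ℝ)) '' Set.Ici 1).Infinite :=
    (Set.Ici_infinite 1).image Nat.cast_injective.injOn
  refine hinf.mono ?_
  rintro _ ⟨k, hk, rfl⟩
  exact (hq k hk).trans (hp k hk).symm

/-- The complex roots of the Ehrhart polynomial of `P`. -/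
def ehrhartRoots {n : ℕ} (P : Set (Fin n → ℝ)) : Set ℂ :=
  {s : ℂ | Polynomial.aeval s (ehrhartPolynomial P) = 0}

/-- `Γ(n, l)`: the roots of the Ehrhart polynomials of the lattice `n`-polytopes with exactly `l`
interior lattice points. -/
def rootsWithInterior (n l : ℕ) : Set ℂ :=
  {s : ℂ | ∃ P : Set (Fin n → ℝ),
    IsLatticePolytope P ∧ latticeCount (interior P) = l ∧ s ∈ ehrhartRoots P}

/-- `Γ(n) = ⋃ₗ Γ(n, l)`, the union over all `l ≥ 0`. -/
def allRoots (n : ℕ) : Set ℂ := ⋃ l : ℕ, rootsWithInterior n l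

/-- Equivalence under the affine unimodular maps `x ↦ A x + b`, with `A ∈ GLₙ(ℤ)`, `b ∈ ℤⁿ`. -/
def UnimodularEquivalent {n : ℕ} (P Q : Set (Fin n → ℝ)) : Prop :=
  ∃ (A : Matrix (Fin n) (Fin n) ℤ) (b : Fin n → ℤ), IsUnit A.det ∧
    Q = (fun x : Fin n → ℝ => (A.map (fun a : ℤ => (a : ℝ))).mulVec x + latticePoint b) '' P

end Ehrhart

/-!
The theorem reduces to three facts about a lattice polygon `P` with `i` interior and `b` boundary
lattice points.

* **Pick and Ehrhart** (`IsLatticePolytope.hasPick`, `IsLatticePolytope.mem_ehrhartRoots_iff`): the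
  Ehrhart polynomial is `A s² + (b / 2) s + 1` with `A = i + b / 2 - 1`. Half-open parallelograms
  are counted by strips, and the point reflection of a parallelogram in its centre then gives the
  count in a triangle, where the dilation factor occurs as a parameter. A polygon with more than
  three vertices is cut along a diagonal (`HasPick.of_cut`), and the induction is on the number of
  vertices.

* **Scott's inequality** (`IsLatticePolytope.scott`): if `i ≥ 1`, then `b ≤ 2 i + 6`, except for the
  polygons with `i = 1` and `b = 9`, all of which are equivalent to three times the standard
  triangle. Among all unimodular images of `P`, one of least height is considered. Its top and
  bottom edges bound `b` from above by the number of rows, and also bound the area from below. A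
  suitable shear, together with the minimality of the height, excludes the remaining cases.

* **Examples**: the triangles with vertices `(0, 0)`, `(l, 0)`, `(0, 1)` have no interior lattice
  point and the roots `-1` and `-2 / l` (`exists_thin_triangle`). A family of quadrilaterals
  (`exists_quadrilateral`) provides the roots in the real interval `[-1/2, 0]`.

The rest is the discussion of a quadratic equation. A non-real root has real part `-b / (4 A)` and
squared absolute value `1 / A`, which puts it on the circle around `-2 / b` through the origin.
Scott's inequality says that `A s² + (b / 2) s + 1` is nonnegative at `-1/2`, so that the roots lie
to the right of the line `Re s = -1/2`; on this line, a non-real root forces `i = 1`. Non-real roots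
accumulate only at the origin, since there are only finitely many Ehrhart polynomials with a given
bound on `A` (`finite_roots_away`). By the intermediate value theorem, the real roots are dense in
`[-1/2, 0]` (`exists_root_between`).
-/

namespace Ehrhart

/-! ### Counting lattice points in a triangle -/

/-- The determinant of the `2 × 2` matrix with columns `u` and `v`. -/
def cross {R : Type*} [CommRing R] (u v : Fin 2 → R) : R := u 0 * v 1 - u 1 * v 0

theorem cross_add_left {R : Type*} [CommRing R] (u u' v : Fin 2 → R) :
    cross (u + u') v = cross u v + cross u' v := by
  simp only [cross, Pi.add_apply]; ring

theorem cross_add_right {R : Type*} [CommRing R] (u v v' : Fin 2 → R) :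
    cross u (v + v') = cross u v + cross u v' := by
  simp only [cross, Pi.add_apply]; ring

theorem cross_sub_left {R : Type*} [CommRing R] (u u' v : Fin 2 → R) :
    cross (u - u') v = cross u v - cross u' v := by
  simp only [cross, Pi.sub_apply]; ring

theorem cross_sub_right {R : Type*} [CommRing R] (u v v' : Fin 2 → R) :
    cross u (v - v') = cross u v - cross u v' := by
  simp only [cross, Pi.sub_apply]; ring

theorem cross_smul_left {R : Type*} [CommRing R] (k : R) (u v : Fin 2 → R) :
    cross (k • u) v = k * cross u v := by
  simp only [cross, Pi.smul_apply, smul_eq_mul]; ring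

theorem cross_smul_right {R : Type*} [CommRing R] (k : R) (u v : Fin 2 → R) :
    cross u (k • v) = k * cross u v := by
  simp only [cross, Pi.smul_apply, smul_eq_mul]; ring

theorem cross_self {R : Type*} [CommRing R] (u : Fin 2 → R) : cross u u = 0 := by
  simp only [cross]; ring

/-- Cramer's rule. -/
theorem cross_smul_eq {R : Type*} [CommRing R] (u v z : Fin 2 → R) :
    cross u v • z = cross z v • u + cross u z • v := by
  ext i
  fin_cases i <;> simp [cross] <;> ring

theorem ncard_image_add {C : Set (Fin 2 → ℤ)} (e : Fin 2 → ℤ) :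
    ((fun z => z + e) '' C).ncard = C.ncard :=
  Set.ncard_image_of_injective _ (add_left_injective e)

/-- A set of lattice points that is invariant under a translation `e` is cut by the translates of
a fundamental strip into pieces of equal cardinality. -/
theorem ncard_strip {X : (Fin 2 → ℤ) → ℤ} {D : ℤ} (hD : 0 < D) {C : Set (Fin 2 → ℤ)}
    {e : Fin 2 → ℤ} (hC : ∀ z, z + e ∈ C ↔ z ∈ C) (hX : ∀ z, X (z + e) = X z + D)
    (hfin : ∀ M, {z | z ∈ C ∧ 0 ≤ X z ∧ X z < M}.Finite) (k : ℕ) :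
    {z | z ∈ C ∧ 0 ≤ X z ∧ X z < k * D}.ncard
      = k * {z | z ∈ C ∧ 0 ≤ X z ∧ X z < D}.ncard := by
  induction k with
  | zero =>
    have : {z | z ∈ C ∧ 0 ≤ X z ∧ X z < ((0 : ℕ) : ℤ) * D} = ∅ := by
      ext z
      simp only [Set.mem_ofPred_eq, Set.mem_empty_iff_false, iff_false]
      rintro ⟨-, h1, h2⟩
      simp at h2
      omega
    rw [this]; simp
  | succ k ih =>
    have hsplit : {z | z ∈ C ∧ 0 ≤ X z ∧ X z < ((k + 1 : ℕ) : ℤ) * D}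
        = {z | z ∈ C ∧ 0 ≤ X z ∧ X z < D}
          ∪ (fun z => z + e) '' {z | z ∈ C ∧ 0 ≤ X z ∧ X z < k * D} := by
      ext z
      simp only [Set.mem_union, Set.mem_ofPred_eq, Set.mem_image]
      have hkD : ((k + 1 : ℕ) : ℤ) * D = k * D + D := by push_cast; ring
      have hk0 : 0 ≤ (k : ℤ) * D := by positivity
      rw [hkD]
      constructor
      · rintro ⟨h1, h2, h3⟩
        by_cases h : X z < D
        · exact Or.inl ⟨h1, h2, h⟩
        · right
          have hX' := hX (z - e)
          have hC' := hC (z - e)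
          rw [sub_add_cancel] at hX' hC'
          exact ⟨z - e, ⟨hC'.1 h1, by omega, by omega⟩, sub_add_cancel z e⟩
      · rintro (⟨h1, h2, h3⟩ | ⟨z, ⟨h1, h2, h3⟩, rfl⟩)
        · exact ⟨h1, h2, by omega⟩
        · rw [hX]
          exact ⟨(hC z).2 h1, by omega, by omega⟩
    rw [hsplit, Set.ncard_union_eq _ (hfin D) ((hfin _).image _), ncard_image_add, ih]
    · ring
    · rw [Set.disjoint_left]
      rintro z ⟨-, -, h3⟩ ⟨z, ⟨-, h2, -⟩, rfl⟩
      rw [hX] at h3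
      omega

theorem finite_cross_box {u v : Fin 2 → ℤ} (hD : 0 < cross u v) (M N : ℤ) :
    {z | 0 ≤ cross z v ∧ cross z v ≤ M ∧ 0 ≤ cross u z ∧ cross u z ≤ N}.Finite := by
  apply Set.Finite.of_finite_image (f := fun z => (cross z v, cross u z))
  · apply ((Set.finite_Icc (0 : ℤ) M).prod (Set.finite_Icc (0 : ℤ) N)).subset
    rintro _ ⟨z, ⟨h1, h2, h3, h4⟩, rfl⟩
    exact ⟨⟨h1, h2⟩, ⟨h3, h4⟩⟩
  · rintro z - z' - h
    simp only [Prod.mk.injEq] at h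
    have h1 := cross_smul_eq u v z
    have h2 := cross_smul_eq u v z'
    rw [h.1, h.2, ← h2] at h1
    exact smul_right_injective _ hD.ne' h1

/-- A half-open fundamental parallelogram of `ℤu + ℤv` has `det (u, v)` lattice points. -/
theorem ncard_parallelogram {u v : Fin 2 → ℤ} (hD : 0 < cross u v) :
    ({z | (0 ≤ cross u z ∧ cross u z < cross u v) ∧ 0 ≤ cross z v ∧ cross z v < cross u v}.ncard : ℤ)
      = cross u v := by
  set M : Matrix (Fin 2) (Fin 2) ℤ := !![u 0, v 0; u 1, v 1] with hM
  have hdet : M.det = cross u v := by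
    rw [hM, Matrix.det_fin_two_of]; simp only [cross]; ring
  have happ : ∀ c : Fin 2 → ℤ, Matrix.toLin' M c = c 0 • u + c 1 • v := by
    intro c
    ext i
    fin_cases i <;> simp [hM, Matrix.mulVec, dotProduct, Fin.sum_univ_two] <;> ring
  have hcu : ∀ c : Fin 2 → ℤ, cross (Matrix.toLin' M c) v = c 0 * cross u v := by
    intro c
    rw [happ, cross_add_left, cross_smul_left, cross_smul_left, cross_self]; ring
  have hcv : ∀ c : Fin 2 → ℤ, cross u (Matrix.toLin' M c) = c 1 * cross u v := by
    intro c
    rw [happ, cross_add_right, cross_smul_right, cross_smul_right, cross_self]; ring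
  have hinj : Function.Injective (Matrix.toLin' M) := by
    intro c c' h
    have h0 := hcu c
    have h1 := hcv c
    rw [h, hcu] at h0
    rw [h, hcv] at h1
    ext i
    fin_cases i
    · exact (mul_right_cancel₀ hD.ne' h0).symm
    · exact (mul_right_cancel₀ hD.ne' h1).symm
  set e := LinearEquiv.ofInjective (Matrix.toLin' M) hinj
  have hcard := Submodule.natAbs_det_equiv (LinearMap.range (Matrix.toLin' M)) e
  have hcomp : (LinearMap.range (Matrix.toLin' M)).subtype ∘ₗ
      AddMonoidHom.toIntLinearMap (e : (Fin 2 → ℤ) →+ LinearMap.range (Matrix.toLin' M))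
        = Matrix.toLin' M := by
    ext1; rfl
  rw [hcomp, LinearMap.det_toLin', hdet] at hcard
  have hbij : Nat.card {z // z ∈ {z | (0 ≤ cross u z ∧ cross u z < cross u v) ∧
      0 ≤ cross z v ∧ cross z v < cross u v}}
        = Nat.card ((Fin 2 → ℤ) ⧸ LinearMap.range (Matrix.toLin' M)) := by
    apply Nat.card_eq_of_bijective (fun z => Submodule.Quotient.mk z.1)
    constructor
    · rintro ⟨z, ⟨h1, h2⟩, h3, h4⟩ ⟨z', ⟨h1', h2'⟩, h3', h4'⟩ h
      simp only [Submodule.Quotient.eq] at h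
      obtain ⟨c, hc⟩ := h
      have e1 := hcu c
      have e2 := hcv c
      rw [hc, cross_sub_left] at e1
      rw [hc, cross_sub_right] at e2
      have hz : ∀ t : ℤ, -cross u v < t * cross u v → t * cross u v < cross u v → t = 0 := by
        intro t ht1 ht2
        have : t < 1 := by nlinarith
        have : -1 < t := by nlinarith
        omega
      have c0 : c = 0 := by
        ext i
        fin_cases i
        · exact hz (c 0) (by omega) (by omega)
        · exact hz (c 1) (by omega) (by omega)
      rw [c0, map_zero] at hc
      exact Subtype.ext (sub_eq_zero.1 hc.symm)
    · intro q
      obtain ⟨z, rfl⟩ := Submodule.Quotient.mk_surjective _ q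
      set c : Fin 2 → ℤ := ![cross z v / cross u v, cross u z / cross u v] with hc
      have e1 := hcu c
      have e2 := hcv c
      simp only [hc, Matrix.cons_val_zero, Matrix.cons_val_one] at e1 e2
      rw [← hc] at e1 e2
      have m1 := Int.emod_add_mul_ediv (cross z v) (cross u v)
      have m2 := Int.emod_add_mul_ediv (cross u z) (cross u v)
      have b1 := Int.emod_nonneg (cross z v) hD.ne'
      have b2 := Int.emod_nonneg (cross u z) hD.ne'
      have b3 := Int.emod_lt_of_pos (cross z v) hD
      have b4 := Int.emod_lt_of_pos (cross u z) hD
      refine ⟨⟨z - Matrix.toLin' M c, ⟨?_, ?_⟩, ?_, ?_⟩, ?_⟩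
      · rw [cross_sub_right, e2]; linarith
      · rw [cross_sub_right, e2]; linarith
      · rw [cross_sub_left, e1]; linarith
      · rw [cross_sub_left, e1]; linarith
      · simp only [Submodule.Quotient.eq]
        exact ⟨-c, by rw [map_neg]; abel⟩
  rw [← Nat.card_coe_set_eq]
  change ((Nat.card {z // z ∈ _} : ℕ) : ℤ) = _
  rw [hbij, ← hcard]
  exact Int.natAbs_of_nonneg hD.le

theorem ncard_image_sub {C : Set (Fin 2 → ℤ)} (e : Fin 2 → ℤ) :
    ((fun z => e - z) '' C).ncard = C.ncard :=
  Set.ncard_image_of_injective _ sub_right_injective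

section Edges

variable {u v : Fin 2 → ℤ}

theorem ncard_edge_left (hD : 0 < cross u v) (k : ℕ) :
    {z | cross u z = 0 ∧ 0 ≤ cross z v ∧ cross z v < k * cross u v}.ncard
      = k * {z | cross u z = 0 ∧ 0 ≤ cross z v ∧ cross z v < cross u v}.ncard := by
  refine ncard_strip (X := fun z => cross z v) (C := {z | cross u z = 0}) (e := u) hD ?_ ?_ ?_ k
  · intro z; simp only [Set.mem_ofPred_eq, cross_add_right, cross_self, add_zero]
  · intro z; simp only [cross_add_left]
  · intro M
    refine (finite_cross_box hD M 0).subset ?_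
    rintro z ⟨h1, h2, h3⟩
    exact ⟨h2, h3.le, h1.ge, h1.le⟩

theorem ncard_edge_right (hD : 0 < cross u v) (k : ℕ) :
    {z | cross z v = 0 ∧ 0 ≤ cross u z ∧ cross u z < k * cross u v}.ncard
      = k * {z | cross z v = 0 ∧ 0 ≤ cross u z ∧ cross u z < cross u v}.ncard := by
  refine ncard_strip (X := fun z => cross u z) (C := {z | cross z v = 0}) (e := v) hD ?_ ?_ ?_ k
  · intro z; simp only [Set.mem_ofPred_eq, cross_add_left, cross_self, add_zero]
  · intro z; simp only [cross_add_right]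
  · intro M
    refine (finite_cross_box hD 0 M).subset ?_
    rintro z ⟨h1, h2, h3⟩
    exact ⟨h1.ge, h1.le, h2, h3.le⟩

theorem ncard_edge_diag (hD : 0 < cross u v) (k : ℕ) :
    {z | cross z v + cross u z = k * cross u v ∧ 0 ≤ cross z v ∧ cross z v < k * cross u v}.ncard
      = k * {z | cross z v + cross u z = cross u v ∧ 0 ≤ cross z v ∧ cross z v < cross u v}.ncard := by
  have htrans : ∀ m : ℤ, {z | cross z v + cross u z = m * cross u v ∧ 0 ≤ cross z v ∧
      cross z v < m * cross u v}.ncard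
        = {z | cross z v + cross u z = 0 ∧ 0 ≤ cross z v ∧ cross z v < m * cross u v}.ncard := by
    intro m
    conv_rhs => rw [← ncard_image_add (m • v)]
    congr 1
    ext z
    simp only [Set.mem_image, Set.mem_ofPred_eq]
    constructor
    · rintro ⟨h1, h2, h3⟩
      refine ⟨z - m • v, ?_, sub_add_cancel _ _⟩
      simp only [cross_sub_left, cross_sub_right, cross_smul_left, cross_smul_right, cross_self]
      exact ⟨by linarith, by linarith, by linarith⟩
    · rintro ⟨z, ⟨h1, h2, h3⟩, rfl⟩
      simp only [cross_add_left, cross_add_right, cross_smul_left, cross_smul_right, cross_self]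
      exact ⟨by linarith, by linarith, by linarith⟩
  have h1 := htrans 1
  rw [one_mul] at h1
  rw [htrans k, h1]
  refine ncard_strip (X := fun z => cross z v) (C := {z | cross z v + cross u z = 0})
    (e := u - v) hD ?_ ?_ ?_ k
  · intro z
    simp only [Set.mem_ofPred_eq, cross_add_right, cross_add_left, cross_sub_left,
      cross_sub_right, cross_self]
    constructor <;> intro h <;> linarith
  · intro z; simp only [cross_add_left, cross_sub_left, cross_self, sub_zero]
  · intro M
    have := (finite_cross_box hD M (M * cross u v)).image (fun z => z - (M • v : Fin 2 → ℤ))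
    refine this.subset ?_
    rintro z ⟨h1, h2, h3⟩
    have h1 : cross z v + cross u z = 0 := h1
    have hM : M ≤ M * cross u v := le_mul_of_one_le_right (by linarith) hD
    refine ⟨z + M • v, ?_, add_sub_cancel_right _ _⟩
    simp only [Set.mem_ofPred_eq, cross_add_left, cross_add_right, cross_smul_left,
      cross_smul_right, cross_self]
    exact ⟨by linarith, by linarith, by linarith, by linarith⟩

theorem ncard_square (hD : 0 < cross u v) (k : ℕ) :
    ({z | (0 ≤ cross u z ∧ cross u z < k * cross u v) ∧ 0 ≤ cross z v ∧
      cross z v < k * cross u v}.ncard : ℤ) = cross u v * k ^ 2 := by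
  have h1 : {z | (0 ≤ cross u z ∧ cross u z < k * cross u v) ∧ 0 ≤ cross z v ∧
      cross z v < k * cross u v}.ncard = k * {z | (0 ≤ cross u z ∧ cross u z < k * cross u v) ∧
        0 ≤ cross z v ∧ cross z v < cross u v}.ncard := by
    refine ncard_strip (X := fun z => cross z v)
      (C := {z | 0 ≤ cross u z ∧ cross u z < k * cross u v}) (e := u) hD ?_ ?_ ?_ k
    · intro z; simp only [Set.mem_ofPred_eq, cross_add_right, cross_self, add_zero]
    · intro z; simp only [cross_add_left]
    · intro M
      refine (finite_cross_box hD M (k * cross u v)).subset ?_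
      rintro z ⟨⟨h1, h2⟩, h3, h4⟩
      exact ⟨h3, h4.le, h1, h2.le⟩
  have h2 : {z | (0 ≤ cross z v ∧ cross z v < cross u v) ∧ 0 ≤ cross u z ∧
      cross u z < k * cross u v}.ncard = k * {z | (0 ≤ cross z v ∧ cross z v < cross u v) ∧
        0 ≤ cross u z ∧ cross u z < cross u v}.ncard := by
    refine ncard_strip (X := fun z => cross u z)
      (C := {z | 0 ≤ cross z v ∧ cross z v < cross u v}) (e := v) hD ?_ ?_ ?_ k
    · intro z; simp only [Set.mem_ofPred_eq, cross_add_left, cross_self, add_zero]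
    · intro z; simp only [cross_add_right]
    · intro M
      refine (finite_cross_box hD (cross u v) M).subset ?_
      rintro z ⟨⟨h1, h2⟩, h3, h4⟩
      exact ⟨h1, h2.le, h3, h4.le⟩
  have hcomm : ∀ a b : ℤ, {z | (0 ≤ cross u z ∧ cross u z < a) ∧ 0 ≤ cross z v ∧ cross z v < b}
      = {z | (0 ≤ cross z v ∧ cross z v < b) ∧ 0 ≤ cross u z ∧ cross u z < a} := by
    intro a b; ext z; simp only [Set.mem_ofPred_eq]; tauto
  rw [h1, hcomm, h2, ← hcomm]
  push_cast
  rw [ncard_parallelogram hD]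
  ring

/-- The lattice points of the dilate `k • conv {0, u, v}`, counted by the rotation of the
parallelogram `k • {s u + t v | 0 ≤ s, t ≤ 1}` about its centre, which exchanges its two halves.
The linear coefficient is the number of lattice points on the boundary of the triangle. -/
theorem ncard_triangle (hD : 0 < cross u v) (k : ℕ) :
    2 * ({z | 0 ≤ cross z v ∧ 0 ≤ cross u z ∧
        cross z v + cross u z ≤ k * cross u v}.ncard : ℤ)
      = cross u v * k ^ 2
        + ({z | 0 ≤ cross z v ∧ 0 ≤ cross u z ∧ cross z v + cross u z ≤ cross u v}.ncard
          - {z | 0 < cross z v ∧ 0 < cross u z ∧ cross z v + cross u z < cross u v}.ncard) * k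
        + 2 := by
  set T : ℕ → Set (Fin 2 → ℤ) := fun k =>
    {z | 0 ≤ cross z v ∧ 0 ≤ cross u z ∧ cross z v + cross u z ≤ k * cross u v} with hT
  have hTfin : ∀ k, (T k).Finite := by
    intro k
    refine (finite_cross_box hD (k * cross u v) (k * cross u v)).subset ?_
    rintro z ⟨h1, h2, h3⟩
    exact ⟨h1, by linarith, h2, by linarith⟩
  set A : Set (Fin 2 → ℤ) :=
    {z | 0 ≤ cross z v ∧ 0 ≤ cross u z ∧ cross z v + cross u z < k * cross u v} with hA
  set B : Set (Fin 2 → ℤ) :=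
    {z | 0 < cross z v ∧ 0 < cross u z ∧ cross z v + cross u z ≤ k * cross u v} with hB
  set E₁ : ℕ → Set (Fin 2 → ℤ) := fun k =>
    {z | cross u z = 0 ∧ 0 ≤ cross z v ∧ cross z v < k * cross u v} with hE₁
  set E₂ : ℕ → Set (Fin 2 → ℤ) := fun k =>
    {z | cross z v = 0 ∧ 0 ≤ cross u z ∧ cross u z < k * cross u v} with hE₂
  set E₃ : ℕ → Set (Fin 2 → ℤ) := fun k =>
    {z | cross z v + cross u z = k * cross u v ∧ 0 ≤ cross z v ∧ cross z v < k * cross u v} with hE₃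
  set I : Set (Fin 2 → ℤ) :=
    {z | 0 < cross z v ∧ 0 < cross u z ∧ cross z v + cross u z < cross u v} with hI
  have hAfin : A.Finite := (hTfin k).subset fun z ⟨h1, h2, h3⟩ => ⟨h1, h2, h3.le⟩
  have hBfin : B.Finite := (hTfin k).subset fun z ⟨h1, h2, h3⟩ => ⟨h1.le, h2.le, h3⟩
  have hIfin : I.Finite := (hTfin 1).subset fun z ⟨h1, h2, h3⟩ =>
    ⟨h1.le, h2.le, by push_cast; linarith⟩
  have hE₁fin : ∀ k, (E₁ k).Finite := fun k => (hTfin k).subset fun z ⟨h1, h2, h3⟩ =>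
    ⟨h2, h1.ge, by linarith⟩
  have hE₂fin : ∀ k, (E₂ k).Finite := fun k => (hTfin k).subset fun z ⟨h1, h2, h3⟩ =>
    ⟨h1.ge, h2, by linarith⟩
  have hE₃fin : ∀ k, (E₃ k).Finite := fun k => (hTfin k).subset fun z ⟨h1, h2, h3⟩ =>
    ⟨h2, by linarith, h1.le⟩
  have huniq : ∀ z, cross z v = k * cross u v → cross u z = 0 → z = (k : ℤ) • u := by
    intro z h1 h2
    have := cross_smul_eq u v z
    rw [h1, h2, zero_smul, add_zero, mul_comm, mul_smul] at this
    exact smul_right_injective _ hD.ne' this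
  -- the square is the union of one half-open triangle and the rotated image of the other
  have hsq : cross u v * k ^ 2 = A.ncard + B.ncard := by
    rw [← ncard_square hD k, ← ncard_image_sub (C := B) ((k : ℤ) • (u + v)), ← Nat.cast_add,
      ← Set.ncard_union_eq _ hAfin (hBfin.image _)]
    · congr 2
      ext z
      simp only [hA, hB, Set.mem_union, Set.mem_image, Set.mem_ofPred_eq]
      constructor
      · rintro ⟨⟨h1, h2⟩, h3, h4⟩
        by_cases h : cross z v + cross u z < k * cross u v
        · exact Or.inl ⟨h3, h1, h⟩
        · right
          refine ⟨(k : ℤ) • (u + v) - z, ?_, sub_sub_cancel _ _⟩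
          simp only [cross_sub_left, cross_sub_right, cross_smul_left, cross_smul_right,
            cross_add_left, cross_add_right, cross_self]
          exact ⟨by linarith, by linarith, by linarith⟩
      · rintro (⟨h1, h2, h3⟩ | ⟨z, ⟨h1, h2, h3⟩, rfl⟩)
        · exact ⟨⟨h2, by linarith⟩, h1, by linarith⟩
        · simp only [cross_sub_left, cross_sub_right, cross_smul_left, cross_smul_right,
            cross_add_left, cross_add_right, cross_self]
          exact ⟨⟨by linarith, by linarith⟩, by linarith, by linarith⟩
    · rw [Set.disjoint_left]
      rintro z ⟨h1, h2, h3⟩ ⟨z, ⟨h1', h2', h3'⟩, rfl⟩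
      simp only [cross_sub_left, cross_sub_right, cross_smul_left, cross_smul_right,
            cross_add_left, cross_add_right, cross_self] at h3
      linarith
  have hTA : ((T k).ncard : ℤ) = A.ncard + (E₃ k).ncard + 1 := by
    have : T k = insert ((k : ℤ) • u) (A ∪ E₃ k) := by
      ext z
      simp only [hT, hA, hE₃, Set.mem_insert_iff, Set.mem_union, Set.mem_ofPred_eq]
      constructor
      · rintro ⟨h1, h2, h3⟩
        rcases h3.lt_or_eq with h | h
        · exact Or.inr (Or.inl ⟨h1, h2, h⟩)
        · rcases h2.lt_or_eq with h' | h'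
          · exact Or.inr (Or.inr ⟨h, h1, by linarith⟩)
          · exact Or.inl (huniq z (by linarith) h'.symm)
      · rintro (rfl | ⟨h1, h2, h3⟩ | ⟨h1, h2, h3⟩)
        · simp only [cross_smul_left, cross_smul_right, cross_self, mul_zero, le_refl,
            add_zero, and_true]
          positivity
        · exact ⟨h1, h2, h3.le⟩
        · exact ⟨h2, by linarith, h1.le⟩
    rw [this, Set.ncard_insert_of_notMem _ (hAfin.union (hE₃fin k)),
      Set.ncard_union_eq _ hAfin (hE₃fin k)]
    · push_cast; ring
    · rw [Set.disjoint_left]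
      rintro z ⟨-, -, h⟩ ⟨h', -, -⟩
      linarith
    · rintro (⟨-, -, h⟩ | ⟨-, -, h⟩)
      · simp only [cross_smul_left, cross_smul_right, cross_self] at h; linarith
      · simp only [cross_smul_left] at h; linarith
  have hTB : ((T k).ncard : ℤ) = B.ncard + (E₁ k).ncard + (E₂ k).ncard + 1 := by
    have : T k = insert ((k : ℤ) • u) (B ∪ E₁ k ∪ (fun z => (k : ℤ) • v - z) '' E₂ k) := by
      ext z
      simp only [hT, hB, hE₁, hE₂, Set.mem_insert_iff, Set.mem_union, Set.mem_ofPred_eq,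
        Set.mem_image]
      constructor
      · rintro ⟨h1, h2, h3⟩
        rcases h2.lt_or_eq with h | h
        · rcases h1.lt_or_eq with h' | h'
          · exact Or.inr (Or.inl (Or.inl ⟨h', h, h3⟩))
          · refine Or.inr (Or.inr ⟨(k : ℤ) • v - z, ?_, sub_sub_cancel _ _⟩)
            simp only [cross_sub_left, cross_sub_right, cross_smul_left, cross_smul_right,
              cross_self]
            exact ⟨by linarith, by linarith, by linarith⟩
        · by_cases h' : cross z v < k * cross u v
          · exact Or.inr (Or.inl (Or.inr ⟨h.symm, h1, h'⟩))
          · exact Or.inl (huniq z (by linarith) h.symm)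
      · rintro (rfl | (⟨h1, h2, h3⟩ | ⟨h1, h2, h3⟩) | ⟨z, ⟨h1, h2, h3⟩, rfl⟩)
        · simp only [cross_smul_left, cross_smul_right, cross_self, mul_zero, le_refl,
            add_zero, and_true]
          positivity
        · exact ⟨h1.le, h2.le, h3⟩
        · exact ⟨h2, h1.ge, by linarith⟩
        · simp only [cross_sub_left, cross_sub_right, cross_smul_left, cross_smul_right,
              cross_self]
          exact ⟨by linarith, by linarith, by linarith⟩
    rw [this, Set.ncard_insert_of_notMem _ ((hBfin.union (hE₁fin k)).union ((hE₂fin k).image _)),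
      Set.ncard_union_eq _ (hBfin.union (hE₁fin k)) ((hE₂fin k).image _), ncard_image_sub,
      Set.ncard_union_eq _ hBfin (hE₁fin k)]
    · push_cast; ring
    · rw [Set.disjoint_left]
      rintro z ⟨-, h, -⟩ ⟨h', -, -⟩
      linarith
    · rw [Set.disjoint_left]
      rintro z (⟨h, h0, -⟩ | ⟨h, h0, -⟩) ⟨z, ⟨h1, h2, h3⟩, rfl⟩
      · simp only [cross_sub_left, cross_smul_left, cross_self] at h; linarith
      · simp only [cross_sub_right, cross_smul_right] at h; linarith
    · rintro ((⟨-, h, -⟩ | ⟨-, -, h⟩) | ⟨z, ⟨h1, h2, h3⟩, hz⟩)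
      · simp only [cross_smul_right, cross_self] at h; linarith
      · simp only [cross_smul_left] at h; linarith
      · have : cross u ((k : ℤ) • v - z) = cross u ((k : ℤ) • u) := congrArg _ hz
        simp only [cross_sub_right, cross_smul_right, cross_self] at this
        linarith
  have hbd : ((T 1).ncard : ℤ) = I.ncard + (E₁ 1).ncard + (E₂ 1).ncard + (E₃ 1).ncard := by
    have : T 1 = (I ∪ E₁ 1) ∪ ((fun z => v - z) '' E₂ 1 ∪ (fun z => (u + v) - z) '' E₃ 1) := by
      ext z
      simp only [hT, hI, hE₁, hE₂, hE₃, Set.mem_union, Set.mem_ofPred_eq,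
        Set.mem_image, Nat.cast_one, one_mul]
      constructor
      · rintro ⟨h1, h2, h3⟩
        by_cases h : cross u z = 0 ∧ cross z v < cross u v
        · exact Or.inl (Or.inr ⟨h.1, h1, h.2⟩)
        by_cases h' : cross z v = 0
        · refine Or.inr (Or.inl ⟨v - z, ?_, sub_sub_cancel _ _⟩)
          simp only [cross_sub_left, cross_sub_right, cross_self]
          have : cross u z ≠ 0 := fun h0 => h ⟨h0, by linarith⟩
          have : 0 < cross u z := lt_of_le_of_ne h2 this.symm
          exact ⟨by linarith, by linarith, by linarith⟩
        have h1' : 0 < cross z v := lt_of_le_of_ne h1 (Ne.symm h')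
        rcases h3.lt_or_eq with h3 | h3
        · rcases h2.lt_or_eq with h2 | h2
          · exact Or.inl (Or.inl ⟨h1', h2, h3⟩)
          · exact absurd ⟨h2.symm, by linarith⟩ h
        · refine Or.inr (Or.inr ⟨u + v - z, ?_, sub_sub_cancel _ _⟩)
          simp only [cross_sub_left, cross_sub_right, cross_add_left, cross_add_right, cross_self]
          exact ⟨by linarith, by linarith, by linarith⟩
      · rintro ((⟨h1, h2, h3⟩ | ⟨h1, h2, h3⟩) | (⟨z, ⟨h1, h2, h3⟩, rfl⟩ | ⟨z, ⟨h1, h2, h3⟩, rfl⟩))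
        · exact ⟨h1.le, h2.le, h3.le⟩
        · exact ⟨h2, h1.ge, by linarith⟩
        · simp only [cross_sub_left, cross_sub_right, cross_self]
          exact ⟨by linarith, by linarith, by linarith⟩
        · simp only [cross_sub_left, cross_sub_right, cross_add_left, cross_add_right, cross_self]
          exact ⟨by linarith, by linarith, by linarith⟩
    rw [this, Set.ncard_union_eq _ (hIfin.union (hE₁fin 1))
      (((hE₂fin 1).image _).union ((hE₃fin 1).image _)),
      Set.ncard_union_eq _ hIfin (hE₁fin 1),
      Set.ncard_union_eq _ ((hE₂fin 1).image _) ((hE₃fin 1).image _),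
      ncard_image_sub, ncard_image_sub]
    · push_cast; ring
    · rw [Set.disjoint_left]
      rintro z ⟨z, ⟨h1, h2, h3⟩, rfl⟩ ⟨z', ⟨h1', h2', h3'⟩, h⟩
      have : cross (u + v - z') v = cross (v - z) v := congrArg (cross · v) h
      simp only [Nat.cast_one, one_mul] at h3'
      simp only [cross_sub_left, cross_add_left, cross_self] at this
      linarith
    · rw [Set.disjoint_left]
      rintro z ⟨-, h, -⟩ ⟨h', -, -⟩
      linarith
    · rw [Set.disjoint_left]
      simp only [hE₂, hE₃, Nat.cast_one, one_mul]
      rintro z (⟨h, h0, h0'⟩ | ⟨h, h0, h0'⟩) (⟨z, ⟨h1, h2, h3⟩, rfl⟩ | ⟨z, ⟨h1, h2, h3⟩, rfl⟩)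
      · simp only [cross_sub_left, cross_self] at h; linarith
      · simp only [cross_sub_left, cross_sub_right, cross_add_left, cross_add_right,
          cross_self] at h0'
        linarith
      · simp only [cross_sub_right] at h; linarith
      · simp only [Nat.cast_one, one_mul, cross_sub_left, cross_sub_right, cross_add_left,
          cross_add_right, cross_self] at h h0'
        linarith
  have e1 : (E₁ k).ncard = k * (E₁ 1).ncard := by
    simpa [hE₁] using ncard_edge_left hD k
  have e2 : (E₂ k).ncard = k * (E₂ 1).ncard := by
    simpa [hE₂] using ncard_edge_right hD k
  have e3 : (E₃ k).ncard = k * (E₃ 1).ncard := by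
    simpa [hE₃] using ncard_edge_diag hD k
  have hT1 : {z | 0 ≤ cross z v ∧ 0 ≤ cross u z ∧ cross z v + cross u z ≤ cross u v} = T 1 := by
    simp [hT]
  rw [e1, e2] at hTB
  rw [e3] at hTA
  rw [hT1, hbd, hsq]
  push_cast at hTA hTB ⊢
  linear_combination hTA + hTB

end Edges

/-! ### Lattice points and half-planes -/

theorem latticePoint_injective {n : ℕ} : Function.Injective (latticePoint (n := n)) := by
  intro a b h
  ext i
  have := congrFun h i
  simpa [latticePoint] using this

theorem latticePoint_add {n : ℕ} (a b : Fin n → ℤ) :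
    latticePoint (a + b) = latticePoint a + latticePoint b := by
  ext i; simp [latticePoint]

theorem latticePoint_sub {n : ℕ} (a b : Fin n → ℤ) :
    latticePoint (a - b) = latticePoint a - latticePoint b := by
  ext i; simp [latticePoint]

theorem latticePoint_smul {n : ℕ} (k : ℤ) (a : Fin n → ℤ) :
    latticePoint (k • a) = (k : ℝ) • latticePoint a := by
  ext i; simp [latticePoint]

theorem cross_latticePoint (a b : Fin 2 → ℤ) :
    cross (latticePoint a) (latticePoint b) = ((cross a b : ℤ) : ℝ) := by
  simp [cross, latticePoint]

theorem finite_setOf_latticePoint_mem {n : ℕ} {S : Set (Fin n → ℝ)} (hS : Bornology.IsBounded S) :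
    {z | latticePoint z ∈ S}.Finite := by
  obtain ⟨R, hR⟩ := hS.exists_norm_le
  refine (Set.Finite.pi' (fun _ : Fin n => Set.finite_Icc (-⌈R⌉) ⌈R⌉)).subset ?_
  intro z hz i
  have h1 := (norm_le_pi_norm (latticePoint z) i).trans (hR _ hz)
  rw [Real.norm_eq_abs] at h1
  have h2 := abs_le.1 (h1.trans (Int.le_ceil R))
  simp only [latticePoint] at h2
  exact ⟨by exact_mod_cast h2.1, by exact_mod_cast h2.2⟩

theorem latticeCount_union {n : ℕ} {S T : Set (Fin n → ℝ)} (hS : Bornology.IsBounded S)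
    (hT : Bornology.IsBounded T) (hd : Disjoint S T) :
    latticeCount (S ∪ T) = latticeCount S + latticeCount T := by
  unfold latticeCount
  rw [← Set.ncard_union_eq _ (finite_setOf_latticePoint_mem hS) (finite_setOf_latticePoint_mem hT)]
  · rfl
  · rw [Set.disjoint_left] at hd ⊢
    exact fun z hz hz' => hd hz hz'

theorem latticeCount_mono {n : ℕ} {S T : Set (Fin n → ℝ)} (h : S ⊆ T)
    (hT : Bornology.IsBounded T) : latticeCount S ≤ latticeCount T :=
  Set.ncard_le_ncard (fun _ hz => h hz) (finite_setOf_latticePoint_mem hT)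

/-- The linear functional `cross u` on the plane. -/
noncomputable def crossL (u : Fin 2 → ℝ) : (Fin 2 → ℝ) →L[ℝ] ℝ :=
  LinearMap.toContinuousLinearMap
    { toFun := cross u
      map_add' := cross_add_right u
      map_smul' := fun k v => cross_smul_right k u v }

@[simp] theorem crossL_apply (u v : Fin 2 → ℝ) : crossL u v = cross u v := rfl

/-- The affine function that vanishes on the line through `a` and `b`, and is positive to the left
of it. -/
def side (a b p : Fin 2 → ℝ) : ℝ := cross (b - a) (p - a)

theorem side_eq (a b p : Fin 2 → ℝ) : side a b p = crossL (b - a) p - cross (b - a) a := by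
  rw [crossL_apply, side, cross_sub_right]

theorem continuous_side (a b : Fin 2 → ℝ) : Continuous (side a b) := by
  simp only [funext (side_eq a b)]
  fun_prop

theorem side_combo (a b p q : Fin 2 → ℝ) {s t : ℝ} (h : s + t = 1) :
    side a b (s • p + t • q) = s * side a b p + t * side a b q := by
  have : s = 1 - t := by linarith
  subst this
  simp only [side, cross, Pi.sub_apply, Pi.add_apply, Pi.smul_apply, smul_eq_mul]; ring

theorem convex_side_nonneg (a b : Fin 2 → ℝ) : Convex ℝ {p | 0 ≤ side a b p} := by
  intro p hp q hq s t hs ht hst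
  simp only [Set.mem_ofPred_eq] at *
  rw [side_combo a b p q hst]
  positivity

theorem interior_side_nonneg {a b : Fin 2 → ℝ} (hab : a ≠ b) :
    interior {p | 0 ≤ side a b p} = {p | 0 < side a b p} := by
  have hsurj : Function.Surjective (crossL (b - a)) := by
    apply LinearMap.surjective (f := (crossL (b - a)).toLinearMap)
    intro h0
    apply hab
    have h1 : cross (b - a) ![1, 0] = 0 := DFunLike.congr_fun h0 ![1, 0]
    have h2 : cross (b - a) ![0, 1] = 0 := DFunLike.congr_fun h0 ![0, 1]
    simp [cross] at h1 h2
    ext i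
    fin_cases i
    · simp; linarith
    · simp; linarith
  have hopen : IsOpenMap (side a b) := by
    have : side a b = (fun t => t - cross (b - a) a) ∘ crossL (b - a) := by
      ext p; simp [side_eq]
    rw [this]
    exact (Homeomorph.subRight _).isOpenMap.comp ((crossL (b - a)).isOpenMap hsurj)
  have := hopen.preimage_interior_eq_interior_preimage (continuous_side a b) (Set.Ici 0)
  rw [interior_Ici] at this
  exact this.symm

/-! ### Lattice triangles and lattice segments -/

theorem convexHull_triangle {a b c : Fin 2 → ℝ} (hD : 0 < side a b c) :
    convexHull ℝ {a, b, c} = {p | 0 ≤ side a b p} ∩ {p | 0 ≤ side b c p} ∩ {p | 0 ≤ side c a p} := by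
  apply Set.Subset.antisymm
  · apply convexHull_min
    · have h1 : side b c a = side a b c := by
        simp only [side, cross, Pi.sub_apply]; ring
      have h2 : side c a b = side a b c := by
        simp only [side, cross, Pi.sub_apply]; ring
      have h0 : ∀ a b : Fin 2 → ℝ, side a b a = 0 ∧ side a b b = 0 := by
        intro a b
        constructor <;> simp only [side, cross, Pi.sub_apply] <;> ring
      rintro p (rfl | rfl | rfl) <;>
        simp only [Set.mem_inter_iff, Set.mem_ofPred_eq, h0, h1, h2, le_refl, hD.le, and_self]
    · exact ((convex_side_nonneg a b).inter (convex_side_nonneg b c)).inter (convex_side_nonneg c a)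
  · rintro p ⟨⟨h1, h2⟩, h3⟩
    simp only [Set.mem_ofPred_eq] at h1 h2 h3
    have hsum : side a b p + side b c p + side c a p = side a b c := by
      simp only [side, cross, Pi.sub_apply]; ring
    rw [convexHull_insert (by simp), convexHull_pair, mem_convexJoin]
    by_cases hbc : side a b p + side c a p = 0
    · refine ⟨a, rfl, b, left_mem_segment _ _ _, ?_⟩
      have hp : side a b p = 0 := by linarith
      have hp' : side c a p = 0 := by linarith
      have : p = a := by
        have hpa : cross (b - a) (c - a) • (p - a) = 0 := by
          rw [cross_smul_eq]
          have e1 : cross (p - a) (c - a) = side c a p := by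
            simp only [side, cross, Pi.sub_apply]; ring
          have e2 : cross (b - a) (p - a) = side a b p := rfl
          rw [e1, e2, hp, hp']; simp
        exact sub_eq_zero.1 ((smul_eq_zero.1 hpa).resolve_left hD.ne')
      rw [this]; exact left_mem_segment _ _ _
    · set s := side a b p + side c a p with hs
      have hs0 : 0 < s := lt_of_le_of_ne (by linarith) (Ne.symm hbc)
      refine ⟨a, rfl, (side c a p / s) • b + (side a b p / s) • c, ?_, ?_⟩
      · exact ⟨_, _, by positivity, by positivity, by field_simp; linarith, rfl⟩
      · refine ⟨side b c p / side a b c, s / side a b c, by positivity, by positivity,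
          by field_simp; linarith, ?_⟩
        have key : side a b c • p = side b c p • a + side c a p • b + side a b p • c := by
          ext i
          fin_cases i <;>
            simp only [side, cross, Pi.sub_apply, Pi.add_apply, Pi.smul_apply, smul_eq_mul] <;>
            simp <;> ring
        ext i
        have hp := congrFun key i
        simp only [Pi.add_apply, Pi.smul_apply, smul_eq_mul] at hp ⊢
        field_simp
        linarith

/-- The convex hull in the plane of a set of lattice points. -/
def hull (S : Set (Fin 2 → ℤ)) : Set (Fin 2 → ℝ) := convexHull ℝ (latticePoint '' S)

theorem smul_hull (k : ℤ) (S : Set (Fin 2 → ℤ)) :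
    (k : ℝ) • hull S = hull ((fun z => k • z) '' S) := by
  rw [hull, hull, ← convexHull_smul, ← Set.image_smul, Set.image_image, Set.image_image]
  simp only [latticePoint_smul]

theorem isBounded_hull {S : Set (Fin 2 → ℤ)} (hS : S.Finite) : Bornology.IsBounded (hull S) :=
  (Set.Finite.isCompact_convexHull ℝ (hS.image _)).isBounded

theorem isClosed_hull {S : Set (Fin 2 → ℤ)} (hS : S.Finite) : IsClosed (hull S) :=
  (Set.Finite.isCompact_convexHull ℝ (hS.image _)).isClosed

/-- Twice the signed area of a lattice triangle. -/
def sideZ (a b c : Fin 2 → ℤ) : ℤ := cross (b - a) (c - a)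

theorem side_latticePoint (a b c : Fin 2 → ℤ) :
    side (latticePoint a) (latticePoint b) (latticePoint c) = ((sideZ a b c : ℤ) : ℝ) := by
  rw [side, ← latticePoint_sub, ← latticePoint_sub, cross_latticePoint, sideZ]

theorem hull_triangle {a b c : Fin 2 → ℤ} (hD : 0 < sideZ a b c) :
    hull {a, b, c} = {p | 0 ≤ side (latticePoint a) (latticePoint b) p}
      ∩ {p | 0 ≤ side (latticePoint b) (latticePoint c) p}
      ∩ {p | 0 ≤ side (latticePoint c) (latticePoint a) p} := by
  rw [hull, Set.image_insert_eq, Set.image_pair]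
  apply convexHull_triangle
  rw [side_latticePoint]
  exact_mod_cast hD

theorem interior_hull_triangle {a b c : Fin 2 → ℤ} (hD : 0 < sideZ a b c) :
    interior (hull {a, b, c}) = {p | 0 < side (latticePoint a) (latticePoint b) p}
      ∩ {p | 0 < side (latticePoint b) (latticePoint c) p}
      ∩ {p | 0 < side (latticePoint c) (latticePoint a) p} := by
  have hne : ∀ {a b c : Fin 2 → ℤ}, 0 < sideZ a b c → latticePoint a ≠ latticePoint b := by
    intro a b c h h'
    rw [latticePoint_injective h'] at h
    simp [sideZ, cross] at h
  have h1 : 0 < sideZ b c a := by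
    have : sideZ b c a = sideZ a b c := by simp only [sideZ, cross, Pi.sub_apply]; ring
    rwa [this]
  have h2 : 0 < sideZ c a b := by
    have : sideZ c a b = sideZ a b c := by simp only [sideZ, cross, Pi.sub_apply]; ring
    rwa [this]
  rw [hull_triangle hD, interior_inter, interior_inter, interior_side_nonneg (hne hD),
    interior_side_nonneg (hne h1), interior_side_nonneg (hne h2)]

/-- Translating a triangle to the origin expresses its lattice points by two determinants. -/
theorem latticeCount_hull_triangle {a b c : Fin 2 → ℤ} (hD : 0 < sideZ a b c) :
    latticeCount (hull {a, b, c}) = {z | 0 ≤ cross z (c - a) ∧ 0 ≤ cross (b - a) z ∧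
      cross z (c - a) + cross (b - a) z ≤ cross (b - a) (c - a)}.ncard := by
  rw [← ncard_image_add a, latticeCount, hull_triangle hD]
  congr 1
  ext z
  simp only [Set.mem_inter_iff, Set.mem_ofPred_eq, side_latticePoint, Set.mem_image]
  norm_cast
  constructor
  · rintro ⟨⟨h1, h2⟩, h3⟩
    refine ⟨z - a, ?_, sub_add_cancel _ _⟩
    simp only [sideZ, cross, Pi.sub_apply] at *
    exact ⟨by linarith, by linarith, by linarith⟩
  · rintro ⟨z, ⟨h1, h2, h3⟩, rfl⟩
    simp only [sideZ, cross, Pi.sub_apply, Pi.add_apply] at *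
    exact ⟨⟨by linarith, by linarith⟩, by linarith⟩

theorem latticeCount_interior_hull_triangle {a b c : Fin 2 → ℤ} (hD : 0 < sideZ a b c) :
    latticeCount (interior (hull {a, b, c})) = {z | 0 < cross z (c - a) ∧ 0 < cross (b - a) z ∧
      cross z (c - a) + cross (b - a) z < cross (b - a) (c - a)}.ncard := by
  rw [← ncard_image_add a, latticeCount, interior_hull_triangle hD]
  congr 1
  ext z
  simp only [Set.mem_inter_iff, Set.mem_ofPred_eq, side_latticePoint, Set.mem_image]
  norm_cast
  constructor
  · rintro ⟨⟨h1, h2⟩, h3⟩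
    refine ⟨z - a, ?_, sub_add_cancel _ _⟩
    simp only [sideZ, cross, Pi.sub_apply] at *
    exact ⟨by linarith, by linarith, by linarith⟩
  · rintro ⟨z, ⟨h1, h2, h3⟩, rfl⟩
    simp only [sideZ, cross, Pi.sub_apply, Pi.add_apply] at *
    exact ⟨⟨by linarith, by linarith⟩, by linarith⟩

/-- `P` has the counting function `G(k P) = (c k² + b k) / 2 + 1`, where `b` is the number of
lattice points of `P` outside its interior; so `c` is twice the area of `P`. -/
def HasPick (P : Set (Fin 2 → ℝ)) (c : ℤ) : Prop :=
  ∀ k : ℕ, 1 ≤ k → 2 * (latticeCount ((k : ℝ) • P) : ℤ)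
    = c * k ^ 2 + (latticeCount P - latticeCount (interior P) : ℤ) * k + 2

theorem sideZ_smul (k : ℤ) (a b c : Fin 2 → ℤ) :
    sideZ (k • a) (k • b) (k • c) = k ^ 2 * sideZ a b c := by
  simp only [sideZ, cross, Pi.sub_apply, Pi.smul_apply, smul_eq_mul]; ring

theorem hasPick_triangle {a b c : Fin 2 → ℤ} (hD : 0 < sideZ a b c) :
    HasPick (hull {a, b, c}) (sideZ a b c) := by
  intro k hk
  have hk' : (0 : ℤ) < k := by exact_mod_cast hk
  have h1 : ((k : ℝ) • hull {a, b, c}) = hull {(k : ℤ) • a, (k : ℤ) • b, (k : ℤ) • c} := by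
    have := smul_hull (k : ℤ) {a, b, c}
    rwa [Int.cast_natCast, Set.image_insert_eq, Set.image_pair] at this
  have hDk : 0 < sideZ ((k : ℤ) • a) ((k : ℤ) • b) ((k : ℤ) • c) := by
    rw [sideZ_smul]; positivity
  rw [h1, latticeCount_hull_triangle hDk, latticeCount_hull_triangle hD,
    latticeCount_interior_hull_triangle hD, sideZ, ← ncard_triangle hD k]
  congr 3
  ext z
  simp only [Set.mem_ofPred_eq]
  rw [← smul_sub, ← smul_sub, cross_smul_left, cross_smul_left, cross_smul_right,
    cross_smul_right, ← mul_add, mul_le_mul_iff_right₀ hk', mul_nonneg_iff_of_pos_left hk',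
    mul_nonneg_iff_of_pos_left hk']

theorem mem_segment_iff {a b c p : Fin 2 → ℝ} (hD : 0 < side a b c) :
    p ∈ segment ℝ a b ↔ side a b p = 0 ∧ 0 ≤ side c a p ∧ side c a p ≤ side a b c := by
  rw [segment_eq_image_lineMap]
  constructor
  · rintro ⟨t, ⟨h0, h1⟩, rfl⟩
    have e1 : side a b (AffineMap.lineMap a b t) = 0 := by
      simp only [side, cross, AffineMap.lineMap_apply, vsub_eq_sub, vadd_eq_add, Pi.add_apply,
        Pi.sub_apply, Pi.smul_apply, smul_eq_mul]; ring
    have e2 : side c a (AffineMap.lineMap a b t) = t * side a b c := by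
      simp only [side, cross, AffineMap.lineMap_apply, vsub_eq_sub, vadd_eq_add, Pi.add_apply,
        Pi.sub_apply, Pi.smul_apply, smul_eq_mul]; ring
    rw [e1, e2]
    exact ⟨rfl, by positivity, mul_le_of_le_one_left hD.le h1⟩
  · rintro ⟨h1, h2, h3⟩
    refine ⟨side c a p / side a b c, ⟨by positivity, (div_le_one hD).2 h3⟩, ?_⟩
    have key := cross_smul_eq (b - a) (c - a) (p - a)
    have e1 : cross (p - a) (c - a) = side c a p := by
      simp only [side, cross, Pi.sub_apply]; ring
    rw [e1, show cross (b - a) (p - a) = 0 from h1, zero_smul, add_zero] at key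
    ext i
    have hi := congrFun key i
    change side a b c * (p i - a i) = _ * (b i - a i) at hi
    simp only [AffineMap.lineMap_apply, vsub_eq_sub, vadd_eq_add, Pi.add_apply,
        Pi.sub_apply, Pi.smul_apply, smul_eq_mul]
    field_simp
    linarith

theorem mem_openSegment_iff {a b c p : Fin 2 → ℝ} (hD : 0 < side a b c) :
    p ∈ openSegment ℝ a b ↔ side a b p = 0 ∧ 0 < side c a p ∧ side c a p < side a b c := by
  have ha : side c a a = 0 := by simp only [side, cross, Pi.sub_apply]; ring
  have hb : side c a b = side a b c := by simp only [side, cross, Pi.sub_apply]; ring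
  constructor
  · intro h
    have h' := (mem_segment_iff hD).1 (openSegment_subset_segment _ _ _ h)
    obtain ⟨s, t, hs, ht, hst, rfl⟩ := h
    rw [side_combo c a a b hst, ha, hb] at h' ⊢
    have h1 := mul_pos ht hD
    have h2 := mul_pos hs hD
    exact ⟨h'.1, by linarith, by nlinarith⟩
  · rintro ⟨h1, h2, h3⟩
    apply mem_openSegment_of_ne_left_right
    · rintro rfl; linarith
    · rintro rfl; linarith
    · exact (mem_segment_iff hD).2 ⟨h1, h2.le, h3.le⟩

theorem latticeCount_segment_one {a b c : Fin 2 → ℤ} (hD : 0 < sideZ a b c) :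
    latticeCount (segment ℝ (latticePoint a) (latticePoint b))
      = {z | cross (b - a) z = 0 ∧ 0 ≤ cross z (c - a) ∧ cross z (c - a) < sideZ a b c}.ncard
        + 1 := by
  have hfin : {z | cross (b - a) z = 0 ∧ 0 ≤ cross z (c - a) ∧
      cross z (c - a) < sideZ a b c}.Finite := by
    refine (finite_cross_box (u := b - a) (v := c - a) hD (sideZ a b c) 0).subset ?_
    rintro z ⟨h1, h2, h3⟩
    exact ⟨h2, h3.le, h1.ge, h1.le⟩
  rw [← Set.ncard_insert_of_notMem (a := b - a) (by rintro ⟨-, -, h⟩; exact h.false) hfin,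
    ← ncard_image_add a, latticeCount]
  congr 1
  ext z
  have hD' : 0 < side (latticePoint a) (latticePoint b) (latticePoint c) := by
    rw [side_latticePoint]; exact_mod_cast hD
  simp only [Set.mem_ofPred_eq, mem_segment_iff hD', side_latticePoint]
  norm_cast
  have e1 : sideZ a b z = cross (b - a) (z - a) := rfl
  have e2 : sideZ c a z = cross (z - a) (c - a) := by
    simp only [sideZ, cross, Pi.sub_apply]; ring
  have e3 : cross (b - a) (c - a) = sideZ a b c := rfl
  rw [e1, e2]
  constructor
  · rintro ⟨h1, h2, h3⟩
    refine ⟨z - a, ?_, sub_add_cancel _ _⟩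
    rcases h3.lt_or_eq with h3 | h3
    · exact Or.inr ⟨h1, h2, h3⟩
    · left
      have := cross_smul_eq (b - a) (c - a) (z - a)
      rw [h1, h3, e3, zero_smul, add_zero] at this
      exact smul_right_injective _ hD.ne' this
  · rintro ⟨z, rfl | ⟨h1, h2, h3⟩, rfl⟩
    · rw [add_sub_cancel_right, cross_self, e3]
      exact ⟨rfl, hD.le, le_refl _⟩
    · rw [add_sub_cancel_right]
      exact ⟨h1, h2, h3.le⟩

/-- Every lattice segment `[a, b]` has `k g + 1` lattice points in its `k`-th dilate, where `g - 1`
is the number of those strictly between `a` and `b`. -/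
theorem latticeCount_segment {a b c : Fin 2 → ℤ} (hD : 0 < sideZ a b c) {k : ℕ} (hk : 1 ≤ k) :
    latticeCount ((k : ℝ) • segment ℝ (latticePoint a) (latticePoint b))
      = k * (latticeCount (openSegment ℝ (latticePoint a) (latticePoint b)) + 1) + 1 := by
  have hk' : (0 : ℤ) < k := by exact_mod_cast hk
  have hDk : 0 < sideZ ((k : ℤ) • a) ((k : ℤ) • b) ((k : ℤ) • c) := by
    rw [sideZ_smul]; positivity
  have hseg : (k : ℝ) • segment ℝ (latticePoint a) (latticePoint b)
      = segment ℝ (latticePoint ((k : ℤ) • a)) (latticePoint ((k : ℤ) • b)) := by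
    rw [latticePoint_smul, latticePoint_smul, ← convexHull_pair, ← convexHull_pair,
      ← convexHull_smul, ← Set.image_smul, Set.image_pair, Int.cast_natCast]
  have h1 := ncard_edge_left (u := b - a) (v := c - a) hD k
  rw [hseg, latticeCount_segment_one hDk, sideZ_smul]
  congr 1
  have hset : {z | cross ((k : ℤ) • b - (k : ℤ) • a) z = 0 ∧
      0 ≤ cross z ((k : ℤ) • c - (k : ℤ) • a) ∧
        cross z ((k : ℤ) • c - (k : ℤ) • a) < (k : ℤ) ^ 2 * sideZ a b c}
      = {z | cross (b - a) z = 0 ∧ 0 ≤ cross z (c - a) ∧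
          cross z (c - a) < k * cross (b - a) (c - a)} := by
    ext z
    simp only [Set.mem_ofPred_eq]
    rw [← smul_sub, ← smul_sub, cross_smul_left, cross_smul_right, sq, mul_assoc,
      mul_lt_mul_iff_right₀ hk', mul_nonneg_iff_of_pos_left hk', mul_eq_zero,
      or_iff_right hk'.ne']
    rfl
  rw [hset, h1]
  congr 1
  have hfin : {z | cross (b - a) z = 0 ∧ 0 < cross z (c - a) ∧
      cross z (c - a) < sideZ a b c}.Finite := by
    refine (finite_cross_box (u := b - a) (v := c - a) hD (sideZ a b c) 0).subset ?_
    rintro z ⟨h1, h2, h3⟩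
    exact ⟨h2.le, h3.le, h1.ge, h1.le⟩
  have hopen : latticeCount (openSegment ℝ (latticePoint a) (latticePoint b))
      = {z | cross (b - a) z = 0 ∧ 0 < cross z (c - a) ∧ cross z (c - a) < sideZ a b c}.ncard := by
    rw [← ncard_image_add a, latticeCount]
    congr 1
    ext z
    have hD' : 0 < side (latticePoint a) (latticePoint b) (latticePoint c) := by
      rw [side_latticePoint]; exact_mod_cast hD
    simp only [Set.mem_ofPred_eq, mem_openSegment_iff hD', side_latticePoint]
    norm_cast
    have e1 : sideZ a b z = cross (b - a) (z - a) := rfl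
    have e2 : sideZ c a z = cross (z - a) (c - a) := by
      simp only [sideZ, cross, Pi.sub_apply]; ring
    rw [e1, e2]
    constructor
    · exact fun h => ⟨z - a, h, sub_add_cancel _ _⟩
    · rintro ⟨z, h, rfl⟩
      rwa [add_sub_cancel_right]
  rw [hopen, ← Set.ncard_insert_of_notMem (a := 0) (by rintro ⟨-, h, -⟩; simp [cross] at h) hfin]
  congr 1
  ext z
  have e3 : cross (b - a) (c - a) = sideZ a b c := rfl
  simp only [Set.mem_ofPred_eq, Set.mem_insert_iff]
  constructor
  · rintro ⟨h1, h2, h3⟩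
    rcases h2.lt_or_eq with h2 | h2
    · exact Or.inr ⟨h1, h2, h3⟩
    · left
      have := cross_smul_eq (b - a) (c - a) z
      rw [h1, ← h2, zero_smul, zero_smul, add_zero] at this
      exact (smul_eq_zero.1 this).resolve_left hD.ne'
  · rintro (rfl | ⟨h1, h2, h3⟩)
    · simp only [cross, Pi.zero_apply, zero_mul, mul_zero, sub_zero, le_refl, true_and]
      exact hD
    · exact ⟨h1, h2.le, h3⟩

/-! ### Cutting a polygon along a diagonal -/

theorem side_swap (a b p : Fin 2 → ℝ) : side b a p = -side a b p := by
  simp only [side, cross, Pi.sub_apply]; ring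

theorem sideZ_swap (a b p : Fin 2 → ℤ) : sideZ b a p = -sideZ a b p := by
  simp only [sideZ, cross, Pi.sub_apply]; ring

@[simp] theorem sideZ_left (a b : Fin 2 → ℤ) : sideZ a b a = 0 := by
  simp [sideZ, cross]

@[simp] theorem sideZ_right (a b : Fin 2 → ℤ) : sideZ a b b = 0 := cross_self _

/-- A convex set with points on both sides of a line has interior points on that line. -/
theorem exists_mem_interior_side_eq_zero {P : Set (Fin 2 → ℝ)} (hP : Convex ℝ P)
    (hint : (interior P).Nonempty) {a b c d : Fin 2 → ℝ} (hc : c ∈ P) (hd : d ∈ P)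
    (hac : 0 < side a b c) (had : side a b d < 0) : ∃ r ∈ interior P, side a b r = 0 := by
  obtain ⟨w, hw⟩ := hint
  have cross_pt : ∀ q ∈ P, side a b w * side a b q < 0 → ∃ r ∈ interior P, side a b r = 0 := by
    intro q hq h
    have hne : side a b q - side a b w ≠ 0 := by
      intro h0
      have : side a b q = side a b w := by linarith
      rw [this] at h
      nlinarith [mul_self_nonneg (side a b w)]
    set t := side a b q / (side a b q - side a b w) with ht
    have ht0 : 0 < t := by
      rw [ht, ← mul_div_mul_right _ _ hne]
      have := mul_self_pos.2 hne
      apply div_pos _ this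
      nlinarith [mul_self_nonneg (side a b q)]
    have ht1 : 0 < 1 - t := by
      have : 1 - t = -side a b w / (side a b q - side a b w) := by rw [ht]; field_simp; ring
      rw [this, ← mul_div_mul_right _ _ hne]
      have := mul_self_pos.2 hne
      apply div_pos _ this
      nlinarith [mul_self_nonneg (side a b w)]
    refine ⟨t • w + (1 - t) • q, hP.openSegment_interior_self_subset_interior hw hq
      ⟨t, 1 - t, ht0, ht1, by ring, rfl⟩, ?_⟩
    rw [side_combo a b w q (by ring), ht]
    field_simp
    ring
  rcases lt_trichotomy (side a b w) 0 with h | h | h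
  · exact cross_pt c hc (mul_neg_of_neg_of_pos h hac)
  · exact ⟨w, hw, h⟩
  · exact cross_pt d hd (mul_neg_of_pos_of_neg h had)

theorem exists_eq_lineMap {a b p : Fin 2 → ℝ} (hab : a ≠ b) (h : side a b p = 0) :
    ∃ t : ℝ, p = AffineMap.lineMap a b t := by
  simp only [side, cross, Pi.sub_apply] at h
  have hne : b 0 - a 0 ≠ 0 ∨ b 1 - a 1 ≠ 0 := by
    by_contra! hcon
    apply hab
    ext i
    fin_cases i
    · simp; linarith
    · simp; linarith
  rcases hne with h0 | h0
  · refine ⟨(p 0 - a 0) / (b 0 - a 0), ?_⟩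
    ext i
    fin_cases i <;> simp [AffineMap.lineMap_apply] <;> field_simp
    · ring
    · linarith
  · refine ⟨(p 1 - a 1) / (b 1 - a 1), ?_⟩
    ext i
    fin_cases i <;> simp [AffineMap.lineMap_apply] <;> field_simp
    · linarith
    · ring

/-- A chord of a convex set with points of the set on both of its sides runs in the interior. -/
theorem openSegment_subset_interior_of_side {P : Set (Fin 2 → ℝ)} (hP : Convex ℝ P)
    (hint : (interior P).Nonempty) {a b c d : Fin 2 → ℝ} (ha : a ∈ P) (hb : b ∈ P) (hab : a ≠ b)
    (hc : c ∈ P) (hd : d ∈ P) (hac : 0 < side a b c) (had : side a b d < 0) :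
    openSegment ℝ a b ⊆ interior P := by
  obtain ⟨r, hr, hr0⟩ := exists_mem_interior_side_eq_zero hP hint hc hd hac had
  obtain ⟨s, rfl⟩ := exists_eq_lineMap hab hr0
  intro p hp
  rw [openSegment_eq_image_lineMap] at hp
  obtain ⟨t, ⟨ht0, ht1⟩, rfl⟩ := hp
  rcases lt_trichotomy s t with h | h | h
  · apply hP.openSegment_interior_self_subset_interior hr hb
    refine ⟨(1 - t) / (1 - s), (t - s) / (1 - s), by apply div_pos <;> linarith,
      by apply div_pos <;> linarith, ?_, ?_⟩
    · have : 1 - s ≠ 0 := by linarith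
      field_simp; ring
    · have : 1 - s ≠ 0 := by linarith
      ext i
      simp [AffineMap.lineMap_apply]
      field_simp
      ring
  · rwa [← h]
  · apply hP.openSegment_interior_self_subset_interior hr ha
    refine ⟨t / s, (s - t) / s, by apply div_pos <;> linarith,
      by apply div_pos <;> linarith, ?_, ?_⟩
    · have : s ≠ 0 := by linarith
      field_simp; ring
    · have : s ≠ 0 := by linarith
      ext i
      simp [AffineMap.lineMap_apply]
      field_simp
      ring

theorem mem_segment_of_extremePoints {P : Set (Fin 2 → ℝ)} {a b p : Fin 2 → ℝ}
    (ha : a ∈ P.extremePoints ℝ) (hb : b ∈ P.extremePoints ℝ) (hab : a ≠ b) (hp : p ∈ P)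
    (h : side a b p = 0) : p ∈ segment ℝ a b := by
  obtain ⟨t, rfl⟩ := exists_eq_lineMap hab h
  rw [mem_extremePoints_iff_left] at ha hb
  by_cases h0 : t < 0
  · have : a ∈ openSegment ℝ (AffineMap.lineMap a b t) b := by
      refine ⟨1 / (1 - t), -t / (1 - t), by apply div_pos <;> linarith,
        by apply div_pos <;> linarith, ?_, ?_⟩
      · have : 1 - t ≠ 0 := by linarith
        field_simp; ring
      · ext i
        have : 1 - t ≠ 0 := by linarith
        simp [AffineMap.lineMap_apply]
        field_simp
        ring
    rw [ha.2 _ hp _ hb.1 this]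
    exact left_mem_segment _ _ _
  by_cases h1 : 1 < t
  · have : b ∈ openSegment ℝ (AffineMap.lineMap a b t) a := by
      refine ⟨1 / t, (t - 1) / t, by apply div_pos <;> linarith,
        by apply div_pos <;> linarith, ?_, ?_⟩
      · have : t ≠ 0 := by linarith
        field_simp; ring
      · ext i
        have : t ≠ 0 := by linarith
        simp [AffineMap.lineMap_apply]
        field_simp
        ring
    rw [hb.2 _ hp _ ha.1 this]
    exact right_mem_segment _ _ _
  rw [segment_eq_image_lineMap]
  exact ⟨t, ⟨by linarith, by linarith⟩, rfl⟩

/-- Counting functions add up when a convex set is cut along a lattice segment. -/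
theorem HasPick.of_cut {P : Set (Fin 2 → ℝ)} (hP : Convex ℝ P) (hb : Bornology.IsBounded P)
    (hint : (interior P).Nonempty) {a b c d : Fin 2 → ℤ}
    (ha' : latticePoint a ∈ P.extremePoints ℝ) (hb' : latticePoint b ∈ P.extremePoints ℝ)
    (hc' : latticePoint c ∈ P) (hd' : latticePoint d ∈ P)
    (hc : 0 < sideZ a b c) (hd : sideZ a b d < 0) {m n : ℤ}
    (h₁ : HasPick (P ∩ {p | 0 ≤ side (latticePoint a) (latticePoint b) p}) m)
    (h₂ : HasPick (P ∩ {p | 0 ≤ side (latticePoint b) (latticePoint a) p}) n) :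
    HasPick P (m + n) := by
  set A := latticePoint a with hA
  set B := latticePoint b with hB
  have hAB : A ≠ B := by
    intro h
    rw [latticePoint_injective h] at hc
    simp [sideZ, cross] at hc
  set P₁ := P ∩ {p | 0 ≤ side A B p} with hP₁
  set P₂ := P ∩ {p | 0 ≤ side B A p} with hP₂
  have hunion : P = P₁ ∪ P₂ := by
    ext p
    simp only [hP₁, hP₂, Set.mem_union, Set.mem_inter_iff, Set.mem_ofPred_eq, side_swap A B]
    constructor
    · intro h
      rcases le_total 0 (side A B p) with h' | h'
      · exact Or.inl ⟨h, h'⟩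
      · exact Or.inr ⟨h, by linarith⟩
    · rintro (h | h) <;> exact h.1
  have hinter : P₁ ∩ P₂ = segment ℝ A B := by
    ext p
    simp only [hP₁, hP₂, Set.mem_inter_iff, Set.mem_ofPred_eq, side_swap A B]
    constructor
    · rintro ⟨⟨h1, h2⟩, -, h3⟩
      exact mem_segment_of_extremePoints ha' hb' hAB h1 (by linarith)
    · intro h
      have hp : side A B p = 0 := by
        have hD : 0 < side A B (latticePoint c) := by
          rw [side_latticePoint]; exact_mod_cast hc
        exact ((mem_segment_iff hD).1 h).1
      have := hP.segment_subset ha'.1 hb'.1 h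
      exact ⟨⟨this, hp.ge⟩, this, by linarith⟩
  have hint₁ : interior P₁ = interior P ∩ {p | 0 < side A B p} := by
    rw [hP₁, interior_inter, interior_side_nonneg hAB]
  have hint₂ : interior P₂ = interior P ∩ {p | 0 < side B A p} := by
    rw [hP₂, interior_inter, interior_side_nonneg hAB.symm]
  have hline : interior P ∩ {p | side A B p = 0} = openSegment ℝ A B := by
    apply Set.Subset.antisymm
    · rintro p ⟨hp, hp0⟩
      have hseg := mem_segment_of_extremePoints ha' hb' hAB (interior_subset hp) hp0
      have hne : ∀ q ∈ P.extremePoints ℝ, q ≠ p := by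
        rintro q hq rfl
        exact Set.disjoint_left.1 (disjoint_interior_extremePoints P) hp hq
      exact mem_openSegment_of_ne_left_right (hne _ ha') (hne _ hb') hseg
    · have hD : 0 < side A B (latticePoint c) := by
        rw [side_latticePoint]; exact_mod_cast hc
      exact fun p hp => ⟨openSegment_subset_interior_of_side hP hint ha'.1 hb'.1 hAB hc' hd' hD
        (by rw [side_latticePoint]; exact_mod_cast hd) hp, ((mem_openSegment_iff hD).1 hp).1⟩
  have hb₁ : Bornology.IsBounded P₁ := hb.subset Set.inter_subset_left
  have hb₂ : Bornology.IsBounded P₂ := hb.subset Set.inter_subset_left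
  have hI : latticeCount (interior P) = latticeCount (interior P₁) + latticeCount (interior P₂)
      + latticeCount (openSegment ℝ A B) := by
    rw [← latticeCount_union (hb₁.subset interior_subset) (hb₂.subset interior_subset),
      ← latticeCount_union ((hb₁.subset interior_subset).union (hb₂.subset interior_subset)),
      ← hline, hint₁, hint₂]
    · congr 1
      ext p
      simp only [Set.mem_union, Set.mem_inter_iff, Set.mem_ofPred_eq, side_swap A B]
      constructor
      · intro h
        rcases lt_trichotomy (side A B p) 0 with h' | h' | h'
        · exact Or.inl (Or.inr ⟨h, by linarith⟩)
        · exact Or.inr ⟨h, h'⟩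
        · exact Or.inl (Or.inl ⟨h, h'⟩)
      · rintro ((h | h) | h) <;> exact h.1
    · rw [← hline]
      exact hb.subset (Set.inter_subset_left.trans interior_subset)
    · rw [← hline, hint₁, hint₂, Set.disjoint_left]
      rintro p (⟨-, h⟩ | ⟨-, h⟩) ⟨-, h'⟩
      · simp only [Set.mem_ofPred_eq] at h h'; linarith
      · simp only [Set.mem_ofPred_eq, side_swap A B] at h h'; linarith
    · rw [hint₁, hint₂, Set.disjoint_left]
      rintro p ⟨-, h⟩ ⟨-, h'⟩
      simp only [Set.mem_ofPred_eq, side_swap A B] at h h'; linarith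
  have hG : ∀ k : ℕ, 1 ≤ k → latticeCount ((k : ℝ) • P)
      + (k * (latticeCount (openSegment ℝ A B) + 1) + 1)
        = latticeCount ((k : ℝ) • P₁) + latticeCount ((k : ℝ) • P₂) := by
    intro k hk
    have hk0 : (k : ℝ) ≠ 0 := by
      have : (1 : ℝ) ≤ k := by exact_mod_cast hk
      linarith
    rw [← latticeCount_segment hc hk, ← hA, ← hB, ← hinter, Set.smul_set_inter₀ hk0]
    conv_lhs => rw [hunion, Set.smul_set_union]
    exact Set.ncard_union_add_ncard_inter _ _
      (finite_setOf_latticePoint_mem (hb₁.smul₀ _)) (finite_setOf_latticePoint_mem (hb₂.smul₀ _))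
  intro k hk
  have g1 := hG 1 le_rfl
  have gk := hG k hk
  have p1 := h₁ k hk
  have p2 := h₂ k hk
  simp only [Nat.cast_one, one_smul, one_mul] at g1
  zify at g1 gk hI
  rw [hI]
  linear_combination 2 * gk + p1 + p2 - k * g1

/-- A half of a lattice polygon, cut along a diagonal, is the hull of the vertices in that half. -/
theorem hull_inter_side {V : Finset (Fin 2 → ℤ)} {a b : Fin 2 → ℤ} (ha : a ∈ V) (hb : b ∈ V)
    (hline : ∀ p ∈ hull V, side (latticePoint a) (latticePoint b) p = 0 →
      p ∈ segment ℝ (latticePoint a) (latticePoint b)) :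
    hull V ∩ {p | 0 ≤ side (latticePoint a) (latticePoint b) p}
      = hull (V.filter fun v => 0 ≤ sideZ a b v) := by
  set W := V.filter fun v => 0 ≤ sideZ a b v with hW
  have haW : a ∈ W := by simp [hW, ha]
  have hbW : b ∈ W := by simp [hW, hb]
  have hsub : hull W ⊆ hull V := by
    apply convexHull_mono
    apply Set.image_mono
    exact_mod_cast Finset.filter_subset _ V
  apply Set.Subset.antisymm
  · rintro x ⟨hx, hx0⟩
    simp only [Set.mem_ofPred_eq] at hx0
    by_cases hneg : (V.filter fun v => ¬ 0 ≤ sideZ a b v).Nonempty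
    · set N := V.filter fun v => ¬ 0 ≤ sideZ a b v with hN
      have hVu : V = W ∪ N := (Finset.filter_union_filter_not_eq _ _).symm
      rw [hull, hVu, Finset.coe_union, Set.image_union, convexHull_union ⟨_, Set.mem_image_of_mem _ haW⟩
        ((Finset.coe_nonempty.2 hneg).image _), mem_convexJoin] at hx
      obtain ⟨p, hp, q, hq, hx⟩ := hx
      have hpV : p ∈ hull V := hsub hp
      have hqV : q ∈ hull V := by
        refine convexHull_mono (Set.image_mono ?_) hq
        exact_mod_cast Finset.filter_subset _ V
      have hq0 : side (latticePoint a) (latticePoint b) q < 0 := by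
        have hconv : Convex ℝ {p | side (latticePoint a) (latticePoint b) p < 0} := by
          intro p hp q hq s t hs ht hst
          simp only [Set.mem_ofPred_eq] at *
          rw [side_combo _ _ _ _ hst]
          rcases hs.eq_or_lt with rfl | hs
          · have : t = 1 := by linarith
            subst this; linarith
          · nlinarith
        refine convexHull_min ?_ hconv hq
        rintro _ ⟨v, hv, rfl⟩
        simp only [hN, Finset.coe_filter, Set.mem_ofPred_eq, not_le] at hv
        rw [Set.mem_ofPred_eq, side_latticePoint]
        exact_mod_cast hv.2
      obtain ⟨s, t, hs, ht, hst, rfl⟩ := hx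
      rw [side_combo _ _ _ _ hst] at hx0
      set f := side (latticePoint a) (latticePoint b) p with hf
      set g := side (latticePoint a) (latticePoint b) q with hg
      rcases ht.eq_or_lt with rfl | ht
      · have : s = 1 := by linarith
        subst this
        simpa [hull] using hp
      have hf0 : 0 < f := by
        by_contra! hcon
        nlinarith [mul_pos_of_neg_of_neg hq0 (neg_lt_zero.2 ht)]
      -- the point where the segment `[p, q]` crosses the line
      have hr : (-g / (f - g)) • p + (f / (f - g)) • q ∈ hull W := by
        have hsum : -g / (f - g) + f / (f - g) = 1 := by
          have : f - g ≠ 0 := by linarith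
          field_simp; ring
        have hrV : (-g / (f - g)) • p + (f / (f - g)) • q ∈ hull V :=
          (convex_convexHull ℝ _) hpV hqV (by apply div_nonneg <;> linarith)
            (by apply div_nonneg <;> linarith) hsum
        have := hline _ hrV (by
          rw [side_combo _ _ _ _ hsum, ← hf, ← hg]; field_simp; ring)
        exact (convex_convexHull ℝ _).segment_subset
          (subset_convexHull ℝ _ (Set.mem_image_of_mem _ haW))
          (subset_convexHull ℝ _ (Set.mem_image_of_mem _ hbW)) this
      have hfg : f - g ≠ 0 := by linarith
      have hx' : s • p + t • q = ((s * f + t * g) / f) • p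
          + (t * (f - g) / f) • ((-g / (f - g)) • p + (f / (f - g)) • q) := by
        ext i
        simp only [Pi.add_apply, Pi.smul_apply, smul_eq_mul]
        field_simp
        ring
      rw [hx']
      refine (convex_convexHull ℝ _) hp hr (by positivity) ?_ ?_
      · apply div_nonneg _ hf0.le
        apply mul_nonneg ht.le; linarith
      · have : s = 1 - t := by linarith
        rw [this]; field_simp; ring
    · have : V = W := by
        rw [Finset.not_nonempty_iff_eq_empty, Finset.filter_eq_empty_iff] at hneg
        rw [hW, eq_comm, Finset.filter_eq_self]
        intro v hv
        exact not_not.1 (hneg hv)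
      rw [← this]; exact hx
  · refine fun x hx => ⟨hsub hx, ?_⟩
    refine convexHull_min ?_ (convex_side_nonneg _ _) hx
    rintro _ ⟨v, hv, rfl⟩
    simp only [hW, Finset.coe_filter, Set.mem_ofPred_eq] at hv
    rw [Set.mem_ofPred_eq, side_latticePoint]
    exact_mod_cast hv.2

theorem interior_hull_nonempty {S : Set (Fin 2 → ℤ)} {a b c : Fin 2 → ℤ} (ha : a ∈ S) (hb : b ∈ S)
    (hc : c ∈ S) (hD : 0 < sideZ a b c) : (interior (hull S)).Nonempty := by
  have hsub : hull {a, b, c} ⊆ hull S := by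
    apply convexHull_mono (Set.image_mono _)
    rintro z (rfl | rfl | rfl) <;> assumption
  refine Set.Nonempty.mono (interior_mono hsub) ?_
  rw [interior_hull_triangle hD]
  refine ⟨(1 / 3 : ℝ) • (latticePoint a + latticePoint b + latticePoint c), ?_⟩
  have hD' : (0 : ℝ) < sideZ a b c := by exact_mod_cast hD
  rw [← side_latticePoint] at hD'
  simp only [Set.mem_inter_iff, Set.mem_ofPred_eq]
  simp only [side, cross, Pi.sub_apply, Pi.add_apply, Pi.smul_apply, smul_eq_mul] at *
  exact ⟨⟨by linarith, by linarith⟩, by linarith⟩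

theorem sideZ_ne_zero_of_extremePoints {P : Set (Fin 2 → ℝ)} {a b c : Fin 2 → ℤ}
    (ha : latticePoint a ∈ P.extremePoints ℝ) (hb : latticePoint b ∈ P.extremePoints ℝ)
    (hc : latticePoint c ∈ P.extremePoints ℝ) (hab : a ≠ b) (hac : a ≠ c) (hbc : b ≠ c) :
    sideZ a b c ≠ 0 := by
  intro h
  have h0 : side (latticePoint a) (latticePoint b) (latticePoint c) = 0 := by
    rw [side_latticePoint, h, Int.cast_zero]
  have hmem := mem_segment_of_extremePoints ha hb (latticePoint_injective.ne hab) hc.1 h0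
  have := ((mem_extremePoints_iff_left.1 hc).2 _ ha.1 _ hb.1
    (mem_openSegment_of_ne_left_right (latticePoint_injective.ne hac)
      (latticePoint_injective.ne hbc) hmem))
  exact hac (latticePoint_injective this)

/-- Among four points in general position there is a line through two that separates the others:
if neither the line `ab` nor the line `ad` does, then the line `ac` does. -/
theorem exists_diagonal {V : Finset (Fin 2 → ℤ)} (hV : 3 < V.card)
    (hgen : ∀ a ∈ V, ∀ b ∈ V, ∀ c ∈ V, a ≠ b → a ≠ c → b ≠ c → sideZ a b c ≠ 0) :
    ∃ a ∈ V, ∃ b ∈ V, ∃ c ∈ V, ∃ d ∈ V, 0 < sideZ a b c ∧ sideZ a b d < 0 := by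
  obtain ⟨a, ha⟩ : V.Nonempty := Finset.card_pos.1 (by omega)
  obtain ⟨b, c, d, hb, hc, hd, hbc, hbd, hcd⟩ := Finset.two_lt_card_iff.1
    (show 2 < (V.erase a).card by rw [Finset.card_erase_of_mem ha]; omega)
  rw [Finset.mem_erase] at hb hc hd
  have e1 := hgen a ha b hb.2 c hc.2 (Ne.symm hb.1) (Ne.symm hc.1) hbc
  have e2 := hgen a ha b hb.2 d hd.2 (Ne.symm hb.1) (Ne.symm hd.1) hbd
  have e3 := hgen a ha c hc.2 d hd.2 (Ne.symm hc.1) (Ne.symm hd.1) hcd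
  have s1 : sideZ a c b = -sideZ a b c := by simp only [sideZ, cross, Pi.sub_apply]; ring
  have s2 : sideZ a d b = -sideZ a b d := by simp only [sideZ, cross, Pi.sub_apply]; ring
  have s3 : sideZ a d c = -sideZ a c d := by simp only [sideZ, cross, Pi.sub_apply]; ring
  rcases lt_or_gt_of_ne e1 with h1 | h1 <;> rcases lt_or_gt_of_ne e2 with h2 | h2 <;>
    rcases lt_or_gt_of_ne e3 with h3 | h3
  · exact ⟨a, ha, c, hc.2, b, hb.2, d, hd.2, by omega, by omega⟩
  · exact ⟨a, ha, d, hd.2, b, hb.2, c, hc.2, by omega, by omega⟩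
  · exact ⟨a, ha, b, hb.2, d, hd.2, c, hc.2, by omega, by omega⟩
  · exact ⟨a, ha, b, hb.2, d, hd.2, c, hc.2, by omega, by omega⟩
  · exact ⟨a, ha, b, hb.2, c, hc.2, d, hd.2, by omega, by omega⟩
  · exact ⟨a, ha, b, hb.2, c, hc.2, d, hd.2, by omega, by omega⟩
  · exact ⟨a, ha, d, hd.2, c, hc.2, b, hb.2, by omega, by omega⟩
  · exact ⟨a, ha, c, hc.2, d, hd.2, b, hb.2, by omega, by omega⟩

/-- A lattice polygon, given by its vertices, has a quadratic counting function; the proof is by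
induction on the number of vertices. -/
theorem exists_hasPick_of_vertices (V : Finset (Fin 2 → ℤ)) (hV : 3 ≤ V.card)
    (hext : ∀ v ∈ V, latticePoint v ∈ (hull (V : Set (Fin 2 → ℤ))).extremePoints ℝ) :
    ∃ c : ℤ, HasPick (hull (V : Set (Fin 2 → ℤ))) c := by
  induction hn : V.card using Nat.strong_induction_on generalizing V with
  | _ n ih =>
    have hgen : ∀ a ∈ V, ∀ b ∈ V, ∀ c ∈ V, a ≠ b → a ≠ c → b ≠ c → sideZ a b c ≠ 0 :=
      fun a ha b hb c hc => sideZ_ne_zero_of_extremePoints (hext a ha) (hext b hb) (hext c hc)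
    rcases hV.eq_or_lt with h3 | h4
    · obtain ⟨a, b, c, hab, hac, hbc, rfl⟩ := Finset.card_eq_three.1 h3.symm
      have hne := hgen a (by simp) b (by simp) c (by simp) hab hac hbc
      simp only [Finset.coe_insert, Finset.coe_singleton]
      rcases lt_or_gt_of_ne hne with h | h
      · refine ⟨sideZ a c b, ?_⟩
        rw [Set.pair_comm b c]
        apply hasPick_triangle
        have : sideZ a c b = -sideZ a b c := by simp only [sideZ, cross, Pi.sub_apply]; ring
        omega
      · exact ⟨_, hasPick_triangle h⟩
    · obtain ⟨a, ha, b, hb, c, hc, d, hd, hac, had⟩ := exists_diagonal h4 hgen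
      have hab : latticePoint a ≠ latticePoint b := by
        intro h
        rw [latticePoint_injective h] at hac
        simp [sideZ, cross] at hac
      have hmem : ∀ v ∈ V, latticePoint v ∈ hull (V : Set (Fin 2 → ℤ)) := fun v hv => (hext v hv).1
      have h₁ := hull_inter_side ha hb fun p hp h =>
        mem_segment_of_extremePoints (hext a ha) (hext b hb) hab hp h
      have h₂ := hull_inter_side hb ha fun p hp h =>
        mem_segment_of_extremePoints (hext b hb) (hext a ha) hab.symm hp h
      have step : ∀ W ⊆ V, 3 ≤ W.card → W.card < V.card →
          ∃ c : ℤ, HasPick (hull (W : Set (Fin 2 → ℤ))) c := by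
        intro W hWV hW3 hWlt
        refine ih _ (hn ▸ hWlt) W hW3 ?_ rfl
        intro v hv
        have hsub : hull (W : Set (Fin 2 → ℤ)) ⊆ hull (V : Set (Fin 2 → ℤ)) :=
          convexHull_mono (Set.image_mono (by exact_mod_cast hWV))
        exact inter_extremePoints_subset_extremePoints_of_subset hsub
          ⟨subset_convexHull ℝ _ (Set.mem_image_of_mem _ hv), hext v (hWV hv)⟩
      have hthree : ∀ W : Finset (Fin 2 → ℤ), ∀ e : Fin 2 → ℤ, a ∈ W → b ∈ W → e ∈ W →
          sideZ a b e ≠ 0 → 3 ≤ W.card := by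
        intro W e ha hb he h
        have : 2 < W.card := by
          refine Finset.two_lt_card_iff.2 ⟨a, b, e, ha, hb, he, fun h => hab (by rw [h]), ?_, ?_⟩
          · rintro rfl; simp [sideZ, cross] at h
          · rintro rfl; simp [sideZ, cross_self] at h
        exact this
      obtain ⟨m, hm⟩ := step (V.filter fun v => 0 ≤ sideZ a b v) (Finset.filter_subset _ _)
        (hthree _ c (by simp [ha]) (by simp [hb])
          (by simp [hc, hac.le]) hac.ne')
        (Finset.card_lt_card (Finset.filter_ssubset.2 ⟨d, hd, by omega⟩))
      obtain ⟨m', hm'⟩ := step (V.filter fun v => 0 ≤ sideZ b a v) (Finset.filter_subset _ _)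
        (hthree _ d (by simp [ha]) (by simp [hb])
          (by simp only [Finset.mem_filter, hd, true_and]; rw [sideZ_swap]; omega) had.ne)
        (Finset.card_lt_card (Finset.filter_ssubset.2 ⟨c, hc, by rw [sideZ_swap]; omega⟩))
      rw [← h₁] at hm
      rw [← h₂] at hm'
      exact ⟨m + m', HasPick.of_cut (convex_convexHull ℝ _) (isBounded_hull V.finite_toSet)
        (interior_hull_nonempty ha hb hc hac) (hext a ha) (hext b hb) (hmem c hc) (hmem d hd)
        hac had hm hm'⟩

/-! ### The vertices and the counting function of a lattice polygon -/

/-- A lattice polygon is the hull of its vertices, of which there are at least three. -/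
theorem IsLatticePolytope.exists_vertices {P : Set (Fin 2 → ℝ)} (hP : IsLatticePolytope P) :
    ∃ V : Finset (Fin 2 → ℤ), 3 ≤ V.card ∧ P = hull (V : Set (Fin 2 → ℤ)) ∧
      ∀ v ∈ V, latticePoint v ∈ P.extremePoints ℝ := by
  classical
  obtain ⟨⟨V₀, hV₀⟩, hspan⟩ := hP
  have hcomp : IsCompact P := by
    rw [hV₀]; exact Set.Finite.isCompact_convexHull ℝ (V₀.finite_toSet.image _)
  have hconv : Convex ℝ P := by rw [hV₀]; exact convex_convexHull ℝ _
  set V := V₀.filter fun v => latticePoint v ∈ P.extremePoints ℝ with hV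
  have himg : latticePoint '' (V : Set (Fin 2 → ℤ)) = P.extremePoints ℝ := by
    apply Set.Subset.antisymm
    · rintro _ ⟨v, hv, rfl⟩
      simp only [hV, Finset.coe_filter, Set.mem_ofPred_eq] at hv
      exact hv.2
    · intro p hp
      have : p ∈ latticePoint '' (V₀ : Set (Fin 2 → ℤ)) := by
        rw [hV₀] at hp
        exact extremePoints_convexHull_subset hp
      obtain ⟨v, hv, rfl⟩ := this
      exact ⟨v, by simp only [hV, Finset.coe_filter, Set.mem_ofPred_eq]; exact ⟨hv, hp⟩, rfl⟩
  have hPV : P = hull (V : Set (Fin 2 → ℤ)) := by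
    have h1 := closure_convexHull_extremePoints hcomp hconv
    rw [← himg] at h1
    exact h1.symm.trans (isClosed_hull V.finite_toSet).closure_eq
  refine ⟨V, ?_, hPV, fun v hv => himg ▸ Set.mem_image_of_mem _ hv⟩
  by_contra! hcard
  rw [hPV, hull, affineSpan_convexHull] at hspan
  have hdim : Module.finrank ℝ (vectorSpan ℝ (latticePoint '' (V : Set (Fin 2 → ℤ)))) = 2 := by
    rw [← direction_affineSpan, hspan, AffineSubspace.direction_top, finrank_top]
    simp
  rcases Nat.eq_zero_or_pos V.card with h0 | h0
  · rw [Finset.card_eq_zero.1 h0] at hdim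
    rw [Finset.coe_empty, Set.image_empty, vectorSpan_empty, finrank_bot] at hdim
    omega
  · have := finrank_vectorSpan_image_finset_le ℝ (latticePoint (n := 2)) V (n := V.card - 1)
      (by omega)
    rw [Finset.coe_image, hdim] at this
    omega

theorem IsLatticePolytope.exists_hasPick {P : Set (Fin 2 → ℝ)} (hP : IsLatticePolytope P) :
    ∃ c : ℤ, HasPick P c := by
  obtain ⟨V, h3, rfl, hext⟩ := hP.exists_vertices
  exact exists_hasPick_of_vertices V h3 hext

/-! ### Lower bounds for the area -/

/-- The leading coefficient of a counting function is determined by the asymptotics. -/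
theorem HasPick.le_of_growth {P : Set (Fin 2 → ℝ)} {m D e : ℤ} (hm : HasPick P m)
    (h : ∀ k : ℕ, 1 ≤ k → D * k ^ 2 - e * k ≤ 2 * (latticeCount ((k : ℝ) • P) : ℤ)) : D ≤ m := by
  by_contra! hlt
  set b : ℤ := latticeCount P - latticeCount (interior P) with hb
  set k : ℕ := (b + e).natAbs + 3 with hk
  have h1 := h k (by omega)
  have h2 := hm k (by omega)
  rw [h2] at h1
  have hk' : (k : ℤ) = |b + e| + 3 := by rw [hk]; push_cast; ring
  have h3 := le_abs_self (b + e)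
  have h4 : (k : ℤ) ^ 2 ≤ (b + e) * k + 2 := by nlinarith [sq_nonneg (k : ℤ)]
  have h5 := abs_nonneg (b + e)
  nlinarith

/-- Reciprocity for triangles. -/
theorem exists_latticeCount_interior_triangle {a b c : Fin 2 → ℤ} (hD : 0 < sideZ a b c) :
    ∃ e : ℤ, ∀ k : ℕ, 1 ≤ k → 2 * (latticeCount ((k : ℝ) • interior (hull {a, b, c})) : ℤ)
      = sideZ a b c * k ^ 2 - e * k + 2 := by
  refine ⟨latticeCount (hull {a, b, c}) - latticeCount (interior (hull {a, b, c})), ?_⟩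
  intro k hk
  have hk' : (0 : ℤ) < k := by exact_mod_cast hk
  have hk0 : (k : ℝ) ≠ 0 := by exact_mod_cast hk'.ne'
  have h1 : ((k : ℝ) • hull {a, b, c}) = hull {(k : ℤ) • a, (k : ℤ) • b, (k : ℤ) • c} := by
    have := smul_hull (k : ℤ) {a, b, c}
    rwa [Int.cast_natCast, Set.image_insert_eq, Set.image_pair] at this
  have hDk : 0 < sideZ ((k : ℤ) • a) ((k : ℤ) • b) ((k : ℤ) • c) := by
    rw [sideZ_smul]; positivity
  have h2 := hasPick_triangle hD k hk
  have h3 := hasPick_triangle hDk 1 le_rfl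
  rw [Nat.cast_one, one_smul, ← h1, sideZ_smul, interior_smul₀ hk0] at h3
  linear_combination 2 * h3 - h2

theorem smul_interior_triangle_subset {P : Set (Fin 2 → ℝ)} (hP : Convex ℝ P) {a b c : Fin 2 → ℤ}
    (ha : latticePoint a ∈ P) (hb : latticePoint b ∈ P) (hc : latticePoint c ∈ P) (k : ℝ) :
    k • interior (hull {a, b, c}) ⊆ k • P := by
  apply Set.smul_set_mono
  refine interior_subset.trans (convexHull_min ?_ hP)
  rintro _ ⟨z, rfl | rfl | rfl, rfl⟩ <;> assumption

theorem HasPick.sideZ_le {P : Set (Fin 2 → ℝ)} {m : ℤ} (hm : HasPick P m) (hP : Convex ℝ P)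
    (hbdd : Bornology.IsBounded P) {a b c : Fin 2 → ℤ} (ha : latticePoint a ∈ P)
    (hb : latticePoint b ∈ P) (hc : latticePoint c ∈ P) (hD : 0 < sideZ a b c) :
    sideZ a b c ≤ m := by
  obtain ⟨e, he⟩ := exists_latticeCount_interior_triangle hD
  refine hm.le_of_growth (e := e) fun k hk => ?_
  have h1 := latticeCount_mono (smul_interior_triangle_subset hP ha hb hc k) (hbdd.smul₀ _)
  have h2 := he k hk
  zify at h1
  linarith

theorem HasPick.sideZ_sub_sideZ_le {P : Set (Fin 2 → ℝ)} {m : ℤ} (hm : HasPick P m)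
    (hP : Convex ℝ P) (hbdd : Bornology.IsBounded P) {a b c d : Fin 2 → ℤ}
    (ha : latticePoint a ∈ P) (hb : latticePoint b ∈ P) (hc : latticePoint c ∈ P)
    (hd : latticePoint d ∈ P) (hac : 0 < sideZ a b c) (had : sideZ a b d < 0) :
    sideZ a b c - sideZ a b d ≤ m := by
  have had' : 0 < sideZ b a d := by rw [sideZ_swap]; omega
  obtain ⟨e, he⟩ := exists_latticeCount_interior_triangle hac
  obtain ⟨e', he'⟩ := exists_latticeCount_interior_triangle had'
  refine hm.le_of_growth (e := e + e') fun k hk => ?_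
  have hk0 : (k : ℝ) ≠ 0 := by
    have : (1 : ℝ) ≤ k := by exact_mod_cast hk
    linarith
  have hdisj : Disjoint ((k : ℝ) • interior (hull {a, b, c}))
      ((k : ℝ) • interior (hull {b, a, d})) := by
    rw [Set.disjoint_iff_inter_eq_empty, ← Set.smul_set_inter₀ hk0, Set.smul_set_eq_empty,
      ← Set.disjoint_iff_inter_eq_empty, Set.disjoint_left, interior_hull_triangle hac, interior_hull_triangle had']
    rintro p ⟨⟨h1, -⟩, -⟩ ⟨⟨h2, -⟩, -⟩
    simp only [Set.mem_ofPred_eq, side_swap (latticePoint a) (latticePoint b)] at h1 h2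
    linarith
  have hsub := Set.union_subset (smul_interior_triangle_subset hP ha hb hc k)
    (smul_interior_triangle_subset hP hb ha hd k)
  have hb' := hbdd.smul₀ (k : ℝ)
  have h1 := latticeCount_mono hsub hb'
  rw [latticeCount_union (hb'.subset (Set.subset_union_left.trans hsub))
    (hb'.subset (Set.subset_union_right.trans hsub)) hdisj] at h1
  have h2 := he k hk
  have h3 := he' k hk
  rw [sideZ_swap] at h3
  zify at h1
  linarith

/-- Twice the area of a lattice polygon is at least the area of the parallelogram spanned by the
differences of two pairs of its points. -/
theorem HasPick.cross_le {P : Set (Fin 2 → ℝ)} {m : ℤ} (hm : HasPick P m) (hP : Convex ℝ P)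
    (hbdd : Bornology.IsBounded P) {a b c d : Fin 2 → ℤ} (ha : latticePoint a ∈ P)
    (hb : latticePoint b ∈ P) (hc : latticePoint c ∈ P) (hd : latticePoint d ∈ P) :
    cross (b - a) (d - c) ≤ m := by
  have h : cross (b - a) (d - c) = sideZ a b d - sideZ a b c := by
    simp only [sideZ, cross, Pi.sub_apply]; ring
  rw [h]
  rcases lt_or_ge 0 (sideZ a b d) with h1 | h1 <;> rcases lt_or_ge (sideZ a b c) 0 with h2 | h2
  · exact hm.sideZ_sub_sideZ_le hP hbdd ha hb hd hc h1 h2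
  · have := hm.sideZ_le hP hbdd ha hb hd h1
    omega
  · have := hm.sideZ_le hP hbdd hb ha hc (by rw [sideZ_swap]; omega)
    rw [sideZ_swap] at this
    omega
  · have : 0 ≤ m := hm.le_of_growth (e := 0) fun k hk => by simp
    omega

/-! ### Unimodular equivalence -/

section Unimodular

variable {n : ℕ}

/-- The affine map `x ↦ A x + b` of `ℝⁿ`. -/
noncomputable def intAffine (A : Matrix (Fin n) (Fin n) ℤ) (b : Fin n → ℤ) :
    (Fin n → ℝ) →ᵃ[ℝ] (Fin n → ℝ) :=
  (Matrix.toLin' (A.map (fun a : ℤ => (a : ℝ)))).toAffineMap + AffineMap.const ℝ _ (latticePoint b)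

theorem intAffine_apply (A : Matrix (Fin n) (Fin n) ℤ) (b : Fin n → ℤ) (x : Fin n → ℝ) :
    intAffine A b x = (A.map (fun a : ℤ => (a : ℝ))).mulVec x + latticePoint b := by
  simp [intAffine]

theorem intAffine_latticePoint (A : Matrix (Fin n) (Fin n) ℤ) (b z : Fin n → ℤ) :
    intAffine A b (latticePoint z) = latticePoint (A.mulVec z + b) := by
  rw [intAffine_apply, latticePoint_add]
  congr 1
  ext i
  simp [latticePoint, Matrix.mulVec, dotProduct]

theorem intAffine_comp (A B : Matrix (Fin n) (Fin n) ℤ) (b c : Fin n → ℤ) (x : Fin n → ℝ) :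
    intAffine B c (intAffine A b x) = intAffine (B * A) (B.mulVec b + c) x := by
  have h := intAffine_latticePoint B 0 b
  rw [intAffine_apply] at h
  simp only [add_zero] at h
  simp only [intAffine_apply, Matrix.mulVec_add, Matrix.mulVec_mulVec, latticePoint_add, ← h]
  have h0 : latticePoint (0 : Fin n → ℤ) = 0 := by ext i; simp [latticePoint]
  have hmap : (B * A).map (fun a : ℤ => (a : ℝ))
      = B.map (fun a : ℤ => (a : ℝ)) * A.map (fun a : ℤ => (a : ℝ)) :=
    Matrix.map_mul (f := Int.castRingHom ℝ)
  rw [h0, hmap]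
  abel

theorem intAffine_one (x : Fin n → ℝ) : intAffine 1 0 x = x := by
  rw [intAffine_apply]
  ext i
  simp [latticePoint, Matrix.map_one]

theorem unimodularEquivalent_iff {P Q : Set (Fin n → ℝ)} : UnimodularEquivalent P Q ↔
    ∃ (A : Matrix (Fin n) (Fin n) ℤ) (b : Fin n → ℤ), IsUnit A.det ∧ Q = intAffine A b '' P := by
  simp only [UnimodularEquivalent, ← intAffine_apply]

theorem UnimodularEquivalent.refl (P : Set (Fin n → ℝ)) : UnimodularEquivalent P P :=
  unimodularEquivalent_iff.2 ⟨1, 0, by simp, by simp [intAffine_one]⟩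

theorem UnimodularEquivalent.trans {P Q R : Set (Fin n → ℝ)} (h : UnimodularEquivalent P Q)
    (h' : UnimodularEquivalent Q R) : UnimodularEquivalent P R := by
  rw [unimodularEquivalent_iff] at *
  obtain ⟨A, b, hA, rfl⟩ := h
  obtain ⟨B, c, hB, rfl⟩ := h'
  refine ⟨B * A, B.mulVec b + c, by rw [Matrix.det_mul]; exact hB.mul hA, ?_⟩
  simp only [Set.image_image, intAffine_comp]

theorem intAffine_inv {A : Matrix (Fin n) (Fin n) ℤ} (hA : IsUnit A.det) (b : Fin n → ℤ)
    (x : Fin n → ℝ) : intAffine A⁻¹ (-(A⁻¹.mulVec b)) (intAffine A b x) = x := by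
  rw [intAffine_comp, Matrix.nonsing_inv_mul _ hA, add_neg_cancel, intAffine_one]

theorem intAffine_inv' {A : Matrix (Fin n) (Fin n) ℤ} (hA : IsUnit A.det) (b : Fin n → ℤ)
    (x : Fin n → ℝ) : intAffine A b (intAffine A⁻¹ (-(A⁻¹.mulVec b)) x) = x := by
  rw [intAffine_comp, Matrix.mul_nonsing_inv _ hA, Matrix.mulVec_neg, Matrix.mulVec_mulVec,
    Matrix.mul_nonsing_inv _ hA, Matrix.one_mulVec, neg_add_cancel, intAffine_one]

theorem UnimodularEquivalent.symm {P Q : Set (Fin n → ℝ)} (h : UnimodularEquivalent P Q) :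
    UnimodularEquivalent Q P := by
  rw [unimodularEquivalent_iff] at *
  obtain ⟨A, b, hA, rfl⟩ := h
  refine ⟨A⁻¹, -(A⁻¹.mulVec b), by rw [Matrix.isUnit_nonsing_inv_det_iff]; exact hA, ?_⟩
  simp [Set.image_image, intAffine_inv hA]

/-- A unimodular affine map as a homeomorphism of `ℝⁿ`. -/
noncomputable def intAffineHomeomorph (A : Matrix (Fin n) (Fin n) ℤ) (b : Fin n → ℤ)
    (hA : IsUnit A.det) : (Fin n → ℝ) ≃ₜ (Fin n → ℝ) where
  toFun := intAffine A b
  invFun := intAffine A⁻¹ (-(A⁻¹.mulVec b))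
  left_inv := intAffine_inv hA b
  right_inv := intAffine_inv' hA b
  continuous_toFun := AffineMap.continuous_of_finiteDimensional _
  continuous_invFun := AffineMap.continuous_of_finiteDimensional _

theorem latticeCount_intAffine_image {A : Matrix (Fin n) (Fin n) ℤ} (hA : IsUnit A.det)
    (b : Fin n → ℤ) (S : Set (Fin n → ℝ)) : latticeCount (intAffine A b '' S) = latticeCount S := by
  have hinj : Function.Injective (fun z : Fin n → ℤ => A.mulVec z + b) := by
    intro z z' h
    apply latticePoint_injective
    apply (intAffineHomeomorph A b hA).injective
    change intAffine A b _ = intAffine A b _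
    rw [intAffine_latticePoint, intAffine_latticePoint]
    exact congrArg _ h
  rw [latticeCount, latticeCount]
  conv_rhs => rw [← Set.ncard_image_of_injective _ hinj]
  congr 1
  ext z
  simp only [Set.mem_ofPred_eq, Set.mem_image]
  constructor
  · rintro ⟨x, hx, hxz⟩
    refine ⟨A⁻¹.mulVec z + -(A⁻¹.mulVec b), ?_, ?_⟩
    · rw [← intAffine_latticePoint, ← hxz, intAffine_inv hA]; exact hx
    · rw [Matrix.mulVec_add, Matrix.mulVec_neg, Matrix.mulVec_mulVec, Matrix.mulVec_mulVec,
        Matrix.mul_nonsing_inv _ hA, Matrix.one_mulVec, Matrix.one_mulVec, neg_add_cancel_right]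
  · rintro ⟨z, hz, rfl⟩
    exact ⟨latticePoint z, hz, intAffine_latticePoint A b z⟩

theorem UnimodularEquivalent.latticeCount_interior {P Q : Set (Fin n → ℝ)}
    (h : UnimodularEquivalent P Q) : latticeCount (interior Q) = latticeCount (interior P) := by
  obtain ⟨A, b, hA, rfl⟩ := unimodularEquivalent_iff.1 h
  have := (intAffineHomeomorph A b hA).image_interior P
  change intAffine A b '' _ = interior (intAffine A b '' P) at this
  rw [← this, latticeCount_intAffine_image hA]

theorem UnimodularEquivalent.latticeCount_frontier {P Q : Set (Fin n → ℝ)}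
    (h : UnimodularEquivalent P Q) : latticeCount (frontier Q) = latticeCount (frontier P) := by
  obtain ⟨A, b, hA, rfl⟩ := unimodularEquivalent_iff.1 h
  have := (intAffineHomeomorph A b hA).image_frontier P
  change intAffine A b '' _ = frontier (intAffine A b '' P) at this
  rw [← this, latticeCount_intAffine_image hA]

theorem UnimodularEquivalent.isLatticePolytope {P Q : Set (Fin n → ℝ)}
    (h : UnimodularEquivalent P Q) (hP : IsLatticePolytope P) : IsLatticePolytope Q := by
  obtain ⟨A, b, hA, rfl⟩ := unimodularEquivalent_iff.1 h
  obtain ⟨⟨V, rfl⟩, hspan⟩ := hP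
  refine ⟨⟨V.image fun z => A.mulVec z + b, ?_⟩, ?_⟩
  · rw [AffineMap.image_convexHull, Finset.coe_image, Set.image_image, Set.image_image]
    simp only [intAffine_latticePoint]
  · rw [← AffineSubspace.map_span, hspan]
    exact AffineMap.map_top_of_surjective _ (intAffineHomeomorph A b hA).surjective

end Unimodular

/-! ### Pick's formula and the Ehrhart polynomial -/

section Polygon

variable {P : Set (Fin 2 → ℝ)}

theorem IsLatticePolytope.isCompact (hP : IsLatticePolytope P) : IsCompact P := by
  obtain ⟨⟨V, rfl⟩, -⟩ := hP
  exact Set.Finite.isCompact_convexHull ℝ (V.finite_toSet.image _)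

theorem IsLatticePolytope.convex (hP : IsLatticePolytope P) : Convex ℝ P := by
  obtain ⟨⟨V, rfl⟩, -⟩ := hP
  exact convex_convexHull ℝ _

theorem IsLatticePolytope.interior_nonempty (hP : IsLatticePolytope P) : (interior P).Nonempty :=
  hP.convex.interior_nonempty_iff_affineSpan_eq_top.2 hP.2

theorem IsLatticePolytope.finite_lattice (hP : IsLatticePolytope P) :
    {z | latticePoint z ∈ P}.Finite :=
  finite_setOf_latticePoint_mem hP.isCompact.isBounded

theorem IsLatticePolytope.eq_hull (hP : IsLatticePolytope P) :
    P = hull {z | latticePoint z ∈ P} := by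
  obtain ⟨V, hV⟩ := hP.1
  apply Set.Subset.antisymm
  · conv_lhs => rw [hV]
    apply convexHull_mono (Set.image_mono _)
    intro v hv
    rw [Set.mem_ofPred_eq, hV]
    exact subset_convexHull ℝ _ (Set.mem_image_of_mem _ hv)
  · apply convexHull_min _ hP.convex
    rintro _ ⟨z, hz, rfl⟩
    exact hz

theorem IsLatticePolytope.latticeCount_eq (hP : IsLatticePolytope P) :
    latticeCount P = latticeCount (interior P) + latticeCount (frontier P) := by
  have hc := hP.isCompact.isClosed
  have hb := hP.isCompact.isBounded
  rw [hc.frontier_eq, ← latticeCount_union (hb.subset interior_subset) (hb.subset Set.sdiff_subset)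
    Set.disjoint_sdiff_right, Set.union_sdiff_cancel interior_subset]

theorem IsLatticePolytope.three_le_latticeCount_frontier (hP : IsLatticePolytope P) :
    3 ≤ latticeCount (frontier P) := by
  obtain ⟨V, h3, -, hext⟩ := hP.exists_vertices
  refine h3.trans ?_
  rw [latticeCount, ← Set.ncard_coe_finset]
  refine Set.ncard_le_ncard ?_ (finite_setOf_latticePoint_mem
    (hP.isCompact.isBounded.subset hP.isCompact.isClosed.frontier_subset))
  intro v hv
  rw [Set.mem_ofPred_eq, hP.isCompact.isClosed.frontier_eq]
  exact ⟨(hext v hv).1, fun h =>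
    Set.disjoint_left.1 (disjoint_interior_extremePoints P) h (hext v hv)⟩

/-- **Pick's formula**, for all dilates. -/
theorem IsLatticePolytope.hasPick (hP : IsLatticePolytope P) :
    HasPick P (2 * latticeCount (interior P) + latticeCount (frontier P) - 2) := by
  obtain ⟨c, hc⟩ := hP.exists_hasPick
  have h := hc 1 le_rfl
  have h' := hP.latticeCount_eq
  rw [Nat.cast_one, one_smul] at h
  zify at h'
  have : c = 2 * latticeCount (interior P) + latticeCount (frontier P) - 2 := by
    rw [h'] at h; push_cast at h; linarith
  rwa [← this]

theorem IsLatticePolytope.ehrhartPolynomial_eq (hP : IsLatticePolytope P) :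
    ehrhartPolynomial P =
      Polynomial.C ((latticeCount (interior P) : ℝ) + latticeCount (frontier P) / 2 - 1)
          * Polynomial.X ^ 2
        + Polynomial.C ((latticeCount (frontier P) : ℝ) / 2) * Polynomial.X + 1 := by
  apply IsEhrhartPolynomial.eq_ehrhartPolynomial
  intro k hk
  have h := hP.hasPick k hk
  have h' := hP.latticeCount_eq
  have hR : (2 * (latticeCount ((k : ℝ) • P)) : ℝ)
      = (2 * latticeCount (interior P) + latticeCount (frontier P) - 2) * k ^ 2
        + (latticeCount P - latticeCount (interior P)) * k + 2 := by exact_mod_cast h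
  have hR' : (latticeCount P : ℝ) = latticeCount (interior P) + latticeCount (frontier P) := by
    exact_mod_cast h'
  rw [hR'] at hR
  simp only [Polynomial.eval_add, Polynomial.eval_mul, Polynomial.eval_C, Polynomial.eval_pow,
    Polynomial.eval_X, Polynomial.eval_one]
  linarith

theorem IsLatticePolytope.mem_ehrhartRoots_iff (hP : IsLatticePolytope P) {s : ℂ} :
    s ∈ ehrhartRoots P ↔
      ((latticeCount (interior P) : ℂ) + latticeCount (frontier P) / 2 - 1) * s ^ 2
        + latticeCount (frontier P) / 2 * s + 1 = 0 := by
  rw [ehrhartRoots, Set.mem_ofPred_eq, hP.ehrhartPolynomial_eq]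
  simp

/-- The bound `HasPick.cross_le` with the area expressed by Pick's formula. -/
theorem IsLatticePolytope.cross_le (hP : IsLatticePolytope P) {a b c d : Fin 2 → ℤ}
    (ha : latticePoint a ∈ P) (hb : latticePoint b ∈ P) (hc : latticePoint c ∈ P)
    (hd : latticePoint d ∈ P) : cross (b - a) (d - c)
      ≤ 2 * latticeCount (interior P) + latticeCount (frontier P) - 2 :=
  hP.hasPick.cross_le hP.convex hP.isCompact.isBounded ha hb hc hd

end Polygon

/-! ### The rows of a lattice polygon -/

/-- `u` is a highest and `v` a lowest lattice point of `P`. -/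
structure IsTopBot (P : Set (Fin 2 → ℝ)) (u v : Fin 2 → ℤ) : Prop where
  top_mem : latticePoint u ∈ P
  bot_mem : latticePoint v ∈ P
  le_top : ∀ z, latticePoint z ∈ P → z 1 ≤ u 1
  bot_le : ∀ z, latticePoint z ∈ P → v 1 ≤ z 1

section Rows

variable {P : Set (Fin 2 → ℝ)} {u v : Fin 2 → ℤ}

theorem IsLatticePolytope.exists_isTopBot (hP : IsLatticePolytope P) :
    ∃ u v, IsTopBot P u v := by
  obtain ⟨V, h3, -, hext⟩ := hP.exists_vertices
  obtain ⟨w, hw⟩ : V.Nonempty := Finset.card_pos.1 (by omega)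
  have hne : {z | latticePoint z ∈ P}.Nonempty := ⟨w, (hext w hw).1⟩
  obtain ⟨u, hu, hu'⟩ := Set.exists_max_image _ (fun z => z 1) hP.finite_lattice hne
  obtain ⟨v, hv, hv'⟩ := Set.exists_min_image _ (fun z => z 1) hP.finite_lattice hne
  exact ⟨u, v, hu, hv, hu', hv'⟩

/-- In each row that meets `P` there are a leftmost and a rightmost lattice point of `P`. -/
theorem IsLatticePolytope.exists_row_ends (hP : IsLatticePolytope P) {w : Fin 2 → ℤ}
    (hw : latticePoint w ∈ P) : ∃ l r : Fin 2 → ℤ, latticePoint l ∈ P ∧ latticePoint r ∈ P ∧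
      l 1 = w 1 ∧ r 1 = w 1 ∧ ∀ z, latticePoint z ∈ P → z 1 = w 1 → l 0 ≤ z 0 ∧ z 0 ≤ r 0 := by
  have hfin : {z | latticePoint z ∈ P ∧ z 1 = w 1}.Finite :=
    hP.finite_lattice.subset fun z hz => hz.1
  have hne : {z | latticePoint z ∈ P ∧ z 1 = w 1}.Nonempty := ⟨w, hw, rfl⟩
  obtain ⟨l, hl, hl'⟩ := Set.exists_min_image _ (fun z => z 0) hfin hne
  obtain ⟨r, hr, hr'⟩ := Set.exists_max_image _ (fun z => z 0) hfin hne
  exact ⟨l, r, hl.1, hr.1, hl.2, hr.2, fun z hz hz1 => ⟨hl' z ⟨hz, hz1⟩, hr' z ⟨hz, hz1⟩⟩⟩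

theorem mem_openSegment_of_row {x y z : Fin 2 → ℝ} (hxy : x 1 = y 1) (hyz : y 1 = z 1)
    (h1 : x 0 < y 0) (h2 : y 0 < z 0) : y ∈ openSegment ℝ x z := by
  have h3 : z 0 - x 0 ≠ 0 := by linarith
  refine ⟨(z 0 - y 0) / (z 0 - x 0), (y 0 - x 0) / (z 0 - x 0), by apply div_pos <;> linarith,
    by apply div_pos <;> linarith, by field_simp; ring, ?_⟩
  ext i
  fin_cases i
  · simp; field_simp; ring
  · simp [hxy, hyz]; field_simp; ring

theorem mem_of_row (hP : Convex ℝ P) {x y z : Fin 2 → ℤ} (hx : latticePoint x ∈ P)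
    (hz : latticePoint z ∈ P) (hxy : x 1 = y 1) (hyz : y 1 = z 1) (h1 : x 0 ≤ y 0)
    (h2 : y 0 ≤ z 0) : latticePoint y ∈ P := by
  rcases h1.eq_or_lt with h1 | h1
  · have : x = y := by ext i; fin_cases i <;> simp [h1, hxy]
    rwa [← this]
  rcases h2.eq_or_lt with h2 | h2
  · have : y = z := by ext i; fin_cases i <;> simp [h2, hyz]
    rwa [this]
  refine hP.openSegment_subset hx hz (mem_openSegment_of_row ?_ ?_ ?_ ?_) <;>
    simp only [latticePoint] <;> exact_mod_cast (by assumption)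

namespace IsTopBot

theorem interior_row (h : IsTopBot P u v) (hP : IsLatticePolytope P) {x : Fin 2 → ℝ}
    (hx : x ∈ interior P) : (v 1 : ℝ) < x 1 ∧ x 1 < u 1 := by
  constructor
  · set a : Fin 2 → ℝ := ![0, v 1] with ha
    set b : Fin 2 → ℝ := ![1, v 1] with hb
    have hside : ∀ p, side a b p = p 1 - v 1 := by
      intro p; simp [side, cross, ha, hb]
    have hab : a ≠ b := fun h => by simpa [ha, hb] using congrFun h 0
    have hsub : P ⊆ {p | 0 ≤ side a b p} := by
      rw [hP.eq_hull]
      apply convexHull_min _ (convex_side_nonneg a b)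
      rintro _ ⟨z, hz, rfl⟩
      rw [Set.mem_ofPred_eq, hside, sub_nonneg, latticePoint]
      exact_mod_cast h.bot_le z hz
    have := interior_mono hsub hx
    rw [interior_side_nonneg hab, Set.mem_ofPred_eq, hside] at this
    linarith
  · set a : Fin 2 → ℝ := ![1, u 1] with ha
    set b : Fin 2 → ℝ := ![0, u 1] with hb
    have hside : ∀ p, side a b p = u 1 - p 1 := by
      intro p; simp [side, cross, ha, hb]
    have hab : a ≠ b := fun h => by simpa [ha, hb] using congrFun h 0
    have hsub : P ⊆ {p | 0 ≤ side a b p} := by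
      rw [hP.eq_hull]
      apply convexHull_min _ (convex_side_nonneg a b)
      rintro _ ⟨z, hz, rfl⟩
      rw [Set.mem_ofPred_eq, hside, sub_nonneg, latticePoint]
      exact_mod_cast h.le_top z hz
    have := interior_mono hsub hx
    rw [interior_side_nonneg hab, Set.mem_ofPred_eq, hside] at this
    linarith

theorem mem_interior (h : IsTopBot P u v) (hP : IsLatticePolytope P) {x y z : Fin 2 → ℝ}
    (hx : x ∈ P) (hz : z ∈ P) (hxy : x 1 = y 1) (hyz : y 1 = z 1) (h1 : x 0 < y 0)
    (h2 : y 0 < z 0) (hv : v 1 < y 1) (hu : y 1 < u 1) : y ∈ interior P := by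
  have hside : ∀ p, side x z p = (z 0 - x 0) * (p 1 - y 1) := by
    intro p; simp only [side, cross, Pi.sub_apply, hxy, hyz]; ring
  have h02 : 0 < z 0 - x 0 := by linarith
  refine openSegment_subset_interior_of_side hP.convex hP.interior_nonempty hx hz ?_ h.top_mem
    h.bot_mem ?_ ?_ (mem_openSegment_of_row hxy hyz h1 h2)
  · rintro rfl; linarith
  · rw [hside]; apply mul_pos h02; simp only [latticePoint]; linarith
  · rw [hside]; apply mul_neg_of_pos_of_neg h02; simp only [latticePoint]; linarith

theorem mem_interior_lattice (h : IsTopBot P u v) (hP : IsLatticePolytope P) {x y z : Fin 2 → ℤ}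
    (hx : latticePoint x ∈ P) (hz : latticePoint z ∈ P) (hxy : x 1 = y 1) (hyz : y 1 = z 1)
    (h1 : x 0 < y 0) (h2 : y 0 < z 0) (hv : v 1 < y 1) (hu : y 1 < u 1) :
    latticePoint y ∈ interior P := by
  refine h.mem_interior hP hx hz ?_ ?_ ?_ ?_ ?_ ?_ <;> simp only [latticePoint] <;>
    exact_mod_cast (by assumption)

/-- The boundary lattice points of an inner row are the ends of that row. -/
theorem ncard_frontier_row_le (h : IsTopBot P u v) (hP : IsLatticePolytope P) {j : ℤ}
    (hv : v 1 < j) (hu : j < u 1) :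
    {z | latticePoint z ∈ frontier P ∧ z 1 = j}.ncard ≤ 2 := by
  have hfr : frontier P = P \ interior P := hP.isCompact.isClosed.frontier_eq
  set F := {z | latticePoint z ∈ frontier P ∧ z 1 = j} with hF
  have hfin : F.Finite := hP.finite_lattice.subset fun z hz => by
    have := hz.1
    rw [hfr] at this
    exact this.1
  rcases F.eq_empty_or_nonempty with h0 | hne
  · rw [h0]; simp
  obtain ⟨l, hl, hl'⟩ := Set.exists_min_image _ (fun z => z 0) hfin hne
  obtain ⟨r, hr, hr'⟩ := Set.exists_max_image _ (fun z => z 0) hfin hne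
  have hsub : F ⊆ {l, r} := by
    intro z hz
    have e1 := hl' z hz
    have e2 := hr' z hz
    rw [hF, Set.mem_ofPred_eq, hfr] at hl hr hz
    by_contra hcon
    simp only [Set.mem_insert_iff, Set.mem_singleton_iff, not_or] at hcon
    refine hz.1.2 (h.mem_interior_lattice hP hl.1.1 hr.1.1 (hl.2.trans hz.2.symm)
      (hz.2.trans hr.2.symm) (lt_of_le_of_ne e1 fun e => hcon.1 ?_)
      (lt_of_le_of_ne e2 fun e => hcon.2 ?_) (by omega) (by omega))
    · ext i; fin_cases i
      · exact e.symm
      · simp [hz.2, hl.2]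
    · ext i; fin_cases i
      · exact e
      · simp [hz.2, hr.2]
  exact (Set.ncard_le_ncard hsub).trans ((Set.ncard_insert_le l {r}).trans (by simp))

end IsTopBot

theorem ncard_row_le {j a b : ℤ} (hab : a ≤ b) {F : Set (Fin 2 → ℤ)}
    (hF : ∀ z ∈ F, z 1 = j ∧ a ≤ z 0 ∧ z 0 ≤ b) : (F.ncard : ℤ) ≤ b - a + 1 := by
  have hinj : Set.InjOn (fun z : Fin 2 → ℤ => z 0) F := by
    intro z hz z' hz' h
    ext i; fin_cases i
    · exact h
    · simp [(hF z hz).1, (hF z' hz').1]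
  have h1 := hinj.ncard_image
  have h2 : (fun z : Fin 2 → ℤ => z 0) '' F ⊆ (Finset.Icc a b : Finset ℤ) := by
    rintro _ ⟨z, hz, rfl⟩
    simpa using (hF z hz).2
  have h3 := Set.ncard_le_ncard h2 (Finset.finite_toSet _)
  rw [h1, Set.ncard_coe_finset, Int.card_Icc] at h3
  omega

/-- The number of boundary lattice points is bounded by the numbers in the top and bottom rows, and
by two for each of the inner rows. -/
theorem IsTopBot.latticeCount_frontier_le (h : IsTopBot P u v) (hP : IsLatticePolytope P)
    (huv : v 1 < u 1) {l r l' r' : Fin 2 → ℤ} (hl : latticePoint l ∈ P) (hl1 : l 1 = u 1)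
    (hl' : latticePoint l' ∈ P) (hl1' : l' 1 = v 1)
    (htop : ∀ z, latticePoint z ∈ P → z 1 = u 1 → l 0 ≤ z 0 ∧ z 0 ≤ r 0)
    (hbot : ∀ z, latticePoint z ∈ P → z 1 = v 1 → l' 0 ≤ z 0 ∧ z 0 ≤ r' 0) :
    (latticeCount (frontier P) : ℤ) ≤
      (r 0 - l 0) + (r' 0 - l' 0) + 2
        + ∑ j ∈ Finset.Ioo (v 1) (u 1), ({z | latticePoint z ∈ frontier P ∧ z 1 = j}.ncard : ℤ) := by
  have hfr : frontier P ⊆ P := hP.isCompact.isClosed.frontier_subset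
  have hfin : {z | latticePoint z ∈ frontier P}.Finite := hP.finite_lattice.subset fun z hz => hfr hz
  have hrow : ∀ j : ℤ, {z | latticePoint z ∈ frontier P ∧ z 1 = j}.ncard
      = (hfin.toFinset.filter fun z => z 1 = j).card := by
    intro j
    rw [← Set.ncard_coe_finset]
    congr 1
    ext z
    simp
  have hcard : latticeCount (frontier P) = hfin.toFinset.card := by
    rw [latticeCount, Set.ncard_eq_toFinset_card _ hfin]
  have hmaps : ∀ z ∈ hfin.toFinset, z 1 ∈ Finset.Icc (v 1) (u 1) := by
    intro z hz
    rw [Set.Finite.mem_toFinset] at hz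
    rw [Finset.mem_Icc]
    exact ⟨h.bot_le z (hfr hz), h.le_top z (hfr hz)⟩
  rw [hcard, Finset.card_eq_sum_card_fiberwise hmaps]
  have hIcc : Finset.Icc (v 1) (u 1) = insert (v 1) (insert (u 1) (Finset.Ioo (v 1) (u 1))) := by
    ext j
    simp only [Finset.mem_Icc, Finset.mem_insert, Finset.mem_Ioo]
    omega
  rw [hIcc, Finset.sum_insert (by simp [huv.ne]), Finset.sum_insert (by simp)]
  simp only [← hrow]
  have h1 := ncard_row_le (htop l hl hl1).2
    (F := {z | latticePoint z ∈ frontier P ∧ z 1 = u 1})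
    fun z hz => ⟨hz.2, htop z (hfr hz.1) hz.2⟩
  have h2 := ncard_row_le (hbot l' hl' hl1').2
    (F := {z | latticePoint z ∈ frontier P ∧ z 1 = v 1})
    fun z hz => ⟨hz.2, hbot z (hfr hz.1) hz.2⟩
  push_cast
  linarith

end Rows

/-! ### Lattice width -/

/-- Every lattice polygon has a unimodular image for which the height, the width in the direction
of the second coordinate, is not larger than the width in any of the directions `x + k y`. -/
theorem IsLatticePolytope.exists_minimal_height {P : Set (Fin 2 → ℝ)} (hP : IsLatticePolytope P) :
    ∃ Q u v, UnimodularEquivalent P Q ∧ IsTopBot Q u v ∧ ∀ k : ℤ, ∃ y y' : Fin 2 → ℤ,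
      latticePoint y ∈ Q ∧ latticePoint y' ∈ Q ∧
        u 1 - v 1 ≤ (y' 0 + k * y' 1) - (y 0 + k * y 1) := by
  classical
  have hex : ∃ n : ℕ, ∃ Q u v, UnimodularEquivalent P Q ∧ IsTopBot Q u v ∧ u 1 - v 1 = n := by
    obtain ⟨u, v, huv⟩ := hP.exists_isTopBot
    refine ⟨(u 1 - v 1).toNat, P, u, v, .refl P, huv, ?_⟩
    have := huv.bot_le u huv.top_mem
    omega
  obtain ⟨Q, u, v, hPQ, huv, hn⟩ := Nat.find_spec hex
  refine ⟨Q, u, v, hPQ, huv, fun k => ?_⟩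
  have hA : IsUnit (!![0, 1; 1, k] : Matrix (Fin 2) (Fin 2) ℤ).det := by
    rw [Matrix.det_fin_two_of]; simp
  have hQR : UnimodularEquivalent Q (intAffine !![0, 1; 1, k] 0 '' Q) :=
    unimodularEquivalent_iff.2 ⟨_, _, hA, rfl⟩
  have hR := (hPQ.trans hQR).isLatticePolytope hP
  obtain ⟨a, b, hab⟩ := hR.exists_isTopBot
  have hmin : Nat.find hex ≤ (a 1 - b 1).toNat := by
    apply Nat.find_min' hex
    refine ⟨_, a, b, hPQ.trans hQR, hab, ?_⟩
    have := hab.bot_le a hab.top_mem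
    omega
  have hpre : ∀ z, latticePoint z ∈ intAffine !![0, 1; 1, k] 0 '' Q →
      ∃ y : Fin 2 → ℤ, latticePoint y ∈ Q ∧ z 1 = y 0 + k * y 1 := by
    rintro z ⟨x, hx, hxz⟩
    have hinv := intAffine_inv hA 0 x
    rw [hxz, intAffine_latticePoint] at hinv
    refine ⟨_, hinv ▸ hx, ?_⟩
    rw [← hinv, intAffine_latticePoint] at hxz
    have := congrFun (latticePoint_injective hxz) 1
    rw [← this]
    simp
    ring
  obtain ⟨y', hy', e'⟩ := hpre a hab.top_mem
  obtain ⟨y, hy, e⟩ := hpre b hab.bot_mem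
  have := hab.bot_le a hab.top_mem
  exact ⟨y, y', hy, hy', by omega⟩

/-! ### Scott's inequality -/

/-- The triangle `conv {(0, 0), (3, 0), (0, 3)}`. -/
def tripleSimplex : Set (Fin 2 → ℝ) := hull {0, ![3, 0], ![0, 3]}

theorem unimodularEquivalent_tripleSimplex {e f g : Fin 2 → ℤ} (hfg : cross f g = 1) :
    UnimodularEquivalent tripleSimplex (hull {e, e + (3 : ℤ) • f, e + (3 : ℤ) • g}) := by
  rw [unimodularEquivalent_iff]
  refine ⟨!![f 0, g 0; f 1, g 1], e, ?_, ?_⟩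
  · rw [Matrix.det_fin_two_of, show f 0 * g 1 - g 0 * f 1 = cross f g by simp only [cross]; ring,
      hfg]
    exact isUnit_one
  · rw [tripleSimplex, hull, hull, AffineMap.image_convexHull, Set.image_image]
    have e₀ : (!![f 0, g 0; f 1, g 1]).mulVec 0 + e = e := by simp
    have e₁ : (!![f 0, g 0; f 1, g 1]).mulVec ![3, 0] + e = e + (3 : ℤ) • f := by
      ext i; fin_cases i <;> simp <;> ring
    have e₂ : (!![f 0, g 0; f 1, g 1]).mulVec ![0, 3] + e = e + (3 : ℤ) • g := by
      ext i; fin_cases i <;> simp <;> ring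
    simp only [intAffine_latticePoint, Set.image_insert_eq, Set.image_singleton, e₀, e₁, e₂]

theorem IsLatticePolytope.equivalent_tripleSimplex {P : Set (Fin 2 → ℝ)} (hP : IsLatticePolytope P)
    {e f g : Fin 2 → ℤ} (hfg : cross f g = 1) (he : latticePoint e ∈ P)
    (hf : latticePoint (e + (3 : ℤ) • f) ∈ P) (hg : latticePoint (e + (3 : ℤ) • g) ∈ P)
    (hsub : ∀ z, latticePoint z ∈ P → 0 ≤ cross f (z - e) ∧ 0 ≤ cross (z - e) g ∧
      cross f (z - e) + cross (z - e) g ≤ 3) : UnimodularEquivalent tripleSimplex P := by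
  have hPe : P = hull {e, e + (3 : ℤ) • f, e + (3 : ℤ) • g} := by
    apply Set.Subset.antisymm
    · have hD : sideZ e (e + (3 : ℤ) • f) (e + (3 : ℤ) • g) = 9 := by
        rw [sideZ, add_sub_cancel_left, add_sub_cancel_left, cross_smul_left, cross_smul_right, hfg]
        norm_num
      conv_lhs => rw [hP.eq_hull]
      apply convexHull_min _ (convex_convexHull ℝ _)
      rintro _ ⟨z, hz, rfl⟩
      change latticePoint z ∈ hull _
      obtain ⟨h1, h2, h3⟩ := hsub z hz
      rw [hull_triangle (by omega)]
      simp only [Set.mem_inter_iff, Set.mem_ofPred_eq, side_latticePoint, Int.cast_nonneg_iff]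
      simp only [sideZ, cross, Pi.sub_apply, Pi.add_apply, Pi.smul_apply, smul_eq_mul] at *
      exact ⟨⟨by linarith, by linarith⟩, by linarith⟩
    · apply convexHull_min _ hP.convex
      rintro _ ⟨z, rfl | rfl | rfl, rfl⟩ <;> assumption
  rw [hPe]
  exact unimodularEquivalent_tripleSimplex hfg

section Scott

variable {P : Set (Fin 2 → ℝ)} {u v : Fin 2 → ℤ}

/-- A polygon contains the trapezoid spanned by its top and bottom rows. -/
theorem IsLatticePolytope.trapezoid_le (hP : IsLatticePolytope P) {l r l' r' : Fin 2 → ℤ}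
    (hl : latticePoint l ∈ P) (hr : latticePoint r ∈ P) (hl' : latticePoint l' ∈ P)
    (hr' : latticePoint r' ∈ P) (hlr : l 1 = r 1) (hlr' : l' 1 = r' 1) :
    (r 1 - l' 1) * ((r 0 - l 0) + (r' 0 - l' 0))
      ≤ 2 * latticeCount (interior P) + latticeCount (frontier P) - 2 := by
  refine le_trans (le_of_eq ?_) (hP.cross_le hl' hr hr' hl)
  simp only [cross, Pi.sub_apply, hlr, ← hlr']
  ring

/-- If the top and bottom rows of a polygon of height `p` are short, then a shear brings a top and
a bottom lattice point almost above each other: the horizontal differences of such pairs fill an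
interval of length `w`, whose translates by multiples of `p` leave gaps of length `p - w`. -/
theorem exists_shear (hP : Convex ℝ P) {l r l' r' : Fin 2 → ℤ}
    (hl : latticePoint l ∈ P) (hr : latticePoint r ∈ P) (hl' : latticePoint l' ∈ P)
    (hr' : latticePoint r' ∈ P) (hlr : l 1 = r 1) (hlr' : l' 1 = r' 1) (hq : l 0 ≤ r 0)
    (hq' : l' 0 ≤ r' 0) {p : ℤ} (hp : 0 < p) (hwp : (r 0 - l 0) + (r' 0 - l' 0) ≤ p) :
    ∃ (x x' : Fin 2 → ℤ) (k : ℤ), latticePoint x ∈ P ∧ latticePoint x' ∈ P ∧ x 1 = r 1 ∧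
      x' 1 = l' 1 ∧ 2 * |x 0 - x' 0 + k * p| ≤ p - ((r 0 - l 0) + (r' 0 - l' 0)) := by
  have hα := Int.emod_add_mul_ediv (r 0 - l' 0) p
  have he0 := Int.emod_nonneg (r 0 - l' 0) hp.ne'
  have he1 := Int.emod_lt_of_pos (r 0 - l' 0) hp
  set e := (r 0 - l' 0) % p with he
  set t := (r 0 - l' 0) / p with ht
  by_cases h1 : e ≤ (r 0 - l 0) + (r' 0 - l' 0)
  · refine ⟨![r 0 - min e (r 0 - l 0), r 1], ![l' 0 + (e - min e (r 0 - l 0)), l' 1], -t,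
      ?_, ?_, rfl, rfl, ?_⟩
    · refine mem_of_row hP hl hr ?_ ?_ ?_ ?_ <;> simp <;> omega
    · refine mem_of_row hP hl' hr' ?_ ?_ ?_ ?_ <;> simp <;> omega
    · have : (r 0 - min e (r 0 - l 0)) - (l' 0 + (e - min e (r 0 - l 0))) + -t * p = 0 := by
        linarith
      simp only [Matrix.cons_val_zero, this, abs_zero]
      linarith
  · by_cases h2 : 2 * (e - ((r 0 - l 0) + (r' 0 - l' 0))) ≤ p - ((r 0 - l 0) + (r' 0 - l' 0))
    · refine ⟨l, r', -t, hl, hr', hlr, hlr'.symm, ?_⟩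
      rw [abs_of_nonneg] <;> linarith
    · refine ⟨r, l', -t - 1, hr, hl', rfl, rfl, ?_⟩
      rw [abs_of_nonpos] <;> linarith

/-- The area of a polygon whose height is its lattice width `p`: it contains a quadrilateral with
an almost vertical diagonal, whose other diagonal has horizontal width at least `p`. -/
theorem IsTopBot.width_sq_le (h : IsTopBot P u v) (hP : IsLatticePolytope P)
    (hwidth : ∀ k : ℤ, ∃ y y' : Fin 2 → ℤ, latticePoint y ∈ P ∧ latticePoint y' ∈ P ∧
      u 1 - v 1 ≤ (y' 0 + k * y' 1) - (y 0 + k * y 1)) {l r l' r' : Fin 2 → ℤ}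
    (hl : latticePoint l ∈ P) (hr : latticePoint r ∈ P) (hl' : latticePoint l' ∈ P)
    (hr' : latticePoint r' ∈ P) (hl1 : l 1 = u 1) (hr1 : r 1 = u 1) (hl1' : l' 1 = v 1)
    (hr1' : r' 1 = v 1) (hq : l 0 ≤ r 0) (hq' : l' 0 ≤ r' 0) (huv : v 1 < u 1)
    (hwp : (r 0 - l 0) + (r' 0 - l' 0) ≤ u 1 - v 1) :
    (u 1 - v 1) * ((u 1 - v 1) + ((r 0 - l 0) + (r' 0 - l' 0)))
      ≤ 2 * (2 * latticeCount (interior P) + latticeCount (frontier P) - 2) := by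
  obtain ⟨x, x', k, hx, hx', hx1, hx1', hk⟩ := exists_shear hP.convex hl hr hl' hr'
    (hl1.trans hr1.symm) (hl1'.trans hr1'.symm) hq hq' (sub_pos.2 huv) hwp
  obtain ⟨y, y', hy, hy', hyy⟩ := hwidth k
  have hc := hP.cross_le hx hx' hy hy'
  set p := u 1 - v 1 with hp
  set δ := x 0 - x' 0 + k * p with hδ
  have hcr : cross (x' - x) (y' - y)
      = p * ((y' 0 + k * y' 1) - (y 0 + k * y 1)) - δ * (y' 1 - y 1) := by
    simp only [cross, Pi.sub_apply, hx1, hx1', hδ, hr1, hl1', hp]; ring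
  rw [hcr] at hc
  have hpp : 0 < p := sub_pos.2 huv
  have h1 := mul_le_mul_of_nonneg_left hyy hpp.le
  have hdy : |y' 1 - y 1| ≤ p := by
    rw [abs_le]
    have a1 := h.le_top y hy
    have a2 := h.le_top y' hy'
    have a3 := h.bot_le y hy
    have a4 := h.bot_le y' hy'
    constructor <;> omega
  have h2 : δ * (y' 1 - y 1) ≤ |δ| * p :=
    (le_abs_self _).trans (by rw [abs_mul]; exact mul_le_mul_of_nonneg_left hdy (abs_nonneg _))
  have h3 := mul_le_mul_of_nonneg_right hk hpp.le
  nlinarith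

/-- The ends `x`, `y` of an inner row, when they are on the boundary, bound the whole row. -/
theorem IsTopBot.between_of_frontier (h : IsTopBot P u v) (hP : IsLatticePolytope P)
    {x y : Fin 2 → ℤ} (hx : latticePoint x ∈ frontier P) (hy : latticePoint y ∈ frontier P)
    (hxy : x 1 = y 1) (hlt : x 0 < y 0) (hv : v 1 < x 1) (hu : x 1 < u 1) {z : Fin 2 → ℝ}
    (hz : z ∈ P) (hz1 : z 1 = x 1) : (x 0 : ℝ) ≤ z 0 ∧ z 0 ≤ y 0 := by
  have hfr : frontier P = P \ interior P := hP.isCompact.isClosed.frontier_eq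
  rw [hfr] at hx hy
  have hxy' : ((y 1 : ℤ) : ℝ) = x 1 := by rw [hxy]
  constructor
  · by_contra! hcon
    refine hx.2 (h.mem_interior hP hz hy.1 hz1 ?_ hcon ?_ ?_ ?_) <;> simp only [latticePoint]
    · exact hxy'.symm
    all_goals exact_mod_cast (by assumption)
  · by_contra! hcon
    refine hy.2 (h.mem_interior hP hx.1 hz ?_ ?_ ?_ hcon ?_ ?_) <;> simp only [latticePoint]
    · exact hxy'.symm
    · exact hxy'.trans hz1.symm
    · exact_mod_cast hlt
    · rw [hxy']; exact_mod_cast hv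
    · rw [hxy']; exact_mod_cast hu

theorem exists_lt_of_ncard_row {F : Set (Fin 2 → ℤ)} {j : ℤ} (hF : F.ncard = 2)
    (hrow : ∀ z ∈ F, z 1 = j) : ∃ x ∈ F, ∃ y ∈ F, x 0 < y 0 := by
  obtain ⟨x, y, hxy, rfl⟩ := Set.ncard_eq_two.1 hF
  have hne : x 0 ≠ y 0 := by
    intro h
    apply hxy
    ext i; fin_cases i
    · exact h
    · simp [hrow x (by simp), hrow y (by simp)]
  rcases lt_or_gt_of_ne hne with h | h
  · exact ⟨x, by simp, y, by simp, h⟩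
  · exact ⟨y, by simp, x, by simp, h⟩

theorem convex_combo_third (hP : Convex ℝ P) {x y : Fin 2 → ℤ} (hx : latticePoint x ∈ P)
    (hy : latticePoint y ∈ P) : (fun i => (2 * (x i : ℝ) + y i) / 3) ∈ P := by
  have := hP hx hy (show (0 : ℝ) ≤ 2 / 3 by norm_num) (show (0 : ℝ) ≤ 1 / 3 by norm_num)
    (by norm_num)
  convert this using 1
  ext i
  simp [latticePoint]
  ring

/-- A polygon of height three, with one interior and nine boundary lattice points, and with three
lattice units in its top and bottom rows together. Its inner rows are at least as long as convexity
requires, and at most as long as the number of interior lattice points permits; both bounds agree,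
so the polygon is a triangle. -/
theorem IsTopBot.equivalent_tripleSimplex (h : IsTopBot P u v) (hP : IsLatticePolytope P)
    (huv : u 1 = v 1 + 3) {l r l' r' : Fin 2 → ℤ}
    (hl : latticePoint l ∈ P) (hr : latticePoint r ∈ P) (hl' : latticePoint l' ∈ P)
    (hr' : latticePoint r' ∈ P) (hl1 : l 1 = u 1) (hr1 : r 1 = u 1) (hl1' : l' 1 = v 1)
    (hr1' : r' 1 = v 1)
    (htop : ∀ z, latticePoint z ∈ P → z 1 = u 1 → l 0 ≤ z 0 ∧ z 0 ≤ r 0)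
    (hbot : ∀ z, latticePoint z ∈ P → z 1 = v 1 → l' 0 ≤ z 0 ∧ z 0 ≤ r' 0)
    (hw : (r 0 - l 0) + (r' 0 - l' 0) = 3) (hi : latticeCount (interior P) = 1)
    (hb : latticeCount (frontier P) = 9) : UnimodularEquivalent tripleSimplex P := by
  have hfr : frontier P ⊆ P := hP.isCompact.isClosed.frontier_subset
  have hsum := h.latticeCount_frontier_le hP (by omega) hl hl1 hl' hl1' htop hbot
  have hIoo : Finset.Ioo (v 1) (u 1) = {v 1 + 1, v 1 + 2} := by
    ext j
    simp only [Finset.mem_Ioo, Finset.mem_insert, Finset.mem_singleton]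
    omega
  rw [hIoo, Finset.sum_pair (by omega), hb] at hsum
  have hF₁ := h.ncard_frontier_row_le hP (j := v 1 + 1) (by omega) (by omega)
  have hF₂ := h.ncard_frontier_row_le hP (j := v 1 + 2) (by omega) (by omega)
  obtain ⟨a, ⟨ha, ha1⟩, b, ⟨hbf, hb1⟩, hab⟩ := exists_lt_of_ncard_row (j := v 1 + 1)
    (F := {z | latticePoint z ∈ frontier P ∧ z 1 = v 1 + 1}) (by omega) fun z hz => hz.2
  obtain ⟨c, ⟨hc, hc1⟩, d, ⟨hd, hd1⟩, hcd⟩ := exists_lt_of_ncard_row (j := v 1 + 2)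
    (F := {z | latticePoint z ∈ frontier P ∧ z 1 = v 1 + 2}) (by omega) fun z hz => hz.2
  -- there is only one interior lattice point, so the inner rows are short
  obtain ⟨w, hw'⟩ := Set.ncard_eq_one.1 hi
  have hI₁ : ∀ t, 0 < t → t < b 0 - a 0 → ![a 0 + t, v 1 + 1] = w := by
    intro t h0 h1
    have : ![a 0 + t, v 1 + 1] ∈ {z | latticePoint z ∈ interior P} := by
      apply h.mem_interior_lattice hP (hfr ha) (hfr hbf) <;> simp <;> omega
    rw [hw'] at this
    exact this
  have hI₂ : ∀ t, 0 < t → t < d 0 - c 0 → ![c 0 + t, v 1 + 2] = w := by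
    intro t h0 h1
    have : ![c 0 + t, v 1 + 2] ∈ {z | latticePoint z ∈ interior P} := by
      apply h.mem_interior_lattice hP (hfr hc) (hfr hd) <;> simp <;> omega
    rw [hw'] at this
    exact this
  have hshort : (b 0 - a 0) + (d 0 - c 0) ≤ 3 := by
    by_contra! hcon
    by_cases h1 : 3 ≤ b 0 - a 0
    · have := congrFun ((hI₁ 1 (by omega) (by omega)).trans (hI₁ 2 (by omega) (by omega)).symm) 0
      simp at this
    by_cases h2 : 3 ≤ d 0 - c 0
    · have := congrFun ((hI₂ 1 (by omega) (by omega)).trans (hI₂ 2 (by omega) (by omega)).symm) 0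
      simp at this
    have := congrFun ((hI₁ 1 (by omega) (by omega)).trans (hI₂ 1 (by omega) (by omega)).symm) 1
    simp at this
  -- by convexity the inner rows are long
  have huv' : (u 1 : ℝ) = v 1 + 3 := by exact_mod_cast huv
  have ha1' : (a 1 : ℝ) = v 1 + 1 := by exact_mod_cast ha1
  have hc1' : (c 1 : ℝ) = v 1 + 2 := by exact_mod_cast hc1
  have between₁ := fun {z : Fin 2 → ℝ} => h.between_of_frontier hP ha hbf (ha1.trans hb1.symm) hab
    (by omega) (by omega) (z := z)
  have between₂ := fun {z : Fin 2 → ℝ} => h.between_of_frontier hP hc hd (hc1.trans hd1.symm) hcd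
    (by omega) (by omega) (z := z)
  have k1 : 3 * a 0 ≤ 2 * l' 0 + l 0 := by
    have := (between₁ (convex_combo_third hP.convex hl' hl)
      (by simp only [hl1, hl1', ha1', huv']; ring)).1
    have : (3 * a 0 : ℝ) ≤ 2 * l' 0 + l 0 := by linarith
    exact_mod_cast this
  have k2 : 2 * r' 0 + r 0 ≤ 3 * b 0 := by
    have := (between₁ (convex_combo_third hP.convex hr' hr)
      (by simp only [hr1, hr1', ha1', huv']; ring)).2
    have : (2 * r' 0 + r 0 : ℝ) ≤ 3 * b 0 := by linarith
    exact_mod_cast this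
  have k3 : 3 * c 0 ≤ 2 * l 0 + l' 0 := by
    have := (between₂ (convex_combo_third hP.convex hl hl')
      (by simp only [hl1, hl1', hc1', huv']; ring)).1
    have : (3 * c 0 : ℝ) ≤ 2 * l 0 + l' 0 := by linarith
    exact_mod_cast this
  have k4 : 2 * r 0 + r' 0 ≤ 3 * d 0 := by
    have := (between₂ (convex_combo_third hP.convex hr hr')
      (by simp only [hr1, hr1', hc1', huv']; ring)).2
    have : (2 * r 0 + r' 0 : ℝ) ≤ 3 * d 0 := by linarith
    exact_mod_cast this
  have hlr : l 0 ≤ r 0 := (htop l hl hl1).2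
  have hlr' : l' 0 ≤ r' 0 := (hbot l' hl' hl1').2
  have hrow₁ : ∀ z, latticePoint z ∈ P → z 1 = v 1 + 1 → a 0 ≤ z 0 ∧ z 0 ≤ b 0 := by
    intro z hz hz1
    have := between₁ hz (by simp only [latticePoint]; rw [ha1', hz1]; push_cast; ring)
    simp only [latticePoint] at this
    exact ⟨by exact_mod_cast this.1, by exact_mod_cast this.2⟩
  have hrow₂ : ∀ z, latticePoint z ∈ P → z 1 = v 1 + 2 → c 0 ≤ z 0 ∧ z 0 ≤ d 0 := by
    intro z hz hz1
    have := between₂ hz (by simp only [latticePoint]; rw [hc1', hz1]; push_cast; ring)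
    simp only [latticePoint] at this
    exact ⟨by exact_mod_cast this.1, by exact_mod_cast this.2⟩
  have hrows : ∀ z, latticePoint z ∈ P →
      (z 1 = v 1 ∧ l' 0 ≤ z 0 ∧ z 0 ≤ r' 0) ∨ (z 1 = v 1 + 1 ∧ a 0 ≤ z 0 ∧ z 0 ≤ b 0) ∨
      (z 1 = v 1 + 2 ∧ c 0 ≤ z 0 ∧ z 0 ≤ d 0) ∨ (z 1 = v 1 + 3 ∧ l 0 ≤ z 0 ∧ z 0 ≤ r 0) := by
    intro z hz
    have e1 := h.bot_le z hz
    have e2 := h.le_top z hz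
    have : z 1 = v 1 ∨ z 1 = v 1 + 1 ∨ z 1 = v 1 + 2 ∨ z 1 = v 1 + 3 := by omega
    rcases this with h | h | h | h
    · exact Or.inl ⟨h, hbot z hz h⟩
    · exact Or.inr (Or.inl ⟨h, hrow₁ z hz h⟩)
    · exact Or.inr (Or.inr (Or.inl ⟨h, hrow₂ z hz h⟩))
    · exact Or.inr (Or.inr (Or.inr ⟨h, htop z hz (h.trans huv.symm)⟩))
  rcases (show r' 0 - l' 0 = 3 ∨ r' 0 - l' 0 = 0 by omega) with hq | hq
  · -- the bottom row is an edge of length three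
    obtain ⟨m, hm⟩ : ∃ m, l 0 = l' 0 + 3 * m := ⟨a 0 - l' 0, by omega⟩
    have ef : l' + (3 : ℤ) • ![1, 0] = r' := by
      ext i; fin_cases i
      · simp; omega
      · simp; omega
    have eg : l' + (3 : ℤ) • ![m, 1] = l := by
      ext i; fin_cases i
      · simp; omega
      · simp; omega
    refine hP.equivalent_tripleSimplex (e := l') (f := ![1, 0]) (g := ![m, 1])
      (by simp [cross]) hl' (ef ▸ hr') (eg ▸ hl) fun z hz => ?_
    simp only [cross, Pi.sub_apply, Matrix.cons_val_zero, Matrix.cons_val_one, hl1']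
    rcases hrows z hz with h | h | h | h <;> rw [h.1] <;>
      exact ⟨by linarith, by linarith, by linarith⟩
  · -- the top row is an edge of length three
    obtain ⟨m, hm⟩ : ∃ m, l' 0 = r 0 + 3 * m := ⟨d 0 - r 0, by omega⟩
    have ef : r + (3 : ℤ) • ![-1, 0] = l := by
      ext i; fin_cases i
      · simp; omega
      · simp; omega
    have eg : r + (3 : ℤ) • ![m, -1] = l' := by
      ext i; fin_cases i
      · simp; omega
      · simp; omega
    refine hP.equivalent_tripleSimplex (e := r) (f := ![-1, 0]) (g := ![m, -1])
      (by simp [cross]) hr (ef ▸ hl) (eg ▸ hl') fun z hz => ?_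
    simp only [cross, Pi.sub_apply, Matrix.cons_val_zero, Matrix.cons_val_one, hr1, huv]
    rcases hrows z hz with h | h | h | h <;> rw [h.1] <;>
      exact ⟨by linarith, by linarith, by linarith⟩

end Scott

/-- **Scott's inequality** with its case of equality: a lattice polygon with `i ≥ 1` interior and
`b` boundary lattice points has `b ≤ 2 i + 6`, unless it is equivalent to the triangle
`conv {(0, 0), (3, 0), (0, 3)}`, for which `i = 1` and `b = 9`. -/
theorem IsLatticePolytope.scott {P : Set (Fin 2 → ℝ)} (hP : IsLatticePolytope P)
    (hi : 1 ≤ latticeCount (interior P)) :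
    latticeCount (frontier P) ≤ 2 * latticeCount (interior P) + 6 ∨
      (latticeCount (interior P) = 1 ∧ latticeCount (frontier P) = 9 ∧
        UnimodularEquivalent tripleSimplex P) := by
  obtain ⟨Q, u, v, hPQ, h, hwidth⟩ := hP.exists_minimal_height
  have hQ := hPQ.isLatticePolytope hP
  rw [← hPQ.latticeCount_interior, ← hPQ.latticeCount_frontier] at *
  obtain ⟨l, r, hl, hr, hl1, hr1, htop⟩ := hQ.exists_row_ends h.top_mem
  obtain ⟨l', r', hl', hr', hl1', hr1', hbot⟩ := hQ.exists_row_ends h.bot_mem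
  have hq : l 0 ≤ r 0 := (htop l hl hl1).2
  have hq' : l' 0 ≤ r' 0 := (hbot l' hl' hl1').2
  -- an interior lattice point makes the height at least two
  have hp2 : v 1 + 2 ≤ u 1 := by
    have hne : {z | latticePoint z ∈ interior Q}.Nonempty := by
      rw [Set.nonempty_iff_ne_empty]
      intro h0
      rw [latticeCount, h0, Set.ncard_empty] at hi
      omega
    obtain ⟨z, hz⟩ := hne
    have hz' := h.interior_row hQ hz
    simp only [latticePoint] at hz'
    have h1 : v 1 < z 1 := by exact_mod_cast hz'.1
    have h2 : z 1 < u 1 := by exact_mod_cast hz'.2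
    omega
  have hbd := h.latticeCount_frontier_le hQ (by omega) hl hl1 hl' hl1' htop hbot
  have hrows : ∑ j ∈ Finset.Ioo (v 1) (u 1),
      ({z | latticePoint z ∈ frontier Q ∧ z 1 = j}.ncard : ℤ) ≤ 2 * (u 1 - v 1 - 1) := by
    refine (Finset.sum_le_card_nsmul _ _ 2 fun j hj => ?_).trans (le_of_eq ?_)
    · rw [Finset.mem_Ioo] at hj
      exact_mod_cast h.ncard_frontier_row_le hQ hj.1 hj.2
    · rw [Int.card_Ioo, nsmul_eq_mul, Int.toNat_of_nonneg (by omega)]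
      ring
  have htrap := hQ.trapezoid_le hl hr hl' hr' (hl1.trans hr1.symm) (hl1'.trans hr1'.symm)
  rw [hr1, hl1'] at htrap
  have hsq := h.width_sq_le hQ hwidth hl hr hl' hr' hl1 hr1 hl1' hr1' hq hq' (by omega)
  obtain ⟨p, hp⟩ : ∃ p, u 1 - v 1 = p := ⟨_, rfl⟩
  obtain ⟨w, hw⟩ : ∃ w, (r 0 - l 0) + (r' 0 - l' 0) = w := ⟨_, rfl⟩
  rw [hp, hw] at htrap hsq
  have hw0 : 0 ≤ w := by omega
  have hbw : (latticeCount (frontier Q) : ℤ) ≤ w + 2 * p := by omega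
  by_cases hexc : p = 3 ∧ w = 3 ∧ latticeCount (interior Q) = 1 ∧ latticeCount (frontier Q) = 9
  · obtain ⟨h1, h2, h3, h4⟩ := hexc
    refine Or.inr ⟨h3, h4, ?_⟩
    exact (h.equivalent_tripleSimplex hQ (by omega) hl hr hl' hr' hl1 hr1 hl1' hr1' htop hbot
      (by omega) h3 h4).trans hPQ.symm
  · left
    zify at hi hexc ⊢
    have hp2 : 2 ≤ p := by omega
    generalize (latticeCount (interior Q) : ℤ) = i at *
    generalize (latticeCount (frontier Q) : ℤ) = b at *
    -- `hbw` and `htrap` say `b ≤ w + 2 p` and `p w ≤ 2 i + b - 2`, which settles `4 ≤ w`; for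
    -- `w ≤ 3` and `4 ≤ p`, the bound `p (p + w) ≤ 2 (2 i + b - 2)` replaces the latter
    by_cases hw4 : 4 ≤ w
    · nlinarith [mul_nonneg (sub_nonneg.2 hw4) (sub_nonneg.2 hp2)]
    by_cases hp4 : 4 ≤ p
    · have := hsq (by omega)
      nlinarith [mul_nonneg hw0 (sub_nonneg.2 hp4), sq_nonneg (p - 4)]
    have : p = 2 ∨ p = 3 := by omega
    rcases this with rfl | rfl
    · omega
    · omega

/-! ### Examples of lattice polygons -/

theorem isLatticePolytope_hull {S : Set (Fin 2 → ℤ)} (hS : S.Finite) {a b c : Fin 2 → ℤ}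
    (ha : a ∈ S) (hb : b ∈ S) (hc : c ∈ S) (hD : 0 < sideZ a b c) : IsLatticePolytope (hull S) :=
  ⟨⟨hS.toFinset, by rw [hS.coe_toFinset]; rfl⟩,
    (convex_convexHull ℝ _).interior_nonempty_iff_affineSpan_eq_top.1
      (interior_hull_nonempty ha hb hc hD)⟩

/-- By Pick's formula, the interior lattice points of a triangle determine the number of those on
its boundary. -/
theorem latticeCount_frontier_triangle {a b c : Fin 2 → ℤ} (hD : 0 < sideZ a b c) :
    (latticeCount (frontier (hull {a, b, c})) : ℤ)
      = sideZ a b c + 2 - 2 * latticeCount (interior (hull {a, b, c})) := by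
  have h1 := hasPick_triangle hD 1 le_rfl
  have h2 := (isLatticePolytope_hull (S := {a, b, c}) (by simp) (by simp) (by simp) (by simp)
    hD).latticeCount_eq
  rw [Nat.cast_one, one_smul] at h1
  push_cast at h1
  zify at h2
  linarith

theorem exists_thin_triangle {l : ℕ} (hl : 1 ≤ l) : ∃ P : Set (Fin 2 → ℝ), IsLatticePolytope P ∧
    latticeCount (interior P) = 0 ∧ latticeCount (frontier P) = l + 2 := by
  have hsZ : sideZ 0 ![(l : ℤ), 0] ![0, 1] = l := by simp [sideZ, cross]
  have hD : 0 < sideZ 0 ![(l : ℤ), 0] ![0, 1] := by rw [hsZ]; exact_mod_cast hl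
  have hI : latticeCount (interior (hull {0, ![(l : ℤ), 0], ![0, 1]})) = 0 := by
    rw [latticeCount_interior_hull_triangle hD]
    have : {z : Fin 2 → ℤ | 0 < cross z (![0, 1] - 0) ∧ 0 < cross (![(l : ℤ), 0] - 0) z ∧
        cross z (![0, 1] - 0) + cross (![(l : ℤ), 0] - 0) z
          < cross (![(l : ℤ), 0] - 0) (![0, 1] - 0)} = ∅ := by
      ext z
      simp only [cross, sub_zero, Matrix.cons_val_zero, Matrix.cons_val_one, Set.mem_ofPred_eq,
        Set.mem_empty_iff_false, iff_false]
      rintro ⟨h1, h2, h3⟩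
      have hl' : (0 : ℤ) < l := by exact_mod_cast hl
      have : 0 < z 1 := by nlinarith
      nlinarith
    rw [this, Set.ncard_empty]
  have hF := latticeCount_frontier_triangle hD
  rw [hI, hsZ] at hF
  exact ⟨_, isLatticePolytope_hull (by simp) (by simp) (by simp) (by simp) hD, hI, by omega⟩

theorem isLatticePolytope_tripleSimplex : IsLatticePolytope tripleSimplex :=
  isLatticePolytope_hull (a := 0) (b := ![3, 0]) (c := ![0, 3]) (by simp) (by simp) (by simp)
    (by simp) (by simp [sideZ, cross])

theorem latticeCount_interior_tripleSimplex : latticeCount (interior tripleSimplex) = 1 := by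
  rw [tripleSimplex, latticeCount_interior_hull_triangle (by simp [sideZ, cross])]
  rw [Set.ncard_eq_one]
  refine ⟨![1, 1], ?_⟩
  ext z
  simp only [cross, sub_zero, Matrix.cons_val_zero, Matrix.cons_val_one, Set.mem_ofPred_eq,
        Set.mem_singleton_iff]
  constructor
  · rintro ⟨h1, h2, h3⟩
    ext i
    fin_cases i
    · simp; omega
    · simp; omega
  · rintro rfl
    simp

theorem latticeCount_frontier_tripleSimplex : latticeCount (frontier tripleSimplex) = 9 := by
  have h := latticeCount_frontier_triangle (a := 0) (b := ![3, 0]) (c := ![0, 3])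
    (by simp [sideZ, cross])
  rw [← tripleSimplex, latticeCount_interior_tripleSimplex,
    show sideZ 0 ![3, 0] ![0, 3] = 9 by simp [sideZ, cross]] at h
  omega

theorem ncard_row {j a b : ℤ} :
    {z : Fin 2 → ℤ | z 1 = j ∧ a ≤ z 0 ∧ z 0 ≤ b}.ncard = (b + 1 - a).toNat := by
  have hinj : Function.Injective (fun t : ℤ => ![t, j]) := fun t t' h => by
    simpa using congrFun h 0
  have : {z : Fin 2 → ℤ | z 1 = j ∧ a ≤ z 0 ∧ z 0 ≤ b}
      = (fun t : ℤ => ![t, j]) '' (Finset.Icc a b : Finset ℤ) := by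
    ext z
    simp only [Set.mem_ofPred_eq, Set.mem_image, Finset.coe_Icc, Set.mem_Icc]
    constructor
    · rintro ⟨h1, h2⟩
      refine ⟨z 0, h2, ?_⟩
      ext i; fin_cases i <;> simp [h1]
    · rintro ⟨t, ht, rfl⟩
      simpa using ht
  rw [this, Set.ncard_image_of_injective _ hinj, Set.ncard_coe_finset, Int.card_Icc]

theorem finite_row {j a b : ℤ} : {z : Fin 2 → ℤ | z 1 = j ∧ a ≤ z 0 ∧ z 0 ≤ b}.Finite := by
  refine ((Set.finite_Icc a b).image (fun t : ℤ => ![t, j])).subset ?_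
  rintro z ⟨h1, h2⟩
  refine ⟨z 0, h2, ?_⟩
  ext i; fin_cases i <;> simp [h1]

section Quadrilateral

variable {a m : ℕ}

theorem hull_quadrilateral (ha : 1 ≤ a) (ham : a ≤ 2 * m) :
    hull {0, ![(a : ℤ), 0], ![(m : ℤ), 1], ![0, 2]}
      = {p | 0 ≤ side (latticePoint 0) (latticePoint ![(a : ℤ), 0]) p}
        ∩ {p | 0 ≤ side (latticePoint ![(a : ℤ), 0]) (latticePoint ![(m : ℤ), 1]) p}
        ∩ {p | 0 ≤ side (latticePoint ![(m : ℤ), 1]) (latticePoint ![0, 2]) p}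
        ∩ {p | 0 ≤ side (latticePoint ![0, 2]) (latticePoint 0) p} := by
  have ha' : (1 : ℤ) ≤ a := by exact_mod_cast ha
  have ham' : (a : ℤ) ≤ 2 * m := by exact_mod_cast ham
  apply Set.Subset.antisymm
  · apply convexHull_min
    · rintro _ ⟨z, hz, rfl⟩
      simp only [Set.mem_inter_iff, Set.mem_ofPred_eq, side_latticePoint, Int.cast_nonneg_iff]
      rcases hz with rfl | rfl | rfl | rfl <;> simp [sideZ, cross] <;> omega
    · exact (((convex_side_nonneg _ _).inter (convex_side_nonneg _ _)).inter
        (convex_side_nonneg _ _)).inter (convex_side_nonneg _ _)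
  · rintro p ⟨⟨⟨h1, h2⟩, h3⟩, h4⟩
    simp only [Set.mem_ofPred_eq] at h1 h2 h3 h4
    -- the diagonal from `(0, 0)` to `(m, 1)` cuts the quadrilateral into two triangles
    rcases le_total 0 (side (latticePoint 0) (latticePoint ![(m : ℤ), 1]) p) with h | h
    · have hsub : hull {0, ![(m : ℤ), 1], ![0, 2]} ⊆
          hull {0, ![(a : ℤ), 0], ![(m : ℤ), 1], ![0, 2]} := by
        apply convexHull_mono (Set.image_mono _)
        rintro z (rfl | rfl | rfl) <;> simp
      apply hsub
      rw [hull_triangle (by simp [sideZ, cross]; omega)]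
      exact ⟨⟨h, h3⟩, h4⟩
    · have hsub : hull {0, ![(a : ℤ), 0], ![(m : ℤ), 1]} ⊆
          hull {0, ![(a : ℤ), 0], ![(m : ℤ), 1], ![0, 2]} := by
        apply convexHull_mono (Set.image_mono _)
        rintro z (rfl | rfl | rfl) <;> simp
      apply hsub
      rw [hull_triangle (by simp [sideZ, cross]; omega)]
      refine ⟨⟨h1, h2⟩, ?_⟩
      rw [Set.mem_ofPred_eq, side_swap]
      linarith

/-- The quadrilateral with the vertices `(0, 0)`, `(a, 0)`, `(m, 1)`, `(0, 2)`. -/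
theorem exists_quadrilateral (ha : 1 ≤ a) (ham : a ≤ 2 * m) :
    ∃ P : Set (Fin 2 → ℝ), IsLatticePolytope P ∧ latticeCount (interior P) + 1 = m ∧
      latticeCount (frontier P) = a + 4 := by
  have ha' : (1 : ℤ) ≤ a := by exact_mod_cast ha
  have ham' : (a : ℤ) ≤ 2 * m := by exact_mod_cast ham
  set P := hull {0, ![(a : ℤ), 0], ![(m : ℤ), 1], ![0, 2]} with hPdef
  have hP : IsLatticePolytope P :=
    isLatticePolytope_hull (a := 0) (b := ![(a : ℤ), 0]) (c := ![(m : ℤ), 1]) (by simp) (by simp)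
      (by simp) (by simp) (by simp [sideZ, cross]; omega)
  have hI : latticeCount (interior P) + 1 = m := by
    have hset : {z | latticePoint z ∈ interior P} = {z | z 1 = 1 ∧ 1 ≤ z 0 ∧ z 0 ≤ (m : ℤ) - 1} := by
      ext z
      rw [hPdef, hull_quadrilateral ha ham, interior_inter, interior_inter, interior_inter,
        interior_side_nonneg, interior_side_nonneg, interior_side_nonneg, interior_side_nonneg]
      · simp only [Set.mem_inter_iff, Set.mem_ofPred_eq, side_latticePoint, Int.cast_pos]
        simp only [sideZ, cross, Pi.sub_apply, Matrix.cons_val_zero, Matrix.cons_val_one,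
          Pi.zero_apply]
        constructor
        · rintro ⟨⟨⟨h1, h2⟩, h3⟩, h4⟩
          have hz1 : 0 < z 1 := by nlinarith
          have hz2 : z 1 < 2 := by nlinarith
          have : z 1 = 1 := by omega
          rw [this] at h2 h3
          exact ⟨this, by linarith, by linarith⟩
        · rintro ⟨h1, h2, h3⟩
          rw [h1]
          exact ⟨⟨⟨by linarith, by linarith⟩, by linarith⟩, by linarith⟩
      · exact latticePoint_injective.ne fun h => by simpa using congrFun h 1
      · exact latticePoint_injective.ne fun h => by simpa using congrFun h 1
      · exact latticePoint_injective.ne fun h => by simpa using congrFun h 1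
      · exact latticePoint_injective.ne fun h => by
          have : (0 : ℤ) = a := by simpa using congrFun h 0
          omega
    rw [latticeCount, hset, ncard_row]
    omega
  have hG : latticeCount P = a + m + 3 := by
    have hset : {z | latticePoint z ∈ P} = ({z | z 1 = 0 ∧ 0 ≤ z 0 ∧ z 0 ≤ (a : ℤ)}
        ∪ {z | z 1 = 1 ∧ 0 ≤ z 0 ∧ z 0 ≤ (m : ℤ)}) ∪ {z | z 1 = 2 ∧ 0 ≤ z 0 ∧ z 0 ≤ 0} := by
      ext z
      rw [hPdef, hull_quadrilateral ha ham]
      simp only [Set.mem_inter_iff, Set.mem_union, Set.mem_ofPred_eq, side_latticePoint,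
        Int.cast_nonneg_iff]
      simp only [sideZ, cross, Pi.sub_apply, Matrix.cons_val_zero, Matrix.cons_val_one,
          Pi.zero_apply]
      constructor
      · rintro ⟨⟨⟨h1, h2⟩, h3⟩, h4⟩
        have hz1 : 0 ≤ z 1 := by nlinarith
        have hz2 : z 1 < 3 := by nlinarith
        have : z 1 = 0 ∨ z 1 = 1 ∨ z 1 = 2 := by omega
        rcases this with h | h | h <;> rw [h] at h2 h3
        · exact Or.inl (Or.inl ⟨h, by linarith, by linarith⟩)
        · exact Or.inl (Or.inr ⟨h, by linarith, by linarith⟩)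
        · exact Or.inr ⟨h, by linarith, by linarith⟩
      · rintro ((⟨h, h1, h2⟩ | ⟨h, h1, h2⟩) | ⟨h, h1, h2⟩) <;> rw [h] <;>
          exact ⟨⟨⟨by linarith, by linarith⟩, by linarith⟩, by linarith⟩
    rw [latticeCount, hset, Set.ncard_union_eq _ (finite_row.union finite_row) finite_row,
      Set.ncard_union_eq _ finite_row finite_row, ncard_row, ncard_row, ncard_row]
    · omega
    · rw [Set.disjoint_left]
      rintro z ⟨h, -⟩ ⟨h', -⟩
      omega
    · rw [Set.disjoint_left]
      rintro z (⟨h, -⟩ | ⟨h, -⟩) ⟨h', -⟩ <;> omega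
  have := hP.latticeCount_eq
  exact ⟨P, hP, hI, by omega⟩

end Quadrilateral

/-! ### The roots of the Ehrhart polynomial -/

section Roots

variable {P : Set (Fin 2 → ℝ)}

/-- The real and the imaginary part of the equation `A s² + (b / 2) s + 1 = 0`. -/
theorem IsLatticePolytope.mem_ehrhartRoots_iff_re_im (hP : IsLatticePolytope P) {s : ℂ} :
    s ∈ ehrhartRoots P ↔
      ((latticeCount (interior P) : ℝ) + latticeCount (frontier P) / 2 - 1) * (s.re ^ 2 - s.im ^ 2)
          + latticeCount (frontier P) / 2 * s.re + 1 = 0 ∧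
        s.im * (2 * ((latticeCount (interior P) : ℝ) + latticeCount (frontier P) / 2 - 1) * s.re
          + latticeCount (frontier P) / 2) = 0 := by
  have h : ((latticeCount (interior P) : ℂ) + latticeCount (frontier P) / 2 - 1) * s ^ 2
        + latticeCount (frontier P) / 2 * s + 1
      = ⟨((latticeCount (interior P) : ℝ) + latticeCount (frontier P) / 2 - 1)
            * (s.re ^ 2 - s.im ^ 2) + latticeCount (frontier P) / 2 * s.re + 1,
          s.im * (2 * ((latticeCount (interior P) : ℝ) + latticeCount (frontier P) / 2 - 1) * s.re
            + latticeCount (frontier P) / 2)⟩ := by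
    have e1 : ((latticeCount (interior P) : ℂ) + latticeCount (frontier P) / 2 - 1)
        = (((latticeCount (interior P) : ℝ) + latticeCount (frontier P) / 2 - 1 : ℝ) : ℂ) := by
      push_cast; rfl
    have e2 : ((latticeCount (frontier P) : ℂ) / 2)
        = (((latticeCount (frontier P) : ℝ) / 2 : ℝ) : ℂ) := by
      push_cast; rfl
    rw [e1, e2]
    generalize (latticeCount (interior P) : ℝ) + latticeCount (frontier P) / 2 - 1 = a
    generalize (latticeCount (frontier P) : ℝ) / 2 = c
    apply Complex.ext
    · simp only [sq, Complex.add_re, Complex.mul_re, Complex.mul_im, Complex.one_re,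
        Complex.ofReal_re, Complex.ofReal_im]
      ring
    · simp only [sq, Complex.add_im, Complex.mul_im, Complex.mul_re, Complex.one_im,
        Complex.ofReal_re, Complex.ofReal_im]
      ring
  rw [hP.mem_ehrhartRoots_iff, h, Complex.ext_iff]
  rfl

/-- Vieta's formulas for a pair of conjugate roots. -/
theorem IsLatticePolytope.norm_root_sq (hP : IsLatticePolytope P) {s : ℂ}
    (hs : s ∈ ehrhartRoots P) (him : s.im ≠ 0) :
    2 * ((latticeCount (interior P) : ℝ) + latticeCount (frontier P) / 2 - 1) * s.re
        = -(latticeCount (frontier P) / 2) ∧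
      ((latticeCount (interior P) : ℝ) + latticeCount (frontier P) / 2 - 1)
        * (s.re ^ 2 + s.im ^ 2) = 1 := by
  obtain ⟨h1, h2⟩ := hP.mem_ehrhartRoots_iff_re_im.1 hs
  have h3 := (mul_eq_zero.1 h2).resolve_left him
  constructor
  · linarith
  · linear_combination s.re * h3 - h1

theorem IsLatticePolytope.three_le_real (hP : IsLatticePolytope P) :
    (3 : ℝ) ≤ latticeCount (frontier P) := by
  exact_mod_cast hP.three_le_latticeCount_frontier

theorem IsLatticePolytope.leading_pos (hP : IsLatticePolytope P) :
    0 < (latticeCount (interior P) : ℝ) + latticeCount (frontier P) / 2 - 1 := by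
  have h1 := hP.three_le_real
  have h2 : (0 : ℝ) ≤ latticeCount (interior P) := Nat.cast_nonneg _
  linarith

theorem norm_eq_of_sq {s : ℂ} {r t : ℝ} (ht : 0 ≤ t) (h : (s.re + r) ^ 2 + s.im ^ 2 = t ^ 2) :
    ‖s + (r : ℂ)‖ = t := by
  rw [← sq_eq_sq₀ (norm_nonneg _) ht, Complex.sq_norm, Complex.normSq_apply, ← h]
  simp
  ring

theorem IsLatticePolytope.norm_root_add (hP : IsLatticePolytope P) {s : ℂ}
    (hs : s ∈ ehrhartRoots P) (him : s.im ≠ 0) :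
    ‖s + ((2 / latticeCount (frontier P) : ℝ) : ℂ)‖ = 2 / (latticeCount (frontier P) : ℝ) := by
  have hb := hP.three_le_real
  have hA := hP.leading_pos
  obtain ⟨h1, h2⟩ := hP.norm_root_sq hs him
  set A := (latticeCount (interior P) : ℝ) + latticeCount (frontier P) / 2 - 1 with hAdef
  set b := (latticeCount (frontier P) : ℝ) with hbdef
  apply norm_eq_of_sq (by positivity)
  have hb0 : b ≠ 0 := by linarith
  have key : b * (s.re ^ 2 + s.im ^ 2) + 4 * s.re = 0 := by
    apply mul_left_cancel₀ hA.ne'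
    linear_combination b * h2 + 2 * h1
  field_simp
  linear_combination b * key

theorem IsLatticePolytope.roots_real_iff (hP : IsLatticePolytope P) :
    (∀ s ∈ ehrhartRoots P, s.im = 0) ↔ (latticeCount (interior P) : ℝ)
      ≤ ((latticeCount (frontier P) : ℝ) / 4 - 1) ^ 2 := by
  have hA := hP.leading_pos
  constructor
  · intro h
    by_contra! hlt
    set A := (latticeCount (interior P) : ℝ) + latticeCount (frontier P) / 2 - 1 with hAdef
    have hd : 0 < 4 * A - (latticeCount (frontier P) / 2 : ℝ) ^ 2 := by rw [hAdef]; nlinarith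
    have hroot : (⟨-(latticeCount (frontier P) / 2) / (2 * A),
        √(4 * A - (latticeCount (frontier P) / 2 : ℝ) ^ 2) / (2 * A)⟩ : ℂ) ∈ ehrhartRoots P := by
      rw [hP.mem_ehrhartRoots_iff_re_im, ← hAdef]
      constructor
      · have hsq := Real.sq_sqrt hd.le
        generalize √(4 * A - (latticeCount (frontier P) / 2 : ℝ) ^ 2) = r at hsq ⊢
        field_simp
        linear_combination -4 * hsq
      · field_simp
        ring
    have := h _ hroot
    have hpos : 0 < √(4 * A - (latticeCount (frontier P) / 2 : ℝ) ^ 2) / (2 * A) := by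
      have := Real.sqrt_pos.2 hd
      positivity
    exact hpos.ne' this
  · intro h s hs
    by_contra him
    obtain ⟨h1, h2⟩ := hP.norm_root_sq hs him
    set A := (latticeCount (interior P) : ℝ) + latticeCount (frontier P) / 2 - 1 with hAdef
    have h3 : (A * s.im) ^ 2 = A - (latticeCount (frontier P) / 2 : ℝ) ^ 2 / 4 := by
      have : (2 * A * s.re) ^ 2 = (-(latticeCount (frontier P) / 2 : ℝ)) ^ 2 := by rw [h1]
      linear_combination A * h2 - this / 4
    have h4 : 0 < (A * s.im) ^ 2 := by
      have := mul_ne_zero hA.ne' him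
      positivity
    rw [h3, hAdef] at h4
    nlinarith

/-- The roots of a polygon without interior lattice points. -/
theorem IsLatticePolytope.mem_ehrhartRoots_iff_of_interior_eq_zero (hP : IsLatticePolytope P)
    (hi : latticeCount (interior P) = 0) {s : ℂ} : s ∈ ehrhartRoots P ↔
      s = -1 ∨ s = -2 / ((latticeCount (frontier P) - 2 : ℕ) : ℂ) := by
  have h3 := hP.three_le_latticeCount_frontier
  have hc : ((latticeCount (frontier P) - 2 : ℕ) : ℂ) = latticeCount (frontier P) - 2 := by
    rw [Nat.cast_sub (by omega)]; norm_num
  have hne : (latticeCount (frontier P) : ℂ) - 2 ≠ 0 := by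
    rw [← hc]
    exact_mod_cast (by omega : latticeCount (frontier P) - 2 ≠ 0)
  rw [hP.mem_ehrhartRoots_iff, hi, hc, eq_div_iff hne]
  have : (((0 : ℕ) : ℂ) + latticeCount (frontier P) / 2 - 1) * s ^ 2
      + latticeCount (frontier P) / 2 * s + 1
        = 1 / 2 * ((s + 1) * (s * (latticeCount (frontier P) - 2) + 2)) := by
    push_cast; ring
  rw [this]
  simp only [mul_eq_zero, one_div, inv_eq_zero, OfNat.ofNat_ne_zero, false_or,
    add_eq_zero_iff_eq_neg]

theorem ehrhartRoots_of_nine (hP : IsLatticePolytope P) (hi : latticeCount (interior P) = 1)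
    (hb : latticeCount (frontier P) = 9) : ehrhartRoots P = {-2 / 3, -1 / 3} := by
  ext s
  rw [hP.mem_ehrhartRoots_iff, hi, hb, Set.mem_insert_iff, Set.mem_singleton_iff]
  have : (((1 : ℕ) : ℂ) + (9 : ℕ) / 2 - 1) * s ^ 2 + (9 : ℕ) / 2 * s + 1
      = 9 / 2 * ((s - -2 / 3) * (s - -1 / 3)) := by
    push_cast; ring
  rw [this, mul_eq_zero_iff_left (by norm_num), mul_eq_zero, sub_eq_zero, sub_eq_zero]

/-- The half-disc that contains all but three roots. -/
def rootRegion : Set ℂ := {s : ℂ | -1 / 2 ≤ s.re ∧ s.re < 0 ∧ ‖s + 2 / 3‖ ≤ 2 / 3}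

theorem mem_rootRegion_of_real {s : ℂ} (h0 : s.im = 0) (h1 : -1 / 2 ≤ s.re) (h2 : s.re < 0) :
    s ∈ rootRegion := by
  refine ⟨h1, h2, ?_⟩
  have : s + 2 / 3 = ((s.re + 2 / 3 : ℝ) : ℂ) := by
    apply Complex.ext <;> simp [h0]
  rw [this, Complex.norm_real, Real.norm_eq_abs, abs_of_nonneg] <;> linarith

/-- The location of the roots under the bound `b ≤ 2 i + 6`, which says that the Ehrhart polynomial
is nonnegative at `-1/2`. -/
theorem IsLatticePolytope.mem_rootRegion (hP : IsLatticePolytope P)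
    (hi : 1 ≤ latticeCount (interior P))
    (hb : latticeCount (frontier P) ≤ 2 * latticeCount (interior P) + 6) {s : ℂ}
    (hs : s ∈ ehrhartRoots P) : s ∈ rootRegion := by
  have hA := hP.leading_pos
  have h3 := hP.three_le_real
  have hi' : (1 : ℝ) ≤ latticeCount (interior P) := by exact_mod_cast hi
  have hb' : (latticeCount (frontier P) : ℝ) ≤ 2 * latticeCount (interior P) + 6 := by
    exact_mod_cast hb
  by_cases him : s.im = 0
  · obtain ⟨h1, -⟩ := hP.mem_ehrhartRoots_iff_re_im.1 hs
    rw [him] at h1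
    apply mem_rootRegion_of_real him
    · by_contra! hlt
      nlinarith [mul_pos (show 0 < -1 / 2 - s.re by linarith) hA,
        mul_pos (mul_pos (show 0 < -1 / 2 - s.re by linarith)
          (show 0 < -1 / 2 - s.re by linarith)) hA]
    · by_contra! hge
      have : 0 ≤ s.re ^ 2 := sq_nonneg _
      nlinarith [mul_nonneg hA.le this]
  · obtain ⟨h1, h2⟩ := hP.norm_root_sq hs him
    refine ⟨?_, ?_, ?_⟩
    · by_contra! hlt
      nlinarith
    · by_contra! hge
      nlinarith [mul_nonneg hA.le hge]
    · have hcirc := hP.norm_root_add hs him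
      set b := (latticeCount (frontier P) : ℝ) with hbdef
      have hle : 2 / b ≤ 2 / 3 := div_le_div_of_nonneg_left (by norm_num) (by norm_num) h3
      calc ‖s + 2 / 3‖ = ‖(s + ((2 / b : ℝ) : ℂ)) + ((2 / 3 - 2 / b : ℝ) : ℂ)‖ := by
            congr 1; push_cast; ring
        _ ≤ ‖s + ((2 / b : ℝ) : ℂ)‖ + ‖((2 / 3 - 2 / b : ℝ) : ℂ)‖ := norm_add_le _ _
        _ = 2 / b + (2 / 3 - 2 / b) := by
            rw [hcirc, Complex.norm_real, Real.norm_of_nonneg (by linarith)]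
        _ = 2 / 3 := by ring

theorem mem_allRoots_iff {n : ℕ} {s : ℂ} : s ∈ allRoots n ↔
    ∃ P : Set (Fin n → ℝ), IsLatticePolytope P ∧ s ∈ ehrhartRoots P := by
  simp only [allRoots, rootsWithInterior, Set.mem_iUnion, Set.mem_ofPred_eq]
  constructor
  · rintro ⟨l, P, hP, -, hs⟩
    exact ⟨P, hP, hs⟩
  · rintro ⟨P, hP, hs⟩
    exact ⟨_, P, hP, rfl, hs⟩

theorem allRoots_subset : allRoots 2 ⊆ ({-2, -1, -2 / 3} : Set ℂ) ∪ rootRegion := by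
  intro s hs
  obtain ⟨P, hP, hs⟩ := mem_allRoots_iff.1 hs
  rcases Nat.eq_zero_or_pos (latticeCount (interior P)) with hi | hi
  · rw [hP.mem_ehrhartRoots_iff_of_interior_eq_zero hi] at hs
    have h3 := hP.three_le_latticeCount_frontier
    generalize hl : latticeCount (frontier P) - 2 = l at hs
    rcases hs with rfl | rfl
    · left; simp
    · rcases (show l = 1 ∨ l = 2 ∨ l = 3 ∨ 4 ≤ l by omega) with rfl | rfl | rfl | h4
      · left; simp
      · left; norm_num
      · left; norm_num
      · right
        have h4' : (4 : ℝ) ≤ l := by exact_mod_cast h4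
        have e : (-2 / (l : ℂ)) = ((-2 / l : ℝ) : ℂ) := by push_cast; rfl
        rw [e]
        apply mem_rootRegion_of_real (Complex.ofReal_im _) <;> rw [Complex.ofReal_re]
        · rw [div_le_div_iff₀ (by norm_num) (by linarith)]; linarith
        · exact div_neg_of_neg_of_pos (by norm_num) (by linarith)
  · rcases hP.scott hi with hb | ⟨h1, h9, -⟩
    · exact Or.inr (hP.mem_rootRegion hi hb hs)
    · rw [ehrhartRoots_of_nine hP h1 h9] at hs
      rcases hs with rfl | hs
      · left; simp
      · rw [Set.mem_singleton_iff] at hs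
        right
        have e : s = ((-1 / 3 : ℝ) : ℂ) := by rw [hs]; push_cast; rfl
        rw [e]
        apply mem_rootRegion_of_real (Complex.ofReal_im _) <;> rw [Complex.ofReal_re] <;> norm_num

theorem rootsWithInterior_zero :
    rootsWithInterior 2 0 = {s : ℂ | s = -1 ∨ ∃ l : ℕ, 1 ≤ l ∧ s = -2 / (l : ℂ)} := by
  ext s
  constructor
  · rintro ⟨P, hP, hi, hs⟩
    rw [hP.mem_ehrhartRoots_iff_of_interior_eq_zero hi] at hs
    have h3 := hP.three_le_latticeCount_frontier
    exact hs.imp id fun h => ⟨_, by omega, h⟩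
  · rintro (rfl | ⟨l, hl, rfl⟩)
    · obtain ⟨P, hP, hi, -⟩ := exists_thin_triangle le_rfl
      exact ⟨P, hP, hi, (hP.mem_ehrhartRoots_iff_of_interior_eq_zero hi).2 (Or.inl rfl)⟩
    · obtain ⟨P, hP, hi, hb⟩ := exists_thin_triangle hl
      refine ⟨P, hP, hi, (hP.mem_ehrhartRoots_iff_of_interior_eq_zero hi).2 (Or.inr ?_)⟩
      rw [hb, Nat.add_sub_cancel]

/-! ### The line `Re s = -1/2` -/

/-- For `i = 1` the equation is `(b / 2) (s² + s) + 1 = 0`, which is symmetric in `s` and `-1 - s`,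
and has no two distinct real roots if `b ≤ 8`. -/
theorem IsLatticePolytope.re_eq_of_reflexive (hP : IsLatticePolytope P)
    (hi : latticeCount (interior P) = 1) (hb : latticeCount (frontier P) ≤ 8) {s : ℂ}
    (hs : s ∈ ehrhartRoots P) : s.re = -1 / 2 := by
  have h3 := hP.three_le_real
  have hb' : (latticeCount (frontier P) : ℝ) ≤ 8 := by exact_mod_cast hb
  obtain ⟨h1, h2⟩ := hP.mem_ehrhartRoots_iff_re_im.1 hs
  rw [hi] at h1 h2
  push_cast at h1 h2
  rcases mul_eq_zero.1 h2 with h0 | h0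
  · rw [h0] at h1
    have : (s.re + 1 / 2) ^ 2 ≤ 0 := by nlinarith [sq_nonneg (s.re + 1 / 2)]
    have := pow_eq_zero_iff (two_ne_zero) |>.1 (le_antisymm this (sq_nonneg _))
    linarith
  · have h0 : (latticeCount (frontier P) : ℝ) * (s.re + 1 / 2) = 0 := by linarith
    have := (mul_eq_zero.1 h0).resolve_left (by linarith)
    linarith

theorem IsLatticePolytope.of_re_eq (hP : IsLatticePolytope P) {s : ℂ}
    (hs : s ∈ ehrhartRoots P) (him : s.im ≠ 0) (hre : s.re = -1 / 2) :
    latticeCount (interior P) = 1 ∧ latticeCount (frontier P) ≤ 8 := by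
  obtain ⟨h1, h2⟩ := hP.norm_root_sq hs him
  have hA := hP.leading_pos
  rw [hre] at h1 h2
  have e1 : (latticeCount (interior P) : ℝ) = 1 := by linarith
  refine ⟨by exact_mod_cast e1, ?_⟩
  rw [e1] at h2 hA
  have : (latticeCount (frontier P) : ℝ) ≤ 8 := by
    have : 0 ≤ s.im ^ 2 := sq_nonneg _
    nlinarith
  exact_mod_cast this

/-- A square with `i = 1` and `b = 8` has the double root `-1/2`. A real root on the line is
`-1/2`, even if it belongs to a polygon with a different number of lattice points. -/
theorem neg_half_mem : ∃ P : Set (Fin 2 → ℝ), IsLatticePolytope P ∧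
    latticeCount (interior P) = 1 ∧ latticeCount (frontier P) ≤ 8 ∧
      (-1 / 2 : ℂ) ∈ ehrhartRoots P := by
  obtain ⟨P, hP, hi, hb⟩ := exists_quadrilateral (a := 4) (m := 2) (by norm_num) (by norm_num)
  have hi : latticeCount (interior P) = 1 := by omega
  refine ⟨P, hP, hi, by omega, ?_⟩
  rw [hP.mem_ehrhartRoots_iff, hi, hb]
  norm_num

theorem roots_on_line : {s : ℂ | s ∈ allRoots 2 ∧ s.re = -1 / 2}
    = {s : ℂ | ∃ P : Set (Fin 2 → ℝ), IsLatticePolytope P ∧ latticeCount (interior P) = 1 ∧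
        latticeCount (frontier P) ≤ 8 ∧ s ∈ ehrhartRoots P} := by
  ext s
  constructor
  · rintro ⟨hs, hre⟩
    obtain ⟨P, hP, hs⟩ := mem_allRoots_iff.1 hs
    by_cases him : s.im = 0
    · have : s = -1 / 2 := by
        rw [show (-1 / 2 : ℂ) = ((-1 / 2 : ℝ) : ℂ) by push_cast; rfl]
        apply Complex.ext
        · rw [hre, Complex.ofReal_re]
        · rw [him, Complex.ofReal_im]
      rw [this]
      exact neg_half_mem
    · refine ⟨P, hP, ?_⟩
      rcases Nat.eq_zero_or_pos (latticeCount (interior P)) with hi | hi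
      · rw [hP.mem_ehrhartRoots_iff_of_interior_eq_zero hi] at hs
        exfalso
        apply him
        rcases hs with rfl | rfl
        · simp
        · rw [show (-2 / ((latticeCount (frontier P) - 2 : ℕ) : ℂ))
            = ((-2 / ((latticeCount (frontier P) - 2 : ℕ) : ℝ) : ℝ) : ℂ) by push_cast; rfl]
          exact Complex.ofReal_im _
      · obtain ⟨h1, h2⟩ := hP.of_re_eq hs him hre
        exact ⟨h1, h2, hs⟩
  · rintro ⟨P, hP, hi, hb, hs⟩
    exact ⟨mem_allRoots_iff.2 ⟨P, hP, hs⟩, hP.re_eq_of_reflexive hi hb hs⟩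

theorem IsLatticePolytope.roots_on_line_iff (hP : IsLatticePolytope P) :
    (∀ s ∈ ehrhartRoots P, s.re = -1 / 2) ↔
      latticeCount (interior P) = 1 ∧ latticeCount (frontier P) ≤ 8 := by
  refine ⟨fun h => ?_, fun ⟨hi, hb⟩ s hs => hP.re_eq_of_reflexive hi hb hs⟩
  rcases Nat.eq_zero_or_pos (latticeCount (interior P)) with hi | hi
  · have := h (-1) ((hP.mem_ehrhartRoots_iff_of_interior_eq_zero hi).2 (Or.inl rfl))
    norm_num at this
  by_cases hreal : ∀ s ∈ ehrhartRoots P, s.im = 0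
  · -- two real roots on the line coincide, so the discriminant vanishes
    have hA := hP.leading_pos
    have hdisc := hP.roots_real_iff.1 hreal
    set A := (latticeCount (interior P) : ℝ) + latticeCount (frontier P) / 2 - 1 with hAdef
    set d := ((latticeCount (frontier P) : ℝ) / 2) ^ 2 - 4 * A with hd
    have hd0 : 0 ≤ d := by rw [hd, hAdef]; nlinarith
    have hsq := Real.sq_sqrt hd0
    have hroot : ∀ ε : ℝ, ε ^ 2 = 1 →
        (((-(latticeCount (frontier P) / 2) + ε * √d) / (2 * A) : ℝ) : ℂ) ∈ ehrhartRoots P := by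
      intro ε hε
      rw [hP.mem_ehrhartRoots_iff_re_im, ← hAdef, Complex.ofReal_re, Complex.ofReal_im]
      refine ⟨?_, by ring⟩
      have hr : (ε * √d) ^ 2 = d := by rw [mul_pow, hε, hsq, one_mul]
      generalize ε * √d = r at hr ⊢
      rw [hd] at hr
      field_simp
      linear_combination 4 * hr
    have r1 := h _ (hroot 1 (by norm_num))
    have r2 := h _ (hroot (-1) (by norm_num))
    rw [Complex.ofReal_re, div_eq_iff (by positivity)] at r1 r2
    have hs0 : √d = 0 := by linarith
    rw [hs0] at hsq r1
    have e1 : (latticeCount (interior P) : ℝ) = 1 := by linarith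
    have e2 : (latticeCount (frontier P) : ℝ) = 8 := by
      have h3 := hP.three_le_real
      have : (latticeCount (frontier P) : ℝ) * (latticeCount (frontier P) - 8) = 0 := by
        rw [hd, hAdef, e1] at hsq
        linarith
      have := (mul_eq_zero.1 this).resolve_left (by linarith)
      linarith
    exact ⟨by exact_mod_cast e1, le_of_eq (by exact_mod_cast e2)⟩
  · push Not at hreal
    obtain ⟨s, hs, him⟩ := hreal
    exact hP.of_re_eq hs him (h s hs)

/-! ### Cluster points -/

/-- Only finitely many roots are away from the origin and from the real interval `[-1/2, 0]`: the
non-real roots have absolute value `1 / √A`, where `A` is the area, and there are finitely many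
Ehrhart polynomials of bounded area. -/
theorem finite_roots_away {ε : ℝ} (hε : 0 < ε) :
    {s : ℂ | s ∈ allRoots 2 ∧ ε < ‖s‖ ∧ s ∉ (fun x : ℝ => (x : ℂ)) '' Set.Icc (-1 / 2 : ℝ) 0}.Finite
    := by
  obtain ⟨N, hN⟩ := exists_nat_gt (1 / ε ^ 2)
  have hfin : (⋃ i ∈ Set.Iic (2 * N + 2), ⋃ b ∈ Set.Iic (2 * N + 2),
      {s : ℂ | ((i : ℕ) + (b : ℕ) / 2 - 1 : ℂ) * s ^ 2 + (b : ℕ) / 2 * s + 1 = 0}).Finite := by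
    refine (Set.finite_Iic _).biUnion fun i _ => (Set.finite_Iic _).biUnion fun b _ => ?_
    set p : Polynomial ℂ := Polynomial.C ((i : ℕ) + (b : ℕ) / 2 - 1 : ℂ) * Polynomial.X ^ 2
      + Polynomial.C ((b : ℕ) / 2 : ℂ) * Polynomial.X + 1 with hp
    have hp0 : p ≠ 0 := by
      intro h0
      have : p.eval 0 = 1 := by simp [hp]
      rw [h0] at this
      simp at this
    refine (Polynomial.finite_setOfPred_isRoot hp0).subset fun s hs => ?_
    simpa [hp, Polynomial.IsRoot] using hs
  refine (hfin.union (Set.toFinite ({-2, -1, -2 / 3} : Set ℂ))).subset ?_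
  rintro s ⟨hs, hnorm, hreal⟩
  rcases allRoots_subset hs with h | h
  · exact Or.inr h
  left
  obtain ⟨P, hP, hs⟩ := mem_allRoots_iff.1 hs
  have him : s.im ≠ 0 := by
    intro h0
    apply hreal
    exact ⟨s.re, ⟨h.1, h.2.1.le⟩, Complex.ext (by simp) (by simp [h0])⟩
  obtain ⟨-, h2⟩ := hP.norm_root_sq hs him
  have hA := hP.leading_pos
  have hn : s.re ^ 2 + s.im ^ 2 = ‖s‖ ^ 2 := by
    rw [Complex.sq_norm, Complex.normSq_apply]; ring
  rw [hn] at h2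
  have hAN : (latticeCount (interior P) : ℝ) + latticeCount (frontier P) / 2 - 1 < N := by
    refine lt_of_le_of_lt ?_ hN
    rw [le_div_iff₀ (by positivity)]
    exact (mul_le_mul_of_nonneg_left (pow_le_pow_left₀ hε.le hnorm.le 2) hA.le).trans_eq h2
  have h3 := hP.three_le_real
  have hi0 : (0 : ℝ) ≤ latticeCount (interior P) := Nat.cast_nonneg _
  have hiN : (latticeCount (interior P) : ℝ) ≤ ((2 * N + 2 : ℕ) : ℝ) := by push_cast; linarith
  have hbN : (latticeCount (frontier P) : ℝ) ≤ ((2 * N + 2 : ℕ) : ℝ) := by push_cast; linarith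
  simp only [Set.mem_iUnion]
  exact ⟨_, by exact_mod_cast hiN, _, by exact_mod_cast hbN, hP.mem_ehrhartRoots_iff.1 hs⟩

/-- The real roots are dense in `[-1/2, 0]`. For a rational number `n / q` in the given interval,
the quadrilaterals with `a = 2 N n` and `m = N (q - n)` have roots that tend to `-n / q` with `N`,
because their Ehrhart polynomial at `-x` is `N x (q x - n) + (1 - 2 x)`. -/
theorem exists_root_between {x₁ x₂ : ℝ} (h1 : 0 < x₁) (h12 : x₁ < x₂) (h2 : x₂ ≤ 1 / 2) :
    ∃ x, x₁ < x ∧ x ≤ x₂ ∧ ((-x : ℝ) : ℂ) ∈ allRoots 2 := by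
  obtain ⟨r, hr1, hr2⟩ := exists_rat_btwn h12
  have hr0 : 0 < r := by exact_mod_cast h1.trans hr1
  obtain ⟨n, hn⟩ : ∃ n : ℕ, (n : ℤ) = r.num := ⟨r.num.toNat, Int.toNat_of_nonneg (Rat.num_pos.2 hr0).le⟩
  have hq : (0 : ℝ) < r.den := by exact_mod_cast r.den_pos
  have hrn : (r : ℝ) = n / r.den := by
    rw [Rat.cast_def, ← hn]; push_cast; rfl
  set q := r.den with hqdef
  rw [hrn] at hr1 hr2
  rw [lt_div_iff₀ hq] at hr1
  rw [div_lt_iff₀ hq] at hr2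
  have hn0 : 0 < n := by
    have : (0 : ℤ) < n := by rw [hn]; exact Rat.num_pos.2 hr0
    exact_mod_cast this
  have hnq : 2 * n < q := by
    have : (2 * n : ℝ) < q := by nlinarith
    exact_mod_cast this
  obtain ⟨N, hN⟩ := exists_nat_gt (1 / (x₁ * (n - x₁ * q)))
  have hpos : 0 < x₁ * (n - x₁ * q) := mul_pos h1 (by linarith)
  rw [div_lt_iff₀ hpos] at hN
  have hN0 : 0 < N := by
    rcases Nat.eq_zero_or_pos N with h | h
    · rw [h] at hN; norm_num at hN
    · exact h
  obtain ⟨P, hP, hi, hb⟩ := exists_quadrilateral (a := 2 * (N * n)) (m := N * (q - n))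
    (by have := Nat.mul_pos hN0 hn0; omega)
    (by
      have : N * n ≤ N * (q - n) := Nat.mul_le_mul_left _ (by omega)
      omega)
  have hi' : (latticeCount (interior P) : ℝ) = N * (q - n) - 1 := by
    have : ((latticeCount (interior P) + 1 : ℕ) : ℝ) = N * (q - n) := by
      rw [hi]; push_cast [Nat.cast_sub (show n ≤ q by omega)]; ring
    push_cast at this
    linarith
  have hb' : (latticeCount (frontier P) : ℝ) = 2 * (N * n) + 4 := by rw [hb]; push_cast; ring
  set f : ℝ → ℝ := fun x => N * x * (q * x - n) + (1 - 2 * x) with hf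
  have hcont : ContinuousOn f (Set.Icc x₁ x₂) := by fun_prop
  have hf1 : f x₁ < 0 := by simp only [hf]; nlinarith
  have hf2 : 0 ≤ f x₂ := by
    simp only [hf]
    have : 0 ≤ (N : ℝ) * x₂ * (q * x₂ - n) :=
      mul_nonneg (mul_nonneg (Nat.cast_nonneg _) (by linarith)) (by linarith)
    linarith
  obtain ⟨x, ⟨hx1, hx2⟩, hx0⟩ := intermediate_value_Icc h12.le hcont ⟨hf1.le, hf2⟩
  refine ⟨x, lt_of_le_of_ne hx1 ?_, hx2, mem_allRoots_iff.2 ⟨P, hP, ?_⟩⟩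
  · rintro rfl
    exact hf1.ne hx0
  · rw [hP.mem_ehrhartRoots_iff_re_im, Complex.ofReal_re, Complex.ofReal_im, hi', hb']
    simp only [hf] at hx0
    constructor
    · linear_combination hx0
    · ring

theorem accPt_iff_mem_Icc : {s : ℂ | AccPt s (Filter.principal (allRoots 2))}
    = (fun x : ℝ => (x : ℂ)) '' Set.Icc (-1 / 2 : ℝ) 0 := by
  apply Set.Subset.antisymm
  · intro s hs
    by_contra hK
    have hs0 : s ≠ 0 := by
      rintro rfl
      exact hK ⟨0, by norm_num, by simp⟩
    have hclosed : IsClosed ((fun x : ℝ => (x : ℂ)) '' Set.Icc (-1 / 2 : ℝ) 0) :=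
      (isCompact_Icc.image Complex.continuous_ofReal).isClosed
    have hU : {z : ℂ | ‖s‖ / 2 < ‖z‖} ∩ ((fun x : ℝ => (x : ℂ)) '' Set.Icc (-1 / 2 : ℝ) 0)ᶜ
        ∈ nhds s := by
      apply IsOpen.mem_nhds
      · exact (isOpen_lt continuous_const continuous_norm).inter hclosed.isOpen_compl
      · exact ⟨half_lt_self (norm_pos_iff.2 hs0), hK⟩
    have hacc := AccPt.nhds_inter hs hU
    refine Set.Infinite.of_accPt hacc ((finite_roots_away (half_pos (norm_pos_iff.2 hs0))).subset ?_)
    rintro z ⟨⟨h1, h2⟩, h3⟩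
    exact ⟨h3, h1, h2⟩
  · have hopen : (fun x : ℝ => (x : ℂ)) '' Set.Ioo (-1 / 2 : ℝ) 0 ⊆ derivedSet (allRoots 2) := by
      rintro _ ⟨t, ⟨ht1, ht2⟩, rfl⟩
      rw [mem_derivedSet, accPt_iff_nhds]
      intro U hU
      obtain ⟨ε, hε, hball⟩ := Metric.mem_nhds_iff.1 hU
      obtain ⟨x, hx1, hx2, hx⟩ := exists_root_between (x₁ := -t) (x₂ := min (1 / 2) (-t + ε / 2))
        (by linarith) (lt_min (by linarith) (by linarith)) (min_le_left _ _)
      have hx3 := hx2.trans (min_le_right _ _)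
      refine ⟨_, ⟨hball ?_, hx⟩, ?_⟩
      · rw [Metric.mem_ball, Complex.dist_of_im_eq (by simp)]
        simp only [Complex.ofReal_re, Real.dist_eq]
        rw [abs_lt]
        constructor <;> linarith
      · intro h
        have := Complex.ofReal_injective h
        linarith
    have hcl := closure_minimal hopen (isClosed_derivedSet _)
    refine Set.Subset.trans ?_ hcl
    rw [← closure_Ioo (by norm_num)]
    exact image_closure_subset_closure_image Complex.continuous_ofReal

end Roots

end Ehrhart

theorem theorem1p9 :
    -- i) non-real roots lie on circles
    (∀ P : Set (Fin 2 → ℝ), Ehrhart.IsLatticePolytope P →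
      ∀ s ∈ Ehrhart.ehrhartRoots P, s.im ≠ 0 →
        ‖s + 2 / (Ehrhart.latticeCount (frontier P) : ℂ)‖
          = 2 / (Ehrhart.latticeCount (frontier P) : ℝ)) ∧
    -- ii) polygons with real roots
    (∀ P : Set (Fin 2 → ℝ), Ehrhart.IsLatticePolytope P →
      ((∀ s ∈ Ehrhart.ehrhartRoots P, s.im = 0) ↔
        (Ehrhart.latticeCount (interior P) : ℝ)
          ≤ ((Ehrhart.latticeCount (frontier P) : ℝ) / 4 - 1) ^ 2)) ∧
    -- iii) location of all roots
    Ehrhart.allRoots 2 ⊆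
      ({-2, -1, -2 / 3} : Set ℂ) ∪
        {s : ℂ | -1 / 2 ≤ s.re ∧ s.re < 0 ∧ ‖s + 2 / 3‖ ≤ 2 / 3} ∧
    -- iv) cluster points
    {s : ℂ | AccPt s (Filter.principal (Ehrhart.allRoots 2))}
      = (fun x : ℝ => (x : ℂ)) '' Set.Icc (-1 / 2 : ℝ) 0 ∧
    -- v) polygons without interior lattice points
    Ehrhart.rootsWithInterior 2 0
      = {s : ℂ | s = -1 ∨ ∃ l : ℕ, 1 ≤ l ∧ s = -2 / (l : ℂ)} ∧
    -- vi) the line `Re s = -1/2`: the roots on it, ...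
    {s : ℂ | s ∈ Ehrhart.allRoots 2 ∧ s.re = -1 / 2}
      = {s : ℂ | ∃ P : Set (Fin 2 → ℝ), Ehrhart.IsLatticePolytope P ∧
          Ehrhart.latticeCount (interior P) = 1 ∧
          Ehrhart.latticeCount (frontier P) ≤ 8 ∧ s ∈ Ehrhart.ehrhartRoots P} ∧
    -- ... the polygons whose roots lie on it, ...
    (∀ P : Set (Fin 2 → ℝ), Ehrhart.IsLatticePolytope P →
      ((∀ s ∈ Ehrhart.ehrhartRoots P, s.re = -1 / 2) ↔
        Ehrhart.latticeCount (interior P) = 1 ∧ Ehrhart.latticeCount (frontier P) ≤ 8)) ∧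
    -- ... and the only remaining polygon with one interior lattice point:
    -- it has 9 boundary lattice points and roots -2/3, -1/3,
    (∀ P : Set (Fin 2 → ℝ), Ehrhart.IsLatticePolytope P →
      Ehrhart.latticeCount (interior P) = 1 → ¬ Ehrhart.latticeCount (frontier P) ≤ 8 →
        Ehrhart.latticeCount (frontier P) = 9 ∧
          Ehrhart.ehrhartRoots P = ({-2 / 3, -1 / 3} : Set ℂ)) ∧
    -- it exists,
    (∃ P : Set (Fin 2 → ℝ), Ehrhart.IsLatticePolytope P ∧
      Ehrhart.latticeCount (interior P) = 1 ∧ ¬ Ehrhart.latticeCount (frontier P) ≤ 8) ∧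
    -- and it is unique up to unimodular equivalence
    (∀ P Q : Set (Fin 2 → ℝ), Ehrhart.IsLatticePolytope P → Ehrhart.IsLatticePolytope Q →
      Ehrhart.latticeCount (interior P) = 1 → ¬ Ehrhart.latticeCount (frontier P) ≤ 8 →
      Ehrhart.latticeCount (interior Q) = 1 → ¬ Ehrhart.latticeCount (frontier Q) ≤ 8 →
        Ehrhart.UnimodularEquivalent P Q) := by
  refine ⟨fun P hP s hs him => ?_, fun P hP => hP.roots_real_iff, Ehrhart.allRoots_subset,
    Ehrhart.accPt_iff_mem_Icc, Ehrhart.rootsWithInterior_zero, Ehrhart.roots_on_line,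
    fun P hP => hP.roots_on_line_iff, fun P hP hi hb => ?_, ?_, fun P Q hP hQ hiP hbP hiQ hbQ => ?_⟩
  · have h := hP.norm_root_add hs him
    push_cast at h
    exact h
  · rcases hP.scott hi.ge with h | ⟨-, h9, -⟩
    · omega
    · exact ⟨h9, Ehrhart.ehrhartRoots_of_nine hP hi h9⟩
  · refine ⟨_, Ehrhart.isLatticePolytope_tripleSimplex, Ehrhart.latticeCount_interior_tripleSimplex,
      ?_⟩
    rw [Ehrhart.latticeCount_frontier_tripleSimplex]
    norm_num
  · rcases hP.scott hiP.ge with h | ⟨-, -, hP3⟩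
    · omega
    rcases hQ.scott hiQ.ge with h | ⟨-, -, hQ3⟩
    · omega
    exact hP3.symm.trans hQ3
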